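/- **Notation.** Let $\mathbb T=\mathbb R/2\pi\mathbb Z$, $\mathbb T^d=\mathbb R^d/2\pi\mathbb Z^d$ with Lebesgue measure, $\|\cdot\|_p=\|\cdot\|_{L_p(\mathbb T^d)}$, $1/p+1/p'=1$, $\hat f(\mathbf k)=(2\pi)^{-d}\int_{\mathbb T^d}f(\mathbf x)e^{-i(\mathbf k,\mathbf x)}d\mathbf x$, $(f*g)(x)=(2\pi)^{-1}\int_{\mathbb T}f(x-t)g(t)\,dt$ and, for $\mathbf j\in\mathbb Z_+^d$, $|\mathbf j|_1=j_1+\dots+j_d$. For families of functions $(g_{\mathbf j})_{\mathbf j\in\mathbb Z_+^d}$ put $\|g_{\mathbf j}\|_{\ell_\theta(L_p)}=(\sum_{\mathbf j}\|g_{\mathbf j}\|_p^\theta)^{1/\theta}$ ($\sup_{\mathbf j}\|g_{\mathbf j}\|_p$ if $\theta=\infty$). A sequence $(\lambda_k)_{k\in\mathbb Z}$ is a Fourier multiplier in $L_p(\mathbb T)$ if for every $f\in L_p(\mathbb T)$ there is $\lambda f\in L_p(\mathbb T)$ with Fourier coefficients $\lambda_k\hat f(k)$; then $\|\lambda\|_{M_p}=\sup_{\|f\|_p\le1}\|\lambda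 f\|_p$. *Besov spaces.* Let $\phi=(\phi_j)_{j\ge0}$ be smooth functions on $\mathbb R$ with $\operatorname{supp}\phi_0\subset\{|\xi|\le2\}$, $\operatorname{supp}\phi_j\subset\{2^{j-1}\le|\xi|\le2^{j+1}\}$ for $j\ge1$, $\sup_{j,\xi}2^{j\ell}|\phi_j^{(\ell)}(\xi)|<\infty$ for all $\ell\in\mathbb Z_+$, and $\sum_j\phi_j=1$ on $\mathbb R$. For $f\in L_1(\mathbb T^d)$ let $\delta_{\mathbf j}(f)(\mathbf x)=\sum_{\mathbf k\in\mathbb Z^d}\phi_{j_1}(k_1)\cdots\phi_{j_d}(k_d)\hat f(\mathbf k)e^{i(\mathbf k,\mathbf x)}$. The space $\mathbf B^r_{p,\theta}(\mathbb T^d)$ consists of all $f\in L_1(\mathbb T^d)$ with $\|f\|_{\mathbf B^r_{p,\theta}}=\|2^{r|\mathbf j|_1}\delta_{\mathbf j}(f)\|_{\ell_\theta(L_p)}<\infty$. *Quasi-interpolation.* Let $A_j=[-2^{j-1},2^{j-1})\cap\mathbb Z$ and $x_k^j=2\pi k/2^j$. For sequences $\varphi=(\varphi_j)_{j\ge0}$,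 $\tilde\varphi=(\tilde\varphi_j)_{j\ge0}$ of functions on $\mathbb T$ put $$Q_j(f)(x)=2^{-j}\sum_{k\in A_j}(f*\tilde\varphi_j)(x_k^j)\,\varphi_j(x-x_k^j),\qquad Q_{-1}=0,\qquad \Delta^Q_{\mathbf j}=\prod_{i=1}^d\bigl(Q^i_{j_i}-Q^i_{j_i-1}\bigr),$$ where $Q^i_j$ is $Q_j$ acting in the variable $x_i$ and the product is composition. For $\tilde\varphi_j\in L_q(\mathbb T)$ put $$\|\tilde\varphi_j\|_{\mathcal L_{q,j}}=\Bigl(2^j\int_{-\pi/2^j}^{\pi/2^j}\Bigl(2^{-j}\sum_{k\in A_j}|\tilde\varphi_j(x-x_k^j)|\Bigr)^q dx\Bigr)^{1/q},$$ with the (essential) supremum of $2^{-j}\sum_{k\in A_j}|\tilde\varphi_j(x-x_k^j)|$ if $q=\infty$. For $s>0$, $x\in\mathbb R$ and a constant $\kappa\in\mathbb C$ with $|\kappa|=1$, read $x^s$ as $|x|^s$ if $x\ge0$ and as $\kappa|x|^s$ if $x<0$. (The choice of $\kappa$ is arbitrary: $\kappa=1$ gives $|x|^s$, $\kappa=e^{i\pi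 s}$ gives the principal branch.) **Theorem.** Let $1\le p,\theta\le\infty$ and $0<r<s$, and suppose that 1) $\varphi_j\in\operatorname{span}\{e^{ikx}:k\in[-2^j,2^j)\cap\mathbb Z\}$ for all $j\ge 0$, there is $\varepsilon>0$ such that $\hat\varphi_j(k)=0$ for all $j\ge 0$ and $|k|>(1-\varepsilon)2^j$, and $\sup_j\|(\hat\varphi_j(k))_k\|_{M_p}<\infty$; 2) $\tilde\varphi_j\in L_{p'}(\mathbb T)$ for all $j\ge 0$ and $\sup_j\|\tilde\varphi_j\|_{\mathcal L_{p',j}}<\infty$; 3) (compatibility condition of order $s$) $\hat\varphi_j(0)\hat{\tilde\varphi}_j(0)=1$ for all $j\ge 0$, and there is $\delta>0$ such that $$\sup_j\Bigl\|\Bigl(\frac{1-\hat\varphi_j(k)\hat{\tilde\varphi}_j(k)}{(2^{-j}k)^s}\,\phi_0(\delta2^{-j}k)\Bigr)_k\Bigr\|_{M_p}<\infty,$$ where the entry at $k=0$ is read as $0$. Then every $f\in\mathbf B^r_{p,\theta}(\mathbb T^d)$ admits the representation $f=\sum_{\mathbf j\in\mathbb Z_+^d}\Delta^Q_{\mathbf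 j}(f)$ with unconditional convergence in $L_p(\mathbb T^d)$, and there are constants $c,C>0$, independent of $f$, such that for all $f\in\mathbf B^r_{p,\theta}(\mathbb T^d)$ $$c\,\|f\|_{\mathbf B^r_{p,\theta}}\le\|2^{r|\mathbf j|_1}\Delta^Q_{\mathbf j}(f)\|_{\ell_\theta(L_p)}\le C\,\|f\|_{\mathbf B^r_{p,\theta}}.$$ -/

import Mathlib

open MeasureTheory
open scoped ENNReal

noncomputable section

instance instFactTwoPiPos : Fact (0 < 2 * Real.pi) := ⟨Real.two_pi_pos⟩

/-- The one-dimensional torus `ℝ / 2πℤ`; its `volume` is Lebesgue measure, of total mass `2π`. -/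
abbrev Torus : Type := AddCircle (2 * Real.pi)

/-- The `d`-dimensional torus `ℝ^d / 2πℤ^d`, with the product Lebesgue measure as `volume`. -/
abbrev TorusD (d : ℕ) : Type := Fin d → Torus

/-! ### Trigonometric polynomials and Fourier multipliers on the circle -/

/-- The span of the characters `x ↦ e^{ikx}`, `k ∈ [-2^j, 2^j) ∩ ℤ`. -/
def trigPoly (j : ℕ) : Submodule ℂ (Torus → ℂ) :=
  Submodule.span ℂ ((fun k : ℤ => (fun x : Torus => fourier k x)) '' Set.Ico (-(2 : ℤ) ^ j) (2 ^ j))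

/-- `g` is the image of `f` under the sequence `lam`: the Fourier coefficients of `g` are
`lam k * f̂(k)`. -/
def IsMultiplierImage (lam : ℤ → ℂ) (f g : Torus → ℂ) : Prop :=
  ∀ k : ℤ, fourierCoeff g k = lam k * fourierCoeff f k

/-- `lam` is a Fourier multiplier in `L_p(𝕋)`. -/
def IsFourierMultiplier (p : ℝ≥0∞) (lam : ℤ → ℂ) : Prop :=
  ∀ f : Torus → ℂ, MemLp f p volume → ∃ g : Torus → ℂ, MemLp g p volume ∧ IsMultiplierImage lam f g

/-- The multiplier norm: the supremum of `‖lam f‖_p` over `‖f‖_p ≤ 1`. -/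
def multiplierNorm (p : ℝ≥0∞) (lam : ℤ → ℂ) : ℝ≥0∞ :=
  ⨆ (f : Torus → ℂ) (g : Torus → ℂ) (_ : MemLp f p volume) (_ : eLpNorm f p volume ≤ 1)
    (_ : MemLp g p volume) (_ : IsMultiplierImage lam f g), eLpNorm g p volume

/-- Each `lam j` is a Fourier multiplier in `L_p(𝕋)`, and `sup_j ‖lam j‖_{M_p(𝕋)} < ∞`. -/
def UniformlyBoundedMultipliers (p : ℝ≥0∞) (lam : ℕ → ℤ → ℂ) : Prop :=
  (∀ j, IsFourierMultiplier p (lam j)) ∧ ⨆ j, multiplierNorm p (lam j) < ∞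

/-! ### Quasi-interpolation operators and their differences -/

/-- `A_j = [-2^{j-1}, 2^{j-1}) ∩ ℤ`. -/
def nodeIdx (j : ℕ) : Finset ℤ :=
  (Finset.Ico (-(2 : ℤ) ^ j) (2 ^ j)).filter fun k => -(2 : ℤ) ^ j ≤ 2 * k ∧ 2 * k < 2 ^ j

/-- `x_k^j = π k / 2^{j-1} = 2 π k / 2^j`, as a real number. -/
def node (j : ℕ) (k : ℤ) : ℝ := 2 * Real.pi * k / 2 ^ j

/-- The convolution `(f * g)(x) = (2π)⁻¹ ∫_𝕋 f(x - t) g(t) dt`. -/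
def conv (f g : Torus → ℂ) (x : Torus) : ℂ :=
  (((2 * Real.pi)⁻¹ : ℝ) : ℂ) * ∫ t : Torus, f (x - t) * g t

/-- The univariate operator
`Q_j(h)(x) = 2^{-j} ∑_{k ∈ A_j} (h * φt_j)(x_k^j) φ_j(x - x_k^j)`. -/
def quasiInterp (φ φt : ℕ → Torus → ℂ) (j : ℕ) (h : Torus → ℂ) (x : Torus) : ℂ :=
  ((2 : ℂ) ^ j)⁻¹ * ∑ k ∈ nodeIdx j,
    conv h (φt j) ((node j k : ℝ) : Torus) * φ j (x - ((node j k : ℝ) : Torus))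

/-- `Q_j - Q_{j-1}`, where `Q_{-1} = 0`. -/
def quasiInterpDiff (φ φt : ℕ → Torus → ℂ) : ℕ → (Torus → ℂ) → Torus → ℂ
  | 0, h => quasiInterp φ φt 0 h
  | j + 1, h => fun x => quasiInterp φ φt (j + 1) h x - quasiInterp φ φt j h x

/-- A univariate operator `U` applied to a `d`-variate function in the variable `x_i`. -/
def inVariable {d : ℕ} (i : Fin d) (U : (Torus → ℂ) → Torus → ℂ) (f : TorusD d → ℂ) :
    TorusD d → ℂ :=
  fun x => U (fun t => f (Function.update x i t)) (x i)

/-- `Δ_j^Q(f) = ∏_{i=1}^d (Q_{j_i}^i - Q_{j_i-1}^i) f`, the product being composition. -/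
def mixedDiff {d : ℕ} (φ φt : ℕ → Torus → ℂ) (j : Fin d → ℕ) (f : TorusD d → ℂ) : TorusD d → ℂ :=
  (List.finRange d).foldr (fun i g => inVariable i (quasiInterpDiff φ φt (j i)) g) f

/-- The special norm `‖g‖_{ℒ_{q,j}}`: the `L_q` norm of `x ↦ 2^{-j} ∑_{k ∈ A_j} |g(x - x_k^j)|` over
`2^{-j}𝕋`, an interval of length `2π / 2^j`, with respect to `2^j` times Lebesgue measure. For
`q = ∞` it is the essential supremum, over one period of the `2π / 2^j`-periodic function. -/
def specialNorm (q : ℝ≥0∞) (j : ℕ) (g : Torus → ℂ) : ℝ≥0∞ :=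
  eLpNorm (fun x : ℝ => ((2 : ℝ) ^ j)⁻¹ * ∑ k ∈ nodeIdx j, ‖g ((x - node j k : ℝ) : Torus)‖) q
    ((2 : ℝ≥0∞) ^ j • volume.restrict (Set.Ioc (-(Real.pi / 2 ^ j)) (Real.pi / 2 ^ j)))

/-! ### Besov spaces of dominating mixed smoothness -/

/-- Smooth dyadic resolutions of unity. The two support conditions imply compact support. -/
structure IsSmoothResolution (ψ : ℕ → ℝ → ℂ) : Prop where
  smooth : ∀ j, ContDiff ℝ ((⊤ : ℕ∞) : WithTop ℕ∞) (ψ j)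
  support_zero : ∀ ξ : ℝ, ψ 0 ξ ≠ 0 → |ξ| ≤ 2
  support_pos : ∀ j : ℕ, 1 ≤ j → ∀ ξ : ℝ, ψ j ξ ≠ 0 →
    (2 : ℝ) ^ ((j : ℤ) - 1) ≤ |ξ| ∧ |ξ| ≤ (2 : ℝ) ^ (j + 1)
  deriv_bound : ∀ l : ℕ, ∃ c : ℝ, ∀ (j : ℕ) (ξ : ℝ), (2 : ℝ) ^ (j * l) * ‖iteratedDeriv l (ψ j) ξ‖ ≤ c
  sum_eq_one : ∀ ξ : ℝ, HasSum (fun j => ψ j ξ) 1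

/-- `x ↦ e^{i(k,x)}`. -/
def mChar {d : ℕ} (k : Fin d → ℤ) (x : TorusD d) : ℂ := ∏ i, fourier (k i) (x i)

/-- `f̂(k) = (2π)^{-d} ∫ f(x) e^{-i(k,x)} dx`. -/
def mCoeff {d : ℕ} (f : TorusD d → ℂ) (k : Fin d → ℤ) : ℂ :=
  ((((2 * Real.pi) ^ d)⁻¹ : ℝ) : ℂ) * ∫ x : TorusD d, f x * mChar (-k) x

/-- `δ_j(f)(x) = ∑_k ψ_{j_1}(k_1) ⋯ ψ_{j_d}(k_d) f̂(k) e^{i(k,x)}`; for a resolution of unity only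
finitely many terms are nonzero. -/
def dyadicBlock {d : ℕ} (ψ : ℕ → ℝ → ℂ) (j : Fin d → ℕ) (f : TorusD d → ℂ) (x : TorusD d) : ℂ :=
  ∑' k : Fin d → ℤ, (∏ i, ψ (j i) (k i : ℝ)) * mCoeff f k * mChar k x

/-- The norm of `ℓ_θ(L_p(𝕋^d))` of a family of functions indexed by `ℤ_+^d`. -/
def ellLpNorm {d : ℕ} (θ p : ℝ≥0∞) (g : (Fin d → ℕ) → TorusD d → ℂ) : ℝ≥0∞ :=
  if θ = ∞ then ⨆ j, eLpNorm (g j) p volume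
  else (∑' j, eLpNorm (g j) p volume ^ θ.toReal) ^ (1 / θ.toReal)

/-- The family `2^{r|j|_1} g_j`. -/
def weighted {d : ℕ} (r : ℝ) (g : (Fin d → ℕ) → TorusD d → ℂ) : (Fin d → ℕ) → TorusD d → ℂ :=
  fun j x => (((2 : ℝ) ^ (r * ∑ i, (j i : ℝ)) : ℝ) : ℂ) * g j x

/-- The norm of `B^r_{p,θ}(𝕋^d)`. -/
def besovNorm {d : ℕ} (ψ : ℕ → ℝ → ℂ) (p θ : ℝ≥0∞) (r : ℝ) (f : TorusD d → ℂ) : ℝ≥0∞ :=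
  ellLpNorm θ p (weighted r fun j => dyadicBlock ψ j f)

/-- Membership in `B^r_{p,θ}(𝕋^d)`. -/
def MemBesov {d : ℕ} (ψ : ℕ → ℝ → ℂ) (p θ : ℝ≥0∞) (r : ℝ) (f : TorusD d → ℂ) : Prop :=
  Integrable f volume ∧ besovNorm ψ p θ r f < ∞

/-! ### The compatibility condition -/

/-- The power `x^s` on the whole real line: `|x|^s` for `x ≥ 0` and `κ |x|^s` for `x < 0`. The
constant `κ` fixes the branch: `κ = 1` gives `|x|^s`, `κ = e^{iπs}` gives the principal branch of
`x^s`, and `κ = e^{-iπs}` gives a constant multiple of `(ix)^s`. -/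
def branchPow (κ : ℂ) (s x : ℝ) : ℂ := (if x < 0 then κ else 1) * ((|x| ^ s : ℝ) : ℂ)

/-- The sequence `k ↦ (1 - φ̂_j(k) φt̂_j(k)) / (2^{-j}k)^s · ψ_0(δ 2^{-j} k)`. At `k = 0`, where for
`s > 0` the denominator vanishes, its value is `0`. -/
def compatSeq (ψ : ℕ → ℝ → ℂ) (φ φt : ℕ → Torus → ℂ) (κ : ℂ) (s δ : ℝ) (j : ℕ) (k : ℤ) : ℂ :=
  (1 - fourierCoeff (φ j) k * fourierCoeff (φt j) k) / branchPow κ s ((k : ℝ) / 2 ^ j) *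
    ψ 0 (δ * ((k : ℝ) / 2 ^ j))

/-- The compatibility condition of order `s`. Its first part says that the quotient makes sense at
`k = 0`, i.e. that the numerator vanishes there. -/
def Compatibility (ψ : ℕ → ℝ → ℂ) (φ φt : ℕ → Torus → ℂ) (p : ℝ≥0∞) (κ : ℂ) (s : ℝ) : Prop :=
  (∀ j, fourierCoeff (φ j) 0 * fourierCoeff (φt j) 0 = 1) ∧
    ∃ δ : ℝ, 0 < δ ∧ UniformlyBoundedMultipliers p (compatSeq ψ φ φt κ s δ)

end

/-!
The proof compares the mixed differences `Δ_j = ∏_i (Q^i_{j_i} - Q^i_{j_i-1})` with the dyadic blocks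
`δ_m` through almost diagonal estimates.

In one variable, `Q_j` is a sampling operator followed by a synthesis operator at the `2^j` nodes.
Sampling `h * φt_j` maps `L_p` to `ℓ_p` of the nodes with a norm governed by the special norm of
`φt_j` (`enorm_conv_nodes_le`). Synthesis with `φ_j` is the multiplier `φ̂_j` applied to synthesis with
a kernel of de la Vallée Poussin type, which is dominated by a Fejér partition of unity
(`eLpNorm_synthesis_le`). Hence the `Q_j` are uniformly bounded on `L_p` (`eLpNorm_quasiInterp_le`).
On low frequencies there is no aliasing, and `Q_j` is the multiplier `φ̂_j φt̂_j`
(`quasiInterp_trigSum`); the compatibility condition and a fractional Bernstein inequality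
(`exists_bernstein`) then show that `I - Q_j` is `O(2^{-s(j-m)})` on the `m`-th dyadic block
(`exists_approximation_bound`), so that `Q_j - Q_{j-1}` is `O(2^{-s max(j-m,0)})` there
(`exists_quasiInterpDiff_bound`).

In `d` variables these bounds hold on slices, hence for the operators acting in one variable, and
multiply up under composition: `‖Δ_j(δ_m f)‖_p ≤ C ∏_i 2^{-s max(j_i-m_i,0)} ‖δ_m f‖_p`
(`mixedDiff_mTrigSpan`). Since `0 < r < s`, the weights `2^{r|j|_1}` turn this into exponential decay
in `|j_i - m_i|` (`weight_mul_prod_decay_le`). Schur's test (`ellNorm_kernel_le`) gives the upper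
bound. Moreover, the double family `Δ_j(δ_m f)` is absolutely summable; it sums to `δ_m f` over `j`,
by telescoping along boxes, and to `Δ_j(f)` over `m`, so interchanging the sums gives the
representation of `f` (`hasSum_mixedDiff`). Conversely, the spectrum of `Δ_m(f)` lies in the box
`∏_i [-2^{m_i}, 2^{m_i})`, so that only the terms with `j_i ≤ m_i + 1` contribute to
`δ_j(f) = ∑_m δ_j(Δ_m(f))`; as `r > 0`, Schur's test applies again and yields the lower bound
(`besovNorm_le`).
-/

open scoped NNReal

noncomputable section

/-! ### Trigonometric sums and Fourier multipliers on the circle -/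

/-- The trigonometric polynomial `∑_{k ∈ F} c_k e^{ikx}`. -/
def trigSum (F : Finset ℤ) (c : ℤ → ℂ) (x : Torus) : ℂ := ∑ k ∈ F, c k * fourier k x

/-- Multiplying the coefficients of a trigonometric polynomial by `lam` increases its `L_p` norm by
a factor of at most `M`. -/
def MultBound (p : ℝ≥0∞) (lam : ℤ → ℂ) (M : ℝ≥0) : Prop :=
  ∀ (F : Finset ℤ) (c : ℤ → ℂ),
    eLpNorm (trigSum F fun k => lam k * c k) p volume ≤ M * eLpNorm (trigSum F c) p volume

theorem continuous_trigSum (F : Finset ℤ) (c : ℤ → ℂ) : Continuous (trigSum F c) := by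
  unfold trigSum
  fun_prop

theorem continuous_memLp {X : Type*} [TopologicalSpace X] [CompactSpace X] [MeasurableSpace X]
    [BorelSpace X] {μ : Measure X} [IsFiniteMeasure μ] {f : X → ℂ} (hf : Continuous f)
    (p : ℝ≥0∞) : MemLp f p μ := by
  obtain ⟨C, hC⟩ := isCompact_univ.exists_bound_of_continuousOn hf.continuousOn
  exact MemLp.of_bound (hf.aestronglyMeasurable_of_compactSpace) C
    (Filter.Eventually.of_forall fun x => hC x (Set.mem_univ x))

theorem trigSum_congr {F : Finset ℤ} {c c' : ℤ → ℂ} (h : ∀ k ∈ F, c k = c' k) :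
    trigSum F c = trigSum F c' := by
  funext x
  exact Finset.sum_congr rfl fun k hk => by rw [h k hk]

theorem trigSum_subset {F G : Finset ℤ} {c : ℤ → ℂ} (h : F ⊆ G) (hc : ∀ k ∈ G, k ∉ F → c k = 0) :
    trigSum F c = trigSum G c := by
  funext x
  exact Finset.sum_subset h fun k hk hk' => by rw [hc k hk hk', zero_mul]

theorem fourierCoeff_trigSum (F : Finset ℤ) (c : ℤ → ℂ) (n : ℤ) :
    fourierCoeff (trigSum F c) n = if n ∈ F then c n else 0 := by
  have h : trigSum F c = ∑ k ∈ F, (c k) • (fun x : Torus => fourier k x) := by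
    funext x
    simp [trigSum]
  have hi : ∀ k ∈ F, Integrable ((c k) • (fun x : Torus => fourier k x))
      AddCircle.haarAddCircle := fun k _ =>
    (continuous_memLp (p := 1) (by fun_prop)).integrable le_rfl
  rw [h, fourierCoeff.sum F _ hi]
  simp only [Finset.sum_apply, fourierCoeff.const_smul, fourierCoeff_fourier, smul_eq_mul]
  rw [← Finset.sum_ite_eq F n c]
  refine Finset.sum_congr rfl fun k _ => ?_
  simp [Pi.single_apply]

/-- The multiplier norm controls the action on trigonometric polynomials. If a trigonometric polynomial
has norm zero, then its coefficients vanish; otherwise it can be normalized. -/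
theorem multBound_of_multiplierNorm_le {p : ℝ≥0∞} (hp : 1 ≤ p) {lam : ℤ → ℂ} {M : ℝ≥0}
    (h : multiplierNorm p lam ≤ M) : MultBound p lam M := by
  intro F c
  have hfin := (continuous_memLp (μ := volume) (continuous_trigSum F c) p).eLpNorm_ne_top
  by_cases h0 : eLpNorm (trigSum F c) p volume = 0
  · rw [eLpNorm_eq_zero_iff (continuous_trigSum F c).aestronglyMeasurable_of_compactSpace
      (by positivity)] at h0
    have h0' : trigSum F c =ᵐ[AddCircle.haarAddCircle] 0 := by
      rw [AddCircle.volume_eq_smul_haarAddCircle] at h0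
      rw [Filter.EventuallyEq, Measure.ae_ennreal_smul_measure_iff] at h0
      · exact h0
      · simpa using Real.pi_pos
    have hc : ∀ k ∈ F, c k = 0 := fun k hk => by
      have := fourierCoeff_trigSum F c k
      rw [fourierCoeff_congr_ae h0', if_pos hk] at this
      rw [← this]
      simp [fourierCoeff]
    have : trigSum F (fun k => lam k * c k) = 0 := by
      funext x
      exact Finset.sum_eq_zero fun k hk => by simp [hc k hk]
    rw [this]
    simp
  · set a := (eLpNorm (trigSum F c) p volume).toReal with ha
    have ha0 : 0 < a := ENNReal.toReal_pos h0 hfin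
    have hae : eLpNorm (trigSum F c) p volume = ENNReal.ofReal a := (ENNReal.ofReal_toReal hfin).symm
    have hs : ∀ c' : ℤ → ℂ, eLpNorm (trigSum F fun k => (a : ℂ)⁻¹ * c' k) p volume
        = (ENNReal.ofReal a)⁻¹ * eLpNorm (trigSum F c') p volume := fun c' => by
      have : (trigSum F fun k => (a : ℂ)⁻¹ * c' k) = (a : ℂ)⁻¹ • trigSum F c' := by
        funext x
        simp [trigSum, Finset.mul_sum, mul_assoc]
      rw [this, eLpNorm_const_smul]
      congr 1
      rw [enorm_inv (by exact_mod_cast ha0.ne')]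
      congr 1
      rw [← ofReal_norm]
      simp [abs_of_pos ha0]
    have key := hs (fun k => lam k * c k)
    have : eLpNorm (trigSum F fun k => (a : ℂ)⁻¹ * (lam k * c k)) p volume ≤ M := by
      refine le_trans ?_ h
      unfold multiplierNorm
      refine le_iSup_of_le (trigSum F fun k => (a : ℂ)⁻¹ * c k) ?_
      refine le_iSup_of_le (trigSum F fun k => (a : ℂ)⁻¹ * (lam k * c k)) ?_
      refine le_iSup_of_le (continuous_memLp (continuous_trigSum _ _) p) ?_
      refine le_iSup_of_le ?_ ?_
      · rw [hs, hae, ENNReal.inv_mul_cancel] <;> simp [ha0]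
      refine le_iSup_of_le (continuous_memLp (continuous_trigSum _ _) p) ?_
      refine le_iSup_of_le ?_ le_rfl
      intro k
      rw [fourierCoeff_trigSum, fourierCoeff_trigSum]
      split_ifs <;> ring
    rw [key, mul_comm, ← div_eq_mul_inv, ENNReal.div_le_iff (by simpa using ha0) (by simp)] at this
    rwa [hae]

/-- Parseval's identity for a trigonometric polynomial. -/
theorem integral_norm_sq_trigSum (F : Finset ℤ) (c : ℤ → ℂ) :
    ∫ x, ‖trigSum F c x‖ ^ 2 ∂(volume : Measure Torus) = 2 * Real.pi * ∑ k ∈ F, ‖c k‖ ^ 2 := by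
  have hC : ∫ x, (starRingEnd ℂ (trigSum F c x)) * trigSum F c x ∂(volume : Measure Torus)
      = 2 * Real.pi * ∑ k ∈ F, (starRingEnd ℂ (c k)) * c k := by
    have h1 : ∀ x : Torus, (starRingEnd ℂ (trigSum F c x)) * trigSum F c x
        = ∑ k ∈ F, (starRingEnd ℂ (c k)) * (fourier (-k) x • trigSum F c x) := fun x => by
      rw [trigSum, map_sum, Finset.sum_mul]
      refine Finset.sum_congr rfl fun k _ => ?_
      rw [map_mul, fourier_neg, smul_eq_mul, mul_assoc]
    simp_rw [h1]
    rw [integral_finsetSum]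
    · rw [Finset.mul_sum]
      refine Finset.sum_congr rfl fun k hk => ?_
      rw [integral_const_mul]
      have h2 := fourierCoeff_trigSum F c k
      rw [fourierCoeff, AddCircle.integral_haarAddCircle, if_pos hk] at h2
      have hpi : (2 * Real.pi : ℝ) ≠ 0 := by positivity
      rw [inv_smul_eq_iff₀ hpi] at h2
      rw [h2]
      simp only [Complex.real_smul]
      push_cast
      ring
    · intro k _
      refine (continuous_memLp (p := 1) ?_).integrable le_rfl
      have := continuous_trigSum F c
      fun_prop
  have h3 : ∀ z : ℂ, (starRingEnd ℂ z) * z = ((‖z‖ ^ 2 : ℝ) : ℂ) := fun z => by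
    rw [Complex.conj_mul']
    push_cast
    rfl
  simp_rw [h3] at hC
  rw [integral_complex_ofReal] at hC
  exact_mod_cast hC

theorem eLpNorm_comp_sub_right (h : Torus → ℂ) (hh : AEStronglyMeasurable h volume) (p : ℝ≥0∞)
    (t : Torus) : eLpNorm (fun x => h (x - t)) p volume = eLpNorm h p volume :=
  eLpNorm_comp_measurePreserving hh (measurePreserving_sub_right volume t)

/-- Young's inequality for the convolution of two continuous functions on the circle. -/
theorem eLpNorm_conv_le {p : ℝ≥0∞} [Fact (1 ≤ p)] {K h : Torus → ℂ} (hK : Continuous K)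
    (hh : Continuous h) :
    eLpNorm (fun x => ∫ t, K t * h (x - t)) p volume
      ≤ ENNReal.ofReal (∫ t, ‖K t‖) * eLpNorm h p volume := by
  -- The convolution is an integral with values in `C(𝕋)`, which is then mapped to `L_p`.
  let τ : C(Torus, C(Torus, ℂ)) :=
    ContinuousMap.curry ⟨fun z : Torus × Torus => K z.1 * h (z.2 - z.1), by fun_prop⟩
  have hτ : ∀ t x, τ t x = K t * h (x - t) := fun t x => rfl
  have hint : Integrable (fun t => τ t) (volume : Measure Torus) := by
    have := τ.continuous.continuousOn (s := Set.univ)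
      |>.integrableOn_compact (μ := (volume : Measure Torus)) isCompact_univ
    rwa [integrableOn_univ] at this
  let L := ContinuousMap.toLp (E := ℂ) p (volume : Measure Torus) ℂ
  have hv : ∀ x, (∫ t, τ t) x = ∫ t, K t * h (x - t) := fun x => by
    have := (ContinuousMap.evalCLM ℂ x : C(Torus, ℂ) →L[ℂ] ℂ).integral_comp_comm hint
    simp only [ContinuousMap.evalCLM_apply] at this
    rw [← this]
    rfl
  have hL : ∀ g : C(Torus, ℂ), eLpNorm g p volume = ENNReal.ofReal ‖L g‖ := fun g => by
    rw [Lp.norm_def, ENNReal.ofReal_toReal (Lp.eLpNorm_ne_top _)]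
    exact (eLpNorm_congr_ae (ContinuousMap.coeFn_toLp (𝕜 := ℂ) volume g)).symm
  have hnorm : ∀ t, ‖L (τ t)‖ = ‖K t‖ * ‖L ⟨h, hh⟩‖ := fun t => by
    have h1 : τ t = K t • ContinuousMap.comp ⟨h, hh⟩ ⟨fun x : Torus => x - t, by fun_prop⟩ := by
      ext x
      rfl
    rw [h1, map_smul, norm_smul]
    congr 1
    have h2 := hL (ContinuousMap.comp ⟨h, hh⟩ ⟨fun x : Torus => x - t, by fun_prop⟩)
    have h3 := hL ⟨h, hh⟩
    have h4 := eLpNorm_comp_sub_right h hh.aestronglyMeasurable_of_compactSpace p t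
    change eLpNorm (fun x => h (x - t)) p volume = _ at h2
    change eLpNorm h p volume = _ at h3
    rw [h4, h3] at h2
    exact ((ENNReal.ofReal_eq_ofReal_iff (norm_nonneg _) (norm_nonneg _)).1 h2).symm
  have h5 : (fun x => ∫ t, K t * h (x - t)) = ⇑(∫ t, τ t) := funext fun x => (hv x).symm
  rw [h5, hL, ← L.integral_comp_comm hint]
  have h6 := hL ⟨h, hh⟩
  change eLpNorm h p volume = _ at h6
  rw [h6, ← ENNReal.ofReal_mul (by positivity)]
  refine ENNReal.ofReal_le_ofReal ?_
  refine (norm_integral_le_integral_norm _).trans ?_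
  simp_rw [hnorm]
  rw [integral_mul_const]

theorem conv_trigSum (K : Torus → ℂ) (hK : Continuous K) (F : Finset ℤ) (c : ℤ → ℂ) (x : Torus) :
    ∫ t, K t * trigSum F c (x - t)
      = 2 * Real.pi * trigSum F (fun k => fourierCoeff K k * c k) x := by
  have h1 : ∀ t : Torus, K t * trigSum F c (x - t)
      = ∑ k ∈ F, (c k * fourier k x) * (fourier (-k) t • K t) := fun t => by
    rw [trigSum, Finset.mul_sum]
    refine Finset.sum_congr rfl fun k _ => ?_
    have : (fourier k (x - t) : ℂ) = fourier k x * fourier (-k) t := by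
      simp [fourier_apply, sub_eq_add_neg, AddCircle.toCircle_add]
    rw [this, smul_eq_mul]
    ring
  simp_rw [h1]
  rw [integral_finsetSum]
  · rw [trigSum, Finset.mul_sum]
    refine Finset.sum_congr rfl fun k hk => ?_
    rw [integral_const_mul, fourierCoeff, AddCircle.integral_haarAddCircle]
    simp only [Complex.real_smul]
    push_cast
    have : (Real.pi : ℂ) ≠ 0 := by exact_mod_cast Real.pi_ne_zero
    field_simp
  · intro k _
    refine (continuous_memLp (p := 1) ?_).integrable le_rfl
    fun_prop

/-- The weight `N / (1 + N² |e^{it} - 1|²)` has integral bounded independently of `N`. -/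
theorem integral_weight_le {N : ℝ} (hN : 0 < N) :
    ∫ t : Torus, N / (1 + N ^ 2 * ‖(fourier 1 t : ℂ) - 1‖ ^ 2) ≤ Real.pi ^ 2 / 2 := by
  have hpi := Real.pi_pos
  rw [← AddCircle.intervalIntegral_preimage (2 * Real.pi) (-Real.pi)]
  have e1 : -Real.pi + 2 * Real.pi = Real.pi := by ring
  rw [e1]
  set a : ℝ := 2 * N / Real.pi with ha
  have ha0 : 0 < a := by positivity
  have hcont : Continuous fun t : ℝ =>
      N / (1 + N ^ 2 * ‖(fourier 1 (t : Torus) : ℂ) - 1‖ ^ 2) := by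
    refine Continuous.div (by fun_prop) ?_ fun t => by positivity
    have : Continuous fun t : ℝ => (fourier 1 (t : Torus) : ℂ) :=
      (map_continuous (fourier (T := 2 * Real.pi) 1)).comp (AddCircle.continuous_mk' _)
    fun_prop
  have hcont2 : Continuous fun t : ℝ => N * (1 + (a * t) ^ 2)⁻¹ := by
    refine Continuous.mul (by fun_prop) (Continuous.inv₀ (by fun_prop) fun t => by positivity)
  calc ∫ t in -Real.pi..Real.pi, N / (1 + N ^ 2 * ‖(fourier 1 (t : Torus) : ℂ) - 1‖ ^ 2)
      ≤ ∫ t in -Real.pi..Real.pi, N * (1 + (a * t) ^ 2)⁻¹ := by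
        refine intervalIntegral.integral_mono_on (by linarith) (hcont.intervalIntegrable _ _)
          (hcont2.intervalIntegrable _ _) fun t ht => ?_
        rw [div_eq_mul_inv]
        have hf : (fourier 1 (t : Torus) : ℂ) = Complex.exp (Complex.I * t) := by
          rw [fourier_coe_apply]
          congr 1
          have : (Real.pi : ℂ) ≠ 0 := by exact_mod_cast Real.pi_ne_zero
          push_cast
          field_simp
        have hs : 2 / Real.pi * |t / 2| ≤ |Real.sin (t / 2)| := by
          refine Real.mul_abs_le_abs_sin ?_
          rw [abs_le]
          constructor <;> linarith [ht.1, ht.2]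
        have hb : 2 / Real.pi * |t| ≤ ‖(fourier 1 (t : Torus) : ℂ) - 1‖ := by
          rw [hf, Complex.norm_exp_I_mul_ofReal_sub_one, norm_mul, Real.norm_eq_abs,
            Real.norm_eq_abs, abs_two]
          rw [abs_div, abs_two] at hs
          calc 2 / Real.pi * |t| = 2 * (2 / Real.pi * (|t| / 2)) := by ring
            _ ≤ _ := by gcongr
        have : (a * t) ^ 2 ≤ N ^ 2 * ‖(fourier 1 (t : Torus) : ℂ) - 1‖ ^ 2 := by
          calc (a * t) ^ 2 = N ^ 2 * (2 / Real.pi * |t|) ^ 2 := by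
                rw [mul_pow, mul_pow, sq_abs, ha]; ring
            _ ≤ _ := by gcongr
        gcongr
    _ = N * (a⁻¹ * (Real.arctan (a * Real.pi) - Real.arctan (a * -Real.pi))) := by
        rw [intervalIntegral.integral_const_mul,
          intervalIntegral.integral_comp_mul_left (fun x => (1 + x ^ 2)⁻¹) ha0.ne',
          integral_inv_one_add_sq, smul_eq_mul]
    _ ≤ N * (a⁻¹ * Real.pi) := by
        have h1 := Real.arctan_lt_pi_div_two (a * Real.pi)
        have h2 := Real.neg_pi_div_two_lt_arctan (a * -Real.pi)
        gcongr
        linarith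
    _ = Real.pi ^ 2 / 2 := by
        rw [ha]
        field_simp

/-- A multiplier at scale `N`, that is, one supported in `|k| < R ≲ N`, bounded by `A` and with
differences bounded by `A / N`, is bounded on all `L_p`: its kernel `K` has bounded `L_1` norm,
as `|K| ≤ ½ (|K|² w / (N A) + N A / w)` with the weight `w = 1 + N² |e^{it} - 1|²`. -/
theorem multBound_of_lipschitz {p : ℝ≥0∞} [Fact (1 ≤ p)] {lam : ℤ → ℂ} {A : ℝ≥0} (hA : 0 < A)
    {N R : ℕ} (hN : 0 < N) (hR : 2 * R + 1 ≤ 7 * N) (hsupp : ∀ k, lam k ≠ 0 → |k| < R)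
    (hb : ∀ k, ‖lam k‖ ≤ A) (hd : ∀ k, ‖lam (k + 1) - lam k‖ ≤ A / N) :
    MultBound p lam (8 * A) := by
  have hN' : (0 : ℝ) < N := by exact_mod_cast hN
  have hA' : (0 : ℝ) < A := by exact_mod_cast hA
  set G : Finset ℤ := Finset.Icc (-(R : ℤ)) R with hG
  have hGc : (G.card : ℝ) ≤ 7 * N := by
    have : G.card = 2 * R + 1 := by rw [hG, Int.card_Icc]; omega
    rw [this]
    exact_mod_cast hR
  set K := trigSum G lam with hK
  have hKc : Continuous K := continuous_trigSum _ _
  have h0 : ∀ k : ℤ, (R : ℤ) ≤ |k| → lam k = 0 := fun k hk => by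
    by_contra h
    exact absurd (hsupp k h) (not_lt.2 hk)
  have hcoef : ∀ k, fourierCoeff K k = lam k := fun k => by
    rw [hK, fourierCoeff_trigSum]
    split_ifs with h
    · rfl
    · refine (h0 k ?_).symm
      rw [hG, Finset.mem_Icc, ← abs_le] at h
      exact (not_le.1 h).le
  have hshift : ∀ t : Torus, ((fourier 1 t : ℂ) - 1) * K t
      = trigSum G (fun k => lam (k - 1) - lam k) t := fun t => by
    have e1 : (fourier 1 t : ℂ) * K t = trigSum G (fun k => lam (k - 1)) t := by
      have e2 : (fourier 1 t : ℂ) * K t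
          = trigSum (G.map (addRightEmbedding 1)) (fun k => lam (k - 1)) t := by
        simp only [hK, trigSum, Finset.sum_map, Finset.mul_sum, addRightEmbedding_apply,
          add_sub_cancel_right, fourier_add]
        exact Finset.sum_congr rfl fun k _ => by ring
      have e3 : trigSum (G.map (addRightEmbedding 1)) (fun k => lam (k - 1))
          = trigSum (Finset.Icc (-(R : ℤ)) (R + 1)) (fun k => lam (k - 1)) := by
        refine trigSum_subset (fun k hk => ?_) fun k hk hk' => h0 _ ?_
        · simp only [Finset.mem_map, addRightEmbedding_apply, hG, Finset.mem_Icc] at hk ⊢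
          obtain ⟨a, ha, rfl⟩ := hk
          omega
        · simp only [Finset.mem_map, addRightEmbedding_apply, hG, Finset.mem_Icc] at hk hk'
          have : ¬ (-(R : ℤ) ≤ k - 1 ∧ k - 1 ≤ R) := fun h => hk' ⟨k - 1, h, by ring⟩
          rw [le_abs]
          omega
      have e4 : trigSum G (fun k => lam (k - 1))
          = trigSum (Finset.Icc (-(R : ℤ)) (R + 1)) (fun k => lam (k - 1)) := by
        refine trigSum_subset (Finset.Icc_subset_Icc_right (by omega)) fun k hk hk' => h0 _ ?_
        simp only [hG, Finset.mem_Icc] at hk hk'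
        rw [le_abs]
        omega
      rw [e2, e3, e4]
    rw [sub_mul, e1, one_mul, hK]
    simp only [trigSum, sub_mul, Finset.sum_sub_distrib]
  have hI1 : ∫ t, ‖K t‖ ^ 2 ≤ 2 * Real.pi * (7 * N * A ^ 2) := by
    rw [hK, integral_norm_sq_trigSum]
    have : ∑ k ∈ G, ‖lam k‖ ^ 2 ≤ G.card • (A : ℝ) ^ 2 :=
      Finset.sum_le_card_nsmul _ _ _ fun k _ => by gcongr; exact hb k
    rw [nsmul_eq_mul] at this
    have h2 : (G.card : ℝ) * A ^ 2 ≤ 7 * N * A ^ 2 := by gcongr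
    have := this.trans h2
    gcongr
  have hI2 : ∫ t : Torus, ‖((fourier 1 t : ℂ) - 1) * K t‖ ^ 2 ≤ 2 * Real.pi * (7 * N * (A / N) ^ 2) := by
    simp_rw [hshift]
    rw [integral_norm_sq_trigSum]
    have : ∑ k ∈ G, ‖lam (k - 1) - lam k‖ ^ 2 ≤ G.card • ((A : ℝ) / N) ^ 2 :=
      Finset.sum_le_card_nsmul _ _ _ fun k _ => by
        have := hd (k - 1)
        rw [sub_add_cancel, norm_sub_rev] at this
        gcongr
    rw [nsmul_eq_mul] at this
    have h2 : (G.card : ℝ) * (A / N) ^ 2 ≤ 7 * N * (A / N) ^ 2 := by gcongr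
    have := this.trans h2
    gcongr
  have hw := integral_weight_le hN'
  have hint : ∀ {f : Torus → ℝ}, Continuous f → Integrable f volume := fun {f} hf => by
    have := hf.continuousOn (s := Set.univ)
      |>.integrableOn_compact (μ := (volume : Measure Torus)) isCompact_univ
    rwa [integrableOn_univ] at this
  have hK1 : ∫ t, ‖K t‖ ≤ 2 * Real.pi * (8 * A) := by
    set w : Torus → ℝ := fun t => 1 + (N : ℝ) ^ 2 * ‖(fourier 1 t : ℂ) - 1‖ ^ 2 with hwdef
    have hwpos : ∀ t, 0 < w t := fun t => by positivity
    have hwc : Continuous w := by fun_prop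
    have hc3 : Continuous fun t => (N : ℝ) / w t :=
      continuous_const.div hwc fun t => (hwpos t).ne'
    calc ∫ t, ‖K t‖
        ≤ ∫ t, (1 / (2 * (N * A)) * ‖K t‖ ^ 2
          + N / (2 * A) * ‖((fourier 1 t : ℂ) - 1) * K t‖ ^ 2 + A / 2 * (N / w t)) := by
          refine integral_mono (hint (by fun_prop)) (hint (by fun_prop)) fun t => ?_
          have h1 := hwpos t
          have h2 : 1 / (2 * (N * A)) * ‖K t‖ ^ 2
              + N / (2 * A) * ‖((fourier 1 t : ℂ) - 1) * K t‖ ^ 2 + A / 2 * (N / w t) - ‖K t‖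
              = (‖K t‖ * w t - N * A) ^ 2 / (2 * N * A * w t) := by
            have h3 : ‖((fourier 1 t : ℂ) - 1) * K t‖ ^ 2
                = (w t - 1) / N ^ 2 * ‖K t‖ ^ 2 := by
              rw [norm_mul, mul_pow, hwdef]
              field_simp
              ring
            rw [h3]
            field_simp
            ring
          have h4 : 0 ≤ (‖K t‖ * w t - N * A) ^ 2 / (2 * N * A * w t) := by positivity
          change ‖K t‖ ≤ _
          linarith
      _ = 1 / (2 * (N * A)) * (∫ t, ‖K t‖ ^ 2)
          + N / (2 * A) * (∫ t : Torus, ‖((fourier 1 t : ℂ) - 1) * K t‖ ^ 2)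
          + A / 2 * ∫ t, N / w t := by
          have i1 : Integrable (fun t => 1 / (2 * (N * A)) * ‖K t‖ ^ 2) volume :=
            hint (by fun_prop)
          have i2 : Integrable (fun t : Torus => N / (2 * A) * ‖((fourier 1 t : ℂ) - 1) * K t‖ ^ 2)
            volume := hint (by fun_prop)
          have i3 : Integrable (fun t => A / 2 * (N / w t)) volume := hint (by fun_prop)
          rw [integral_add (by exact i1.add i2) i3, integral_add i1 i2, integral_const_mul,
            integral_const_mul, integral_const_mul]
      _ ≤ 1 / (2 * (N * A)) * (2 * Real.pi * (7 * N * A ^ 2))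
          + N / (2 * A) * (2 * Real.pi * (7 * N * (A / N) ^ 2)) + A / 2 * (Real.pi ^ 2 / 2) := by
          refine add_le_add (add_le_add ?_ ?_) ?_
          · exact mul_le_mul_of_nonneg_left hI1 (by positivity)
          · exact mul_le_mul_of_nonneg_left hI2 (by positivity)
          · exact mul_le_mul_of_nonneg_left hw (by positivity)
      _ = 2 * Real.pi * (7 * A) + A * Real.pi * Real.pi / 4 := by
          field_simp
          ring
      _ ≤ 2 * Real.pi * (7 * A) + A * Real.pi * 4 / 4 := by
          gcongr
          exact Real.pi_le_four
      _ ≤ _ := by nlinarith [mul_pos hA' Real.pi_pos]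
  intro F c
  have h := eLpNorm_conv_le (p := p) hKc (continuous_trigSum F c)
  have e : (fun x => ∫ t, K t * trigSum F c (x - t))
      = ((2 * Real.pi : ℝ) : ℂ) • trigSum F (fun k => lam k * c k) := by
    funext x
    rw [conv_trigSum K hKc]
    simp [hcoef]
  rw [e, eLpNorm_const_smul] at h
  have e2 : ‖((2 * Real.pi : ℝ) : ℂ)‖ₑ = ENNReal.ofReal (2 * Real.pi) := by
    rw [← ofReal_norm, Complex.norm_real, Real.norm_of_nonneg (by positivity)]
  rw [e2] at h
  have h5 : ENNReal.ofReal (2 * Real.pi) * eLpNorm (trigSum F fun k => lam k * c k) p volume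
      ≤ ENNReal.ofReal (2 * Real.pi) * (↑(8 * A) * eLpNorm (trigSum F c) p volume) := by
    refine h.trans ?_
    rw [← mul_assoc]
    gcongr
    refine (ENNReal.ofReal_le_ofReal hK1).trans ?_
    rw [ENNReal.ofReal_mul (by positivity)]
    gcongr
    have : (8 * (A : ℝ)) = ((8 * A : ℝ≥0) : ℝ) := by push_cast; ring
    rw [this, ENNReal.ofReal_coe_nnreal]
  rwa [ENNReal.mul_le_mul_iff_right (by simpa using Real.pi_pos)
    ENNReal.ofReal_ne_top] at h5

/-! ### Equidistant nodes and Fejér kernels -/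

/-- The `N` equidistant nodes `2πk/N` on the circle, as a homomorphism from `ℤ/N`. -/
def nodeHom (N : ℕ) : ZMod N →+ Torus :=
  ZMod.lift N ⟨zmultiplesHom Torus ((2 * Real.pi / N : ℝ) : Torus), by
    rw [zmultiplesHom_apply, ← AddCircle.coe_zsmul]
    rcases eq_or_ne N 0 with rfl | hN
    · simp
    · have : ((N : ℤ) • (2 * Real.pi / N) : ℝ) = 2 * Real.pi := by
        have : (N : ℝ) ≠ 0 := by exact_mod_cast hN
        rw [zsmul_eq_mul]
        push_cast
        field_simp
      rw [this, AddCircle.coe_period]⟩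

theorem nodeHom_intCast (N : ℕ) (k : ℤ) :
    nodeHom N k = ((2 * Real.pi * k / N : ℝ) : Torus) := by
  rw [nodeHom, ZMod.lift_coe, zmultiplesHom_apply, ← AddCircle.coe_zsmul, zsmul_eq_mul]
  congr 1
  ring

theorem node_eq_nodeHom (j : ℕ) (k : ℤ) : ((node j k : ℝ) : Torus) = nodeHom (2 ^ j) k := by
  rw [nodeHom_intCast, node]
  push_cast
  rfl

/-- The nodes with indices in `A_j` run through the subgroup of order `2^j` of the circle. -/
theorem sum_nodeIdx {E : Type*} [AddCommMonoid E] (j : ℕ) (G : Torus → E) :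
    ∑ k ∈ nodeIdx j, G ((node j k : ℝ) : Torus) = ∑ a : ZMod (2 ^ j), G (nodeHom (2 ^ j) a) := by
  have hpos : (0 : ℤ) < 2 ^ j := by positivity
  refine Finset.sum_bij (fun k _ => (k : ZMod (2 ^ j))) (fun _ _ => Finset.mem_univ _) ?_ ?_ ?_
  · intro k hk l hl h
    rw [ZMod.intCast_eq_intCast_iff_dvd_sub] at h
    simp only [nodeIdx, Finset.mem_filter, Finset.mem_Ico] at hk hl
    push_cast at h
    obtain ⟨m, hm⟩ := h
    have h1 : m < 1 := by
      by_contra! h1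
      nlinarith
    have h2 : -1 < m := by
      by_contra! h1
      nlinarith
    have : m = 0 := by omega
    subst this
    linarith
  · intro a _
    have hlt : a.val < 2 ^ j := ZMod.val_lt a
    have hlt' : (a.val : ℤ) < 2 ^ j := by exact_mod_cast hlt
    by_cases h : 2 * (a.val : ℤ) < 2 ^ j
    · refine ⟨a.val, ?_, by simp⟩
      simp only [nodeIdx, Finset.mem_filter, Finset.mem_Ico]
      omega
    · refine ⟨a.val - 2 ^ j, ?_, ?_⟩
      · simp only [nodeIdx, Finset.mem_filter, Finset.mem_Ico]
        omega
      · have := ZMod.natCast_self (2 ^ j)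
        push_cast at this ⊢
        rw [this]
        simp
  · intro k _
    rw [node_eq_nodeHom]

theorem fourier_nodeHom_intCast (N : ℕ) (n k : ℤ) :
    (fourier n (nodeHom N k) : ℂ) = Complex.exp (2 * Real.pi * Complex.I * (n * k / N)) := by
  rw [nodeHom_intCast, fourier_coe_apply]
  congr 1
  have : (Real.pi : ℂ) ≠ 0 := by exact_mod_cast Real.pi_ne_zero
  push_cast
  field_simp

theorem fourier_nodeHom_of_dvd (N : ℕ) [NeZero N] {n : ℤ} (h : (N : ℤ) ∣ n) (a : ZMod N) :
    (fourier n (nodeHom N a) : ℂ) = 1 := by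
  obtain ⟨k, rfl⟩ := ZMod.intCast_surjective a
  obtain ⟨m, rfl⟩ := h
  rw [fourier_nodeHom_intCast, Complex.exp_eq_one_iff]
  refine ⟨m * k, ?_⟩
  have : (N : ℂ) ≠ 0 := by exact_mod_cast NeZero.ne N
  push_cast
  field_simp

theorem fourier_add_apply (n : ℤ) (x y : Torus) :
    (fourier n (x + y) : ℂ) = fourier n x * fourier n y := by
  simp [fourier_apply, AddCircle.toCircle_add]

theorem fourier_neg_apply (n : ℤ) (x : Torus) :
    (fourier n (-x) : ℂ) = fourier (-n) x := by
  simp [fourier_apply]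

theorem fourier_sub_apply (n : ℤ) (x y : Torus) :
    (fourier n (x - y) : ℂ) = fourier n x * fourier (-n) y := by
  rw [sub_eq_add_neg, fourier_add_apply, fourier_neg_apply]

/-- Orthogonality of the characters restricted to the nodes. -/
theorem sum_fourier_nodeHom (N : ℕ) [NeZero N] (n : ℤ) :
    ∑ a : ZMod N, (fourier n (nodeHom N a) : ℂ) = if (N : ℤ) ∣ n then (N : ℂ) else 0 := by
  split_ifs with h
  · simp [fourier_nodeHom_of_dvd N h]
  · set S := ∑ a : ZMod N, (fourier n (nodeHom N a) : ℂ) with hS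
    have h1 : S = fourier n (nodeHom N 1) * S := by
      rw [hS, Finset.mul_sum]
      refine (Equiv.sum_comp (Equiv.addLeft (1 : ZMod N)) _).symm.trans
        (Finset.sum_congr rfl fun a _ => ?_)
      rw [Equiv.coe_addLeft, map_add, fourier_add_apply]
    have h2 : (fourier n (nodeHom N 1) : ℂ) ≠ 1 := by
      intro h3
      have h4 := fourier_nodeHom_intCast N n 1
      rw [Int.cast_one, h3] at h4
      obtain ⟨m, hm⟩ := Complex.exp_eq_one_iff.1 h4.symm
      apply h
      refine ⟨m, ?_⟩
      have hpi : (2 * Real.pi * Complex.I : ℂ) ≠ 0 := by simp [Real.pi_ne_zero]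
      have hN : (N : ℂ) ≠ 0 := by exact_mod_cast NeZero.ne N
      rw [mul_comm (m : ℂ)] at hm
      have h5 := mul_left_cancel₀ hpi hm
      push_cast at h5
      field_simp at h5
      exact_mod_cast h5
    have h3 : (1 - (fourier n (nodeHom N 1) : ℂ)) * S = 0 := by
      rw [sub_mul, one_mul, ← h1, sub_self]
    rcases mul_eq_zero.1 h3 with h4 | h4
    · exact absurd (sub_eq_zero.1 h4).symm h2
    · exact h4

/-- The Dirichlet sum `∑_{0 ≤ k < N} e^{ikx}`. -/
def dirichletSum (N : ℕ) (x : Torus) : ℂ := ∑ k ∈ Finset.range N, (fourier k x : ℂ)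

/-- The Fejér kernel divided by `N`: `N⁻² |∑_{0 ≤ k < N} e^{ikx}|²`. Its translates by the nodes
form a partition of unity. -/
def fejerWeight (N : ℕ) (x : Torus) : ℝ := ((N : ℝ)⁻¹) ^ 2 * ‖dirichletSum N x‖ ^ 2

theorem fejerWeight_nonneg (N : ℕ) (x : Torus) : 0 ≤ fejerWeight N x := by
  unfold fejerWeight
  positivity

theorem continuous_fejerWeight (N : ℕ) : Continuous (fejerWeight N) := by
  unfold fejerWeight dirichletSum
  fun_prop

theorem fejerWeight_eq (N : ℕ) (x : Torus) : (fejerWeight N x : ℂ)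
    = ((N : ℂ)⁻¹) ^ 2 * ∑ l ∈ Finset.range N, fourier (-(l : ℤ)) x * dirichletSum N x := by
  rw [fejerWeight, ← Finset.sum_mul]
  push_cast
  rw [← Complex.conj_mul']
  congr 2
  rw [dirichletSum, map_sum]
  exact Finset.sum_congr rfl fun l _ => fourier_neg.symm

theorem sum_fejerWeight (N : ℕ) [NeZero N] (x : Torus) :
    ∑ a : ZMod N, fejerWeight N (x - nodeHom N a) = 1 := by
  have hN : (N : ℂ) ≠ 0 := by exact_mod_cast NeZero.ne N
  have h : ∑ a : ZMod N, (fejerWeight N (x - nodeHom N a) : ℂ) = 1 := by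
    simp_rw [fejerWeight_eq]
    rw [← Finset.mul_sum, Finset.sum_comm]
    have h1 : ∀ l ∈ Finset.range N, ∑ a : ZMod N, (fourier (-(l : ℤ)) (x - nodeHom N a) : ℂ)
        * dirichletSum N (x - nodeHom N a) = N := by
      intro l hl
      simp_rw [dirichletSum, Finset.mul_sum]
      rw [Finset.sum_comm, Finset.sum_eq_single l]
      · rw [Finset.sum_congr rfl (g := fun _ => (1 : ℂ)) fun a _ => by
          rw [← fourier_add, neg_add_cancel, fourier_zero]]
        simp
      · intro k hk hkl
        have h2 : ∀ a : ZMod N, (fourier (-(l : ℤ)) (x - nodeHom N a) : ℂ)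
            * fourier (k : ℤ) (x - nodeHom N a)
            = fourier ((k : ℤ) - l) x * fourier (-((k : ℤ) - l)) (nodeHom N a) := fun a => by
          rw [← fourier_add, fourier_sub_apply]
          congr 3 <;> ring
        simp_rw [h2]
        rw [← Finset.mul_sum, sum_fourier_nodeHom, if_neg, mul_zero]
        rw [dvd_neg]
        intro hd
        have h3 := Int.eq_zero_of_abs_lt_dvd hd (by
          rw [Finset.mem_range] at hk hl
          rw [abs_lt]
          omega)
        omega
      · exact fun h => absurd hl h
    rw [Finset.sum_congr rfl h1]
    simp only [Finset.sum_const, Finset.card_range, nsmul_eq_mul]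
    field_simp
  exact_mod_cast h

theorem lintegral_fejerWeight (N : ℕ) [NeZero N] (a : ZMod N) :
    ∫⁻ x, ENNReal.ofReal (fejerWeight N (x - nodeHom N a)) = ENNReal.ofReal (2 * Real.pi) / N := by
  have hN : (N : ℝ≥0∞) ≠ 0 := by exact_mod_cast NeZero.ne N
  have h1 : ∀ b : ZMod N, ∫⁻ x, ENNReal.ofReal (fejerWeight N (x - nodeHom N b))
      = ∫⁻ x, ENNReal.ofReal (fejerWeight N x) := fun b =>
    lintegral_sub_right_eq_self (fun x => ENNReal.ofReal (fejerWeight N x)) (nodeHom N b)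
  have hm : ∀ b : ZMod N, Measurable fun x => ENNReal.ofReal (fejerWeight N (x - nodeHom N b)) :=
    fun b => by
      have := continuous_fejerWeight N
      exact (Continuous.measurable (by fun_prop)).ennreal_ofReal
  have h2 : ∑ b : ZMod N, ∫⁻ x, ENNReal.ofReal (fejerWeight N (x - nodeHom N b))
      = ENNReal.ofReal (2 * Real.pi) := by
    rw [← lintegral_finsetSum _ fun b _ => hm b]
    have : ∀ x, ∑ b : ZMod N, ENNReal.ofReal (fejerWeight N (x - nodeHom N b)) = 1 := fun x => by
      rw [← ENNReal.ofReal_sum_of_nonneg fun b _ => fejerWeight_nonneg N _, sum_fejerWeight,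
        ENNReal.ofReal_one]
    simp_rw [this]
    rw [lintegral_one, AddCircle.measure_univ]
  simp_rw [h1] at h2 ⊢
  rw [Finset.sum_const, Finset.card_univ, ZMod.card, nsmul_eq_mul] at h2
  rw [ENNReal.eq_div_iff hN (by simp), h2]

/-- The coefficients of the de la Vallée Poussin type kernel `(e^{-iNx} + 1 + e^{iNx}) F_N(x)`, where
`F_N` is the Fejér kernel. They are equal to `1` on `[-N, N]`, and the kernel is bounded by `3 F_N`. -/
def vpCoeff (N : ℕ) (n : ℤ) : ℂ :=
  (N : ℂ)⁻¹ * ∑ l ∈ Finset.range N, if n + l ∈ Finset.Ico (-(N : ℤ)) (2 * N) then 1 else 0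

theorem vpCoeff_eq_one (N : ℕ) [NeZero N] {n : ℤ} (h : -(N : ℤ) ≤ n) (h' : n ≤ N) :
    vpCoeff N n = 1 := by
  have hN : (N : ℂ) ≠ 0 := by exact_mod_cast NeZero.ne N
  rw [vpCoeff, Finset.sum_congr rfl (g := fun _ => (1 : ℂ))]
  · simp [hN]
  · intro l hl
    rw [Finset.mem_range] at hl
    rw [if_pos]
    rw [Finset.mem_Ico]
    omega

theorem trigSum_vpCoeff (N : ℕ) [NeZero N] (x : Torus) :
    trigSum (Finset.Ico (-2 * (N : ℤ)) (2 * N)) (vpCoeff N) x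
      = (fourier (-(N : ℤ)) x + 1 + fourier N x) * (N * fejerWeight N x) := by
  have hN : (N : ℂ) ≠ 0 := by exact_mod_cast NeZero.ne N
  have h1 : ∑ k ∈ Finset.Ico (-(N : ℤ)) (2 * N), (fourier k x : ℂ)
      = (fourier (-(N : ℤ)) x + 1 + fourier N x) * dirichletSum N x := by
    have hs : ∀ m : ℤ, (fourier m x : ℂ) * dirichletSum N x
        = ∑ k ∈ Finset.Ico m (m + N), (fourier k x : ℂ) := fun m => by
      rw [dirichletSum, Finset.mul_sum]
      refine Finset.sum_bij (fun k _ => m + k) ?_ ?_ ?_ ?_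
      · intro k hk
        rw [Finset.mem_range] at hk
        rw [Finset.mem_Ico]
        omega
      · intro a _ b _ h
        omega
      · intro b hb
        rw [Finset.mem_Ico] at hb
        exact ⟨(b - m).toNat, by rw [Finset.mem_range]; omega, by omega⟩
      · intro k _
        rw [fourier_add]
    have h0 := hs 0
    rw [fourier_zero] at h0
    have hc : ∀ a b c : ℤ, a ≤ b → b ≤ c → ∑ k ∈ Finset.Ico a b, (fourier k x : ℂ)
        + ∑ k ∈ Finset.Ico b c, (fourier k x : ℂ) = ∑ k ∈ Finset.Ico a c, (fourier k x : ℂ) :=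
      fun a b c hab hbc => by
        rw [← Finset.sum_union (Finset.Ico_disjoint_Ico_consecutive a b c),
          Finset.Ico_union_Ico_eq_Ico hab hbc]
    rw [add_mul, add_mul, hs, h0, hs, neg_add_cancel, zero_add, hc _ _ _ (by omega) (by omega),
      hc _ _ _ (by omega) (by omega), two_mul]
  rw [fejerWeight_eq]
  have h2 : trigSum (Finset.Ico (-2 * (N : ℤ)) (2 * N)) (vpCoeff N) x
      = (N : ℂ)⁻¹ * ∑ l ∈ Finset.range N, ∑ k ∈ Finset.Ico (-(N : ℤ)) (2 * N),
          (fourier (-(l : ℤ)) x * fourier k x : ℂ) := by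
    simp only [trigSum, vpCoeff, mul_assoc, Finset.sum_mul]
    rw [← Finset.mul_sum, Finset.sum_comm]
    congr 1
    refine Finset.sum_congr rfl fun l hl => ?_
    simp_rw [ite_mul, one_mul, zero_mul]
    rw [← Finset.sum_filter]
    refine Finset.sum_bij (fun n _ => n + l) ?_ ?_ ?_ ?_
    · intro n hn
      exact (Finset.mem_filter.1 hn).2
    · intro a _ b _ h
      exact add_right_cancel h
    · intro b hb
      refine ⟨b - l, ?_, by ring⟩
      rw [Finset.mem_filter, sub_add_cancel]
      refine ⟨?_, hb⟩
      rw [Finset.mem_range] at hl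
      rw [Finset.mem_Ico] at hb ⊢
      omega
    · intro n _
      rw [← fourier_add]
      congr 2
      ring
  rw [h2]
  simp_rw [← Finset.mul_sum]
  rw [h1, ← Finset.sum_mul, ← Finset.sum_mul]
  field_simp

/-! ### Sampling and synthesis: boundedness of the quasi-interpolation operators -/

theorem restrict_Ioc_add_nsmul (a T : ℝ) (hT : 0 ≤ T) (n : ℕ) :
    (volume : Measure ℝ).restrict (Set.Ioc a (a + n * T))
      = ∑ k ∈ Finset.range n,
        ((volume : Measure ℝ).restrict (Set.Ioc a (a + T))).map (fun x => x + k * T) := by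
  induction n with
  | zero => simp
  | succ n ih =>
    rw [Finset.sum_range_succ, ← ih]
    have h1 : Set.Ioc a (a + (n + 1 : ℕ) * T)
        = Set.Ioc a (a + n * T) ∪ Set.Ioc (a + n * T) (a + n * T + T) := by
      rw [Set.Ioc_union_Ioc_eq_Ioc (by nlinarith [(Nat.cast_nonneg n : (0 : ℝ) ≤ n)]) (by linarith)]
      congr 1
      push_cast
      ring
    rw [h1, Measure.restrict_union (Set.Ioc_disjoint_Ioc_of_le le_rfl) measurableSet_Ioc]
    congr 1
    have h2 := Measure.restrict_map (μ := (volume : Measure ℝ)) (f := fun x : ℝ => x + n * T)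
      (by fun_prop) (s := Set.Ioc (a + n * T) (a + n * T + T)) measurableSet_Ioc
    rw [map_add_right_eq_self] at h2
    rw [h2]
    congr 2
    ext x
    simp only [Set.mem_preimage, Set.mem_Ioc]
    constructor <;> rintro ⟨h, h'⟩ <;> constructor <;> linarith

/-- The `L_q` norm of a `T`-periodic function over `n` periods is controlled by the one over a
single period with `n` times the Lebesgue measure. -/
theorem eLpNorm_periodic_le {F : ℝ → ℝ} {T : ℝ} (hT : 0 ≤ T) (hF : Function.Periodic F T) (a : ℝ)
    (n : ℕ) (hn : n ≠ 0) {q : ℝ≥0∞} (hq : q ≠ 0) :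
    eLpNorm F q (volume.restrict (Set.Ioc a (a + n * T)))
      ≤ eLpNorm F q ((n : ℝ≥0∞) • volume.restrict (Set.Ioc a (a + T))) := by
  have hF' : ∀ (k : ℕ) x, F (x + k * T) = F x := fun k x => (hF.nat_mul k) x
  rcases eq_or_ne q ∞ with rfl | hq'
  · rw [eLpNorm_exponent_top, eLpNorm_exponent_top]
    refine eLpNormEssSup_le_of_ae_enorm_bound ?_
    have h1 : ∀ᵐ x ∂(volume.restrict (Set.Ioc a (a + T))), ‖F x‖ₑ
        ≤ eLpNormEssSup F ((n : ℝ≥0∞) • volume.restrict (Set.Ioc a (a + T))) := by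
      have := enorm_ae_le_eLpNormEssSup F ((n : ℝ≥0∞) • volume.restrict (Set.Ioc a (a + T)))
      rwa [Measure.ae_ennreal_smul_measure_iff (by exact_mod_cast hn)] at this
    rw [restrict_Ioc_add_nsmul a T hT n, ae_iff, Measure.coe_finsetSum, Finset.sum_apply]
    refine Finset.sum_eq_zero fun k _ => ?_
    have h2 := (MeasurableEquiv.addRight ((k : ℝ) * T)).map_apply
      (μ := volume.restrict (Set.Ioc a (a + T)))
    rw [MeasurableEquiv.coe_addRight] at h2
    rw [h2]
    simp only [Set.preimage_ofPred_eq, hF']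
    exact ae_iff.1 h1
  · rw [eLpNorm_eq_lintegral_rpow_enorm_toReal hq hq', eLpNorm_eq_lintegral_rpow_enorm_toReal hq hq']
    refine le_of_eq ?_
    congr 1
    rw [restrict_Ioc_add_nsmul a T hT n, lintegral_smul_measure, lintegral_finsetSum_measure]
    have : ∀ k ∈ Finset.range n, ∫⁻ x, ‖F x‖ₑ ^ q.toReal
        ∂((volume.restrict (Set.Ioc a (a + T))).map fun x => x + k * T)
        = ∫⁻ x in Set.Ioc a (a + T), ‖F x‖ₑ ^ q.toReal := fun k _ => by
      have := (MeasurableEquiv.addRight ((k : ℝ) * T)).measurableEmbedding.lintegral_map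
        (μ := volume.restrict (Set.Ioc a (a + T))) (fun x => ‖F x‖ₑ ^ q.toReal)
      simp only [MeasurableEquiv.coe_addRight, hF'] at this
      exact this
    rw [Finset.sum_congr rfl this]
    simp

theorem measurePreserving_torus_sub_left (x : Torus) :
    MeasurePreserving (fun t : Torus => x - t) volume volume :=
  Measure.measurePreserving_sub_left volume x

theorem ae_enorm_comp_sub_left_le (h : Torus → ℂ) (x : Torus) :
    ∀ᵐ t : Torus, ‖h (x - t)‖ₑ ≤ eLpNorm h ∞ volume := by
  have := (measurePreserving_torus_sub_left x).quasiMeasurePreserving.tendsto_ae.eventually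
    (enorm_ae_le_eLpNormEssSup h volume)
  rw [eLpNorm_exponent_top]
  exact this

section
variable {N : ℕ} [NeZero N] {p : ℝ≥0∞} [Fact (1 ≤ p)]

theorem enorm_piLp_eq_sum (hp : p ≠ ∞) (c : ZMod N → ℂ) :
    ‖WithLp.toLp p c‖ₑ = (∑ a, ‖c a‖ₑ ^ p.toReal) ^ (1 / p.toReal) := by
  have hp0 : 0 < p.toReal := ENNReal.toReal_pos (zero_lt_one.trans_le Fact.out).ne' hp
  rw [← ofReal_norm, PiLp.norm_eq_sum hp0, ← ENNReal.ofReal_rpow_of_nonneg (by positivity)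
    (by positivity), ENNReal.ofReal_sum_of_nonneg (fun _ _ => by positivity)]
  congr 1
  refine Finset.sum_congr rfl fun a _ => ?_
  rw [← ENNReal.ofReal_rpow_of_nonneg (by positivity) hp0.le, ofReal_norm]

theorem enorm_piLp_top_le {c : ZMod N → ℂ} {M : ℝ≥0∞} (h : ∀ a, ‖c a‖ₑ ≤ M) :
    ‖(WithLp.toLp ∞ c : PiLp ∞ fun _ : ZMod N => ℂ)‖ₑ ≤ M := by
  have : ∃ a, ‖(WithLp.toLp ∞ c : PiLp ∞ fun _ : ZMod N => ℂ)‖ = ‖c a‖ := by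
    rw [PiLp.norm_eq_ciSup]
    obtain ⟨a, ha⟩ := exists_eq_ciSup_of_finite (f := fun a => ‖c a‖)
    exact ⟨a, ha.symm⟩
  obtain ⟨a, ha⟩ := this
  rw [← ofReal_norm, ha, ofReal_norm]
  exact h a

theorem norm_piLp_shift (c : ZMod N → ℂ) (b : ZMod N) :
    ‖(WithLp.toLp p fun a => c (a + b) : PiLp p fun _ : ZMod N => ℂ)‖
      = ‖(WithLp.toLp p c : PiLp p fun _ : ZMod N => ℂ)‖ := by
  rcases eq_or_ne p ∞ with rfl | hp
  · rw [PiLp.norm_eq_ciSup, PiLp.norm_eq_ciSup]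
    exact (Equiv.addRight b).iSup_comp (g := fun a => ‖c a‖)
  · have hp0 : 0 < p.toReal := ENNReal.toReal_pos (zero_lt_one.trans_le Fact.out).ne' hp
    rw [PiLp.norm_eq_sum hp0, PiLp.norm_eq_sum hp0]
    congr 1
    exact Equiv.sum_comp (Equiv.addRight b) (fun a => ‖c a‖ ^ p.toReal)

/-- Averages of node values with Fejér weights: the `L_p` norm of the synthesis operator. -/
theorem eLpNorm_fejer_synthesis_le (c : ZMod N → ℂ) :
    eLpNorm (fun x => ∑ a, (fejerWeight N (x - nodeHom N a) : ℂ) * c a) p volume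
      ≤ (ENNReal.ofReal (2 * Real.pi) / N) ^ (1 / p.toReal) * ‖WithLp.toLp p c‖ₑ := by
  have hpt : ∀ x, ‖∑ a, (fejerWeight N (x - nodeHom N a) : ℂ) * c a‖ₑ
      ≤ ∑ a, ENNReal.ofReal (fejerWeight N (x - nodeHom N a)) * ‖c a‖ₑ := fun x => by
    refine (enorm_sum_le _ _).trans (Finset.sum_le_sum fun a _ => le_of_eq ?_)
    rw [enorm_mul, ← ofReal_norm (fejerWeight N (x - nodeHom N a) : ℂ), Complex.norm_real,
      Real.norm_of_nonneg (fejerWeight_nonneg N _)]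
  have hone : ∀ x, ∑ a, ENNReal.ofReal (fejerWeight N (x - nodeHom N a)) = 1 := fun x => by
    rw [← ENNReal.ofReal_sum_of_nonneg fun b _ => fejerWeight_nonneg N _, sum_fejerWeight,
        ENNReal.ofReal_one]
  rcases eq_or_ne p ∞ with rfl | hp
  · rw [eLpNorm_exponent_top]
    refine eLpNormEssSup_le_of_ae_enorm_bound (Filter.Eventually.of_forall fun x => ?_)
    refine (hpt x).trans ?_
    simp only [ENNReal.toReal_top, div_zero, ENNReal.rpow_zero, one_mul]
    calc ∑ a, ENNReal.ofReal (fejerWeight N (x - nodeHom N a)) * ‖c a‖ₑ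
        ≤ ∑ a, ENNReal.ofReal (fejerWeight N (x - nodeHom N a)) * ‖WithLp.toLp ∞ c‖ₑ := by
          gcongr with a
          exact PiLp.enorm_apply_le (p := ∞) (WithLp.toLp ∞ c) a
      _ = _ := by rw [← Finset.sum_mul, hone, one_mul]
  · have hp0 : 0 < p.toReal := ENNReal.toReal_pos (zero_lt_one.trans_le Fact.out).ne' hp
    have hp1 : 1 ≤ p.toReal := by
      rw [← ENNReal.toReal_one]
      exact ENNReal.toReal_mono hp Fact.out
    rw [eLpNorm_eq_lintegral_rpow_enorm_toReal (zero_lt_one.trans_le Fact.out).ne' hp,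
      enorm_piLp_eq_sum hp, ← ENNReal.mul_rpow_of_nonneg _ _ (by positivity)]
    refine ENNReal.rpow_le_rpow ?_ (by positivity)
    calc ∫⁻ x, ‖∑ a, (fejerWeight N (x - nodeHom N a) : ℂ) * c a‖ₑ ^ p.toReal
        ≤ ∫⁻ x, ∑ a, ENNReal.ofReal (fejerWeight N (x - nodeHom N a)) * ‖c a‖ₑ ^ p.toReal := by
          refine lintegral_mono fun x => ?_
          have h1 := (hpt x).trans (ENNReal.inner_le_weight_mul_Lp_of_nonneg Finset.univ hp1
            (fun a => ENNReal.ofReal (fejerWeight N (x - nodeHom N a))) (fun a => ‖c a‖ₑ))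
          rw [hone, ENNReal.one_rpow, one_mul] at h1
          exact (ENNReal.le_rpow_inv_iff hp0).1 h1
      _ = ∑ a, (ENNReal.ofReal (2 * Real.pi) / N) * ‖c a‖ₑ ^ p.toReal := by
          have hm : ∀ b : ZMod N,
              Measurable fun x => ENNReal.ofReal (fejerWeight N (x - nodeHom N b)) := fun b => by
            have := continuous_fejerWeight N
            exact (Continuous.measurable (by fun_prop)).ennreal_ofReal
          rw [lintegral_finsetSum _ fun a _ => (hm a).mul_const _]
          refine Finset.sum_congr rfl fun a _ => ?_
          rw [lintegral_mul_const _ (hm a), lintegral_fejerWeight]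
      _ = _ := by rw [Finset.mul_sum]

/-- The function `t ↦ ‖(h(x_a - t))_a‖_{ℓ_p}` has `L_p` norm at most `N^{1/p} ‖h‖_p`. -/
theorem eLpNorm_sampling_norm_le {h : Torus → ℂ} (hh : MemLp h p volume) :
    eLpNorm (fun t => ‖(WithLp.toLp p fun a => h (nodeHom N a - t) :
      PiLp p fun _ : ZMod N => ℂ)‖) p volume ≤ (N : ℝ≥0∞) ^ (1 / p.toReal) * eLpNorm h p volume := by
  have hmp : ∀ a : ZMod N, MeasurePreserving (fun t : Torus => nodeHom N a - t) volume volume :=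
    fun a => measurePreserving_torus_sub_left _
  rcases eq_or_ne p ∞ with rfl | hp
  · simp only [ENNReal.toReal_top, div_zero, ENNReal.rpow_zero, one_mul]
    rw [eLpNorm_exponent_top]
    refine eLpNormEssSup_le_of_ae_enorm_bound ?_
    have h1 : ∀ a : ZMod N, ∀ᵐ t : Torus, ‖h (nodeHom N a - t)‖ₑ ≤ eLpNorm h ∞ volume := fun a =>
      ae_enorm_comp_sub_left_le h (nodeHom N a)
    filter_upwards [ae_all_iff.2 h1] with t ht
    rw [enorm_norm]
    exact enorm_piLp_top_le ht
  · have hp0 : 0 < p.toReal := ENNReal.toReal_pos (zero_lt_one.trans_le Fact.out).ne' hp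
    rw [eLpNorm_eq_lintegral_rpow_enorm_toReal (zero_lt_one.trans_le Fact.out).ne' hp,
      eLpNorm_eq_lintegral_rpow_enorm_toReal (zero_lt_one.trans_le Fact.out).ne' hp,
      ← ENNReal.mul_rpow_of_nonneg _ _ (by positivity)]
    refine ENNReal.rpow_le_rpow (le_of_eq ?_) (by positivity)
    have h1 : ∀ t, ‖‖(WithLp.toLp p fun a => h (nodeHom N a - t) :
        PiLp p fun _ : ZMod N => ℂ)‖‖ₑ ^ p.toReal = ∑ a, ‖h (nodeHom N a - t)‖ₑ ^ p.toReal :=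
      fun t => by
        rw [enorm_norm, enorm_piLp_eq_sum hp, one_div, ENNReal.rpow_inv_rpow hp0.ne']
    simp_rw [h1]
    have hm : ∀ a : ZMod N, AEMeasurable (fun t => ‖h (nodeHom N a - t)‖ₑ ^ p.toReal) volume :=
      fun a => ((hh.1.comp_measurePreserving (hmp a)).enorm).pow_const _
    rw [lintegral_finsetSum' _ fun a _ => hm a]
    have h2 : ∀ a : ZMod N, ∫⁻ t, ‖h (nodeHom N a - t)‖ₑ ^ p.toReal = ∫⁻ t, ‖h t‖ₑ ^ p.toReal :=
      fun a => lintegral_sub_left_eq_self (fun t => ‖h t‖ₑ ^ p.toReal) (nodeHom N a)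
    simp_rw [h2]
    simp

/-- The averaged sum of the translates of `|g|` by the nodes. -/
def nodeAverage (N : ℕ) [NeZero N] (g : Torus → ℂ) (t : Torus) : ℝ :=
  (N : ℝ)⁻¹ * ∑ b : ZMod N, ‖g (t - nodeHom N b)‖

/-- The sampling operator: `ℓ_p` norm of the values of a convolution at the nodes. The translation
by the nodes is averaged out first, so that the `ℓ_p`-valued integrand is controlled by
`nodeAverage N g`. -/
theorem enorm_conv_nodes_le {q : ℝ≥0∞} [ENNReal.HolderConjugate p q] {h g : Torus → ℂ}
    (hh : MemLp h p volume) (hg : MemLp g q volume) :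
    ‖(WithLp.toLp p fun a => conv h g (nodeHom N a) : PiLp p fun _ : ZMod N => ℂ)‖ₑ
      ≤ eLpNorm (nodeAverage N g) q volume
        * ((N : ℝ≥0∞) ^ (1 / p.toReal) * eLpNorm h p volume) := by
  have hN : (N : ℂ) ≠ 0 := by exact_mod_cast NeZero.ne N
  let u : Torus → PiLp p fun _ : ZMod N => ℂ := fun t =>
    (N : ℂ)⁻¹ • ∑ b : ZMod N, g (t - nodeHom N b) •
      (WithLp.toLp p fun a => h (nodeHom N (a + b) - t) : PiLp p fun _ : ZMod N => ℂ)
  have hu : ∀ t a, u t a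
      = (N : ℂ)⁻¹ * ∑ b : ZMod N, h (nodeHom N a - (t - nodeHom N b)) * g (t - nodeHom N b) := by
    intro t a
    simp only [u, PiLp.smul_apply, smul_eq_mul, WithLp.ofLp_sum, Finset.sum_apply, WithLp.ofLp_smul,
      Pi.smul_apply]
    congr 1
    refine Finset.sum_congr rfl fun b _ => ?_
    rw [mul_comm, map_add]
    congr 2
    abel
  have hs : ∀ a : ZMod N, MemLp (fun t => h (nodeHom N a - t)) p volume := fun a =>
    hh.comp_measurePreserving (measurePreserving_torus_sub_left (nodeHom N a))
  have hprod : ∀ a : ZMod N, Integrable (fun t => h (nodeHom N a - t) * g t) volume := fun a =>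
    MemLp.integrable_mul (hs a) hg
  have hprod' : ∀ a b : ZMod N, Integrable
      (fun t => h (nodeHom N a - (t - nodeHom N b)) * g (t - nodeHom N b)) volume := fun a b =>
    (hprod a).comp_sub_right (nodeHom N b)
  have hint : ∀ a, Integrable (fun t => u t a) volume := fun a => by
    simp_rw [hu]
    exact (integrable_finsetSum _ fun b _ => hprod' a b).const_mul _
  have hval : ∀ a, (∫ t, u t) a = ∫ t, h (nodeHom N a - t) * g t := fun a => by
    rw [eval_integral_piLp hint]
    simp_rw [hu]
    rw [integral_const_mul, integral_finsetSum _ fun b _ => hprod' a b]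
    have : ∀ b : ZMod N, ∫ t, h (nodeHom N a - (t - nodeHom N b)) * g (t - nodeHom N b)
        = ∫ t, h (nodeHom N a - t) * g t := fun b =>
      integral_sub_right_eq_self (fun t => h (nodeHom N a - t) * g t) (nodeHom N b)
    simp_rw [this]
    simp [hN]
  have hc : (WithLp.toLp p fun a => conv h g (nodeHom N a) : PiLp p fun _ : ZMod N => ℂ)
      = (((2 * Real.pi)⁻¹ : ℝ) : ℂ) • ∫ t, u t := by
    ext a
    rw [PiLp.smul_apply, hval]
    rfl
  set H : Torus → ℝ := fun t => ‖(WithLp.toLp p fun a => h (nodeHom N a - t) :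
      PiLp p fun _ : ZMod N => ℂ)‖ with hH
  have hun : ∀ t, ‖u t‖ ≤ nodeAverage N g t * H t := fun t => by
    simp only [u]
    rw [norm_smul, norm_inv, Complex.norm_natCast, nodeAverage, mul_assoc, Finset.sum_mul]
    gcongr
    refine (norm_sum_le _ _).trans (Finset.sum_le_sum fun b _ => ?_)
    rw [norm_smul, norm_piLp_shift (fun a => h (nodeHom N a - t)) b]
  have hHm : AEStronglyMeasurable H volume := by
    refine AEStronglyMeasurable.norm ?_
    have : MemLp (fun t => (WithLp.toLp p fun a => h (nodeHom N a - t) :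
        PiLp p fun _ : ZMod N => ℂ)) p volume := MemLp.of_eval_piLp hs
    exact this.1
  have hBm : AEStronglyMeasurable (nodeAverage N g) volume := by
    unfold nodeAverage
    refine AEStronglyMeasurable.const_mul ?_ _
    exact Finset.aestronglyMeasurable_fun_sum _ fun b _ =>
      (hg.1.comp_measurePreserving (measurePreserving_sub_right volume (nodeHom N b))).norm
  rw [hc, enorm_smul]
  have h2 : ‖(((2 * Real.pi)⁻¹ : ℝ) : ℂ)‖ₑ ≤ 1 := by
    rw [← ofReal_norm, Complex.norm_real, Real.norm_of_nonneg (by positivity), ENNReal.ofReal_le_one]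
    refine inv_le_one_of_one_le₀ ?_
    linarith [Real.pi_gt_three]
  calc ‖(((2 * Real.pi)⁻¹ : ℝ) : ℂ)‖ₑ * ‖∫ t, u t‖ₑ ≤ 1 * ∫⁻ t, ‖u t‖ₑ := by
        gcongr
        exact enorm_integral_le_lintegral_enorm _
    _ ≤ ∫⁻ t, ‖(nodeAverage N g • H) t‖ₑ := by
        rw [one_mul]
        refine lintegral_mono fun t => ?_
        rw [← ofReal_norm, ← ofReal_norm]
        refine ENNReal.ofReal_le_ofReal ((hun t).trans (le_abs_self _))
    _ = eLpNorm (nodeAverage N g • H) 1 volume := eLpNorm_one_eq_lintegral_enorm.symm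
    _ ≤ eLpNorm (nodeAverage N g) q volume * eLpNorm H p volume := by
        have : ENNReal.HolderTriple q p 1 := (inferInstance : ENNReal.HolderConjugate q p)
        exact eLpNorm_smul_le_mul_eLpNorm hHm hBm
    _ ≤ _ := by
        gcongr
        exact eLpNorm_sampling_norm_le hh

/-- Superposing translates by the nodes multiplies the Fourier coefficients by an `N`-periodic
sequence. -/
theorem sum_translates_trigSum (c : ZMod N → ℂ) (F : Finset ℤ) (d : ℤ → ℂ) (x : Torus) :
    (N : ℂ)⁻¹ * ∑ a, c a * trigSum F d (x - nodeHom N a)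
      = trigSum F (fun k => d k * ((N : ℂ)⁻¹ * ∑ a, c a * fourier (-k) (nodeHom N a))) x := by
  simp only [trigSum, fourier_sub_apply, Finset.mul_sum, Finset.sum_mul]
  rw [Finset.sum_comm]
  refine Finset.sum_congr rfl fun k _ => Finset.sum_congr rfl fun a _ => ?_
  ring

/-- The synthesis operator `c ↦ N⁻¹ ∑_a c_a ϕ(· - x_a)` for a trigonometric polynomial `ϕ` of degree
at most `N` is the multiplier of `ϕ` applied to the synthesis operator of a kernel with Fourier
coefficients `1` on `[-N, N]`, which is dominated by Fejér averages. -/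
theorem eLpNorm_synthesis_le {d : ℤ → ℂ} {M : ℝ≥0} (hd : MultBound p d M)
    (hsupp : ∀ k, k ∉ Finset.Ico (-(N : ℤ)) N → d k = 0) (c : ZMod N → ℂ) :
    eLpNorm (fun x => (N : ℂ)⁻¹ *
        ∑ a, c a * trigSum (Finset.Ico (-(N : ℤ)) N) d (x - nodeHom N a)) p volume
      ≤ M * (3 * ((ENNReal.ofReal (2 * Real.pi) / N) ^ (1 / p.toReal) * ‖WithLp.toLp p c‖ₑ)) := by
  have hN : (N : ℂ) ≠ 0 := by exact_mod_cast NeZero.ne N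
  classical
  set C : ℤ → ℂ := fun k => (N : ℂ)⁻¹ * ∑ a, c a * fourier (-k) (nodeHom N a) with hC
  set I := Finset.Ico (-(N : ℤ)) N with hI
  set J := Finset.Ico (-2 * (N : ℤ)) (2 * N) with hJ
  have hIJ : I ⊆ J := Finset.Ico_subset_Ico (by omega) (by omega)
  have e1 : (fun x => (N : ℂ)⁻¹ * ∑ a, c a * trigSum I d (x - nodeHom N a))
      = trigSum J (fun k => d k * (vpCoeff N k * C k)) := by
    funext x
    rw [sum_translates_trigSum, ← trigSum_subset (F := I) (G := J) hIJ]
    · refine congrFun (trigSum_congr fun k hk => ?_) x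
      rw [hI, Finset.mem_Ico] at hk
      rw [vpCoeff_eq_one N hk.1 hk.2.le, one_mul]
    · intro k _ hk
      rw [hsupp k hk, zero_mul]
  -- The factor `e^{-iNx} + 1 + e^{iNx}` is invariant under translation by the nodes.
  have e2 : trigSum J (fun k => vpCoeff N k * C k) = fun x =>
      (fourier (-(N : ℤ)) x + 1 + fourier N x)
        * ∑ a, (fejerWeight N (x - nodeHom N a) : ℂ) * c a := by
    funext x
    rw [← sum_translates_trigSum]
    simp_rw [hJ, trigSum_vpCoeff, fourier_sub_apply]
    simp_rw [neg_neg, fourier_nodeHom_of_dvd N (dvd_refl (N : ℤ)),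
      fourier_nodeHom_of_dvd N ((dvd_neg).2 (dvd_refl (N : ℤ))), mul_one, Finset.mul_sum]
    refine Finset.sum_congr rfl fun a _ => ?_
    field_simp
  rw [e1]
  refine (hd J _).trans ?_
  gcongr
  rw [e2]
  refine le_trans ?_ (mul_le_mul_right (eLpNorm_fejer_synthesis_le (p := p) c) 3)
  refine eLpNorm_le_nnreal_smul_eLpNorm_of_ae_le_mul (c := 3)
    (Filter.Eventually.of_forall fun x => ?_) p
  rw [nnnorm_mul]
  gcongr
  refine (nnnorm_add_le _ _).trans ((add_le_add_left (nnnorm_add_le _ _) _).trans (le_of_eq ?_))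
  have h1 : ∀ n : ℤ, ‖(fourier n x : ℂ)‖₊ = 1 := fun n => by
    rw [fourier_apply]
    exact Subtype.ext (Circle.norm_coe _)
  rw [h1, h1, nnnorm_one]
  norm_num

/-- The span of the characters `x ↦ e^{ikx}` with `k ∈ S`. -/
def trigSpan (S : Set ℤ) : Submodule ℂ (Torus → ℂ) :=
  Submodule.span ℂ ((fun k : ℤ => (fun x : Torus => (fourier k x : ℂ))) '' S)

theorem exists_trigSum_of_mem_trigSpan {S : Set ℤ} {f : Torus → ℂ} (hf : f ∈ trigSpan S) :
    ∃ (F : Finset ℤ) (c : ℤ → ℂ), (F : Set ℤ) ⊆ S ∧ f = trigSum F c := by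
  obtain ⟨l, hl, rfl⟩ := (Finsupp.mem_span_image_iff_linearCombination ℂ).1 hf
  refine ⟨l.support, l, hl, ?_⟩
  funext x
  rw [Finsupp.linearCombination_apply, Finsupp.sum, Finset.sum_apply]
  rfl

theorem trigSum_mem_trigSpan {S : Set ℤ} {F : Finset ℤ} (hF : (F : Set ℤ) ⊆ S) (c : ℤ → ℂ) :
    trigSum F c ∈ trigSpan S := by
  have : trigSum F c = ∑ k ∈ F, c k • (fun x : Torus => (fourier k x : ℂ)) := by
    funext x
    rw [Finset.sum_apply]
    rfl
  rw [this]
  exact Submodule.sum_mem _ fun k hk =>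
    Submodule.smul_mem _ _ (Submodule.subset_span ⟨k, hF hk, rfl⟩)

theorem eq_trigSum_of_mem_trigPoly {j : ℕ} {f : Torus → ℂ} (hf : f ∈ trigPoly j) :
    f = trigSum (Finset.Ico (-((2 ^ j : ℕ) : ℤ)) (2 ^ j : ℕ)) (fourierCoeff f) := by
  obtain ⟨F, c, hF, rfl⟩ := exists_trigSum_of_mem_trigSpan (S := Set.Ico (-(2 : ℤ) ^ j) (2 ^ j)) hf
  have hc := fourierCoeff_trigSum F c
  refine (trigSum_congr fun k hk => ?_).trans
    (trigSum_subset (F := F) (c := fourierCoeff (trigSum F c)) (fun k hk => ?_) fun k _ hk => ?_)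
  · rw [hc, if_pos hk]
  · have := hF hk
    rw [Finset.mem_Ico]
    push_cast
    exact this
  · rw [hc, if_neg hk]

/-- The average over the nodes has period `2π / 2^j`, so its `L_q` norm over the circle is controlled
by the special norm, which is taken over a single period. -/
theorem eLpNorm_nodeAverage_le (j : ℕ) {g : Torus → ℂ} {q : ℝ≥0∞} (hg : MemLp g q volume)
    (hq : q ≠ 0) : eLpNorm (nodeAverage (2 ^ j) g) q volume ≤ specialNorm q j g := by
  have hBm : AEStronglyMeasurable (nodeAverage (2 ^ j) g) volume := by
    unfold nodeAverage
    refine AEStronglyMeasurable.const_mul ?_ _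
    exact Finset.aestronglyMeasurable_fun_sum _ fun b _ =>
      (hg.1.comp_measurePreserving (measurePreserving_sub_right volume (nodeHom _ b))).norm
  have h1 := eLpNorm_comp_measurePreserving hBm
    (AddCircle.measurePreserving_mk (2 * Real.pi) (-(Real.pi / 2 ^ j))) (p := q)
  rw [← h1]
  set F : ℝ → ℝ := nodeAverage (2 ^ j) g ∘ fun x : ℝ => (x : Torus) with hF
  have h2 : (fun x : ℝ => ((2 : ℝ) ^ j)⁻¹ * ∑ k ∈ nodeIdx j, ‖g ((x - node j k : ℝ) : Torus)‖)
      = F := by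
    funext x
    have := sum_nodeIdx j (fun y => ‖g ((x : Torus) - y)‖)
    simp only [AddCircle.coe_sub, this, hF, Function.comp_apply, nodeAverage]
    push_cast
    rfl
  have hper : Function.Periodic F (2 * Real.pi / 2 ^ j) := by
    intro x
    have h3 : ((2 * Real.pi / 2 ^ j : ℝ) : Torus) = nodeHom (2 ^ j) 1 := by
      have := nodeHom_intCast (2 ^ j) 1
      rw [Int.cast_one] at this
      rw [this]
      push_cast
      rw [mul_one]
    simp only [hF, Function.comp_apply, nodeAverage, AddCircle.coe_add, h3]
    congr 1
    refine (Equiv.sum_comp (Equiv.addRight (1 : ZMod (2 ^ j))) _).symm.trans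
      (Finset.sum_congr rfl fun a _ => ?_)
    rw [Equiv.coe_addRight, map_add, add_sub_add_right_eq_sub]
  have h4 := eLpNorm_periodic_le (by positivity) hper (-(Real.pi / 2 ^ j)) (2 ^ j)
    (by positivity) hq
  rw [specialNorm, h2]
  convert h4 using 4
  · push_cast
    field_simp
  · push_cast
    rfl
  · congr 1
    ring

/-- Uniform `L_p` bound for the quasi-interpolation operators. -/
theorem eLpNorm_quasiInterp_le {q : ℝ≥0∞} [ENNReal.HolderConjugate p q] {φ φt : ℕ → Torus → ℂ}
    {j : ℕ} {M S : ℝ≥0} (hφ : φ j ∈ trigPoly j) (hM : MultBound p (fourierCoeff (φ j)) M)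
    (hφt : MemLp (φt j) q volume) (hS : specialNorm q j (φt j) ≤ S) {h : Torus → ℂ}
    (hh : MemLp h p volume) :
    eLpNorm (quasiInterp φ φt j h) p volume ≤ (M * 3 * S * 7 : ℝ≥0) * eLpNorm h p volume := by
  have hp1 : 1 ≤ p := Fact.out
  have hq : q ≠ 0 := (ENNReal.HolderConjugate.ne_zero q p)
  set c : ZMod (2 ^ j) → ℂ := fun a => conv h (φt j) (nodeHom (2 ^ j) a) with hc
  have e1 : quasiInterp φ φt j h = fun x => (((2 ^ j : ℕ) : ℂ))⁻¹ * ∑ a, c a *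
      trigSum (Finset.Ico (-((2 ^ j : ℕ) : ℤ)) (2 ^ j : ℕ)) (fourierCoeff (φ j))
        (x - nodeHom (2 ^ j) a) := by
    funext x
    have := sum_nodeIdx j (fun y => conv h (φt j) y * φ j (x - y))
    rw [quasiInterp, this, ← eq_trigSum_of_mem_trigPoly hφ]
    push_cast
    rfl
  rw [e1]
  refine (eLpNorm_synthesis_le hM (fun k hk => ?_) c).trans ?_
  · rw [eq_trigSum_of_mem_trigPoly hφ, fourierCoeff_trigSum, if_neg hk]
  have h1 := enorm_conv_nodes_le (N := 2 ^ j) hh hφt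
  have h2 := (eLpNorm_nodeAverage_le j hφt hq).trans hS
  have hN0 : ((2 ^ j : ℕ) : ℝ≥0∞) ≠ 0 := by positivity
  have hr : 0 ≤ 1 / p.toReal := by positivity
  calc (M : ℝ≥0∞) * (3 * ((ENNReal.ofReal (2 * Real.pi) / (2 ^ j : ℕ)) ^ (1 / p.toReal)
        * ‖WithLp.toLp p c‖ₑ))
      ≤ M * (3 * ((ENNReal.ofReal (2 * Real.pi) / (2 ^ j : ℕ)) ^ (1 / p.toReal)
        * (S * (((2 ^ j : ℕ) : ℝ≥0∞) ^ (1 / p.toReal) * eLpNorm h p volume)))) := by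
        gcongr
        exact h1.trans (by gcongr)
    _ = M * 3 * S * (ENNReal.ofReal (2 * Real.pi)) ^ (1 / p.toReal) * eLpNorm h p volume := by
        have : (ENNReal.ofReal (2 * Real.pi)) ^ (1 / p.toReal)
            = (ENNReal.ofReal (2 * Real.pi) / (2 ^ j : ℕ)) ^ (1 / p.toReal)
              * ((2 ^ j : ℕ) : ℝ≥0∞) ^ (1 / p.toReal) := by
          rw [← ENNReal.mul_rpow_of_nonneg _ _ hr, ENNReal.div_mul_cancel hN0 (by simp)]
        rw [this]
        ring
    _ ≤ (M * 3 * S * 7 : ℝ≥0) * eLpNorm h p volume := by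
        push_cast
        gcongr
        -- The powers of `N = 2^j` cancel, and `(2π)^{1/p} ≤ 7` is left.
        have h7 : ENNReal.ofReal (2 * Real.pi) ≤ 7 := by
          rw [← ENNReal.ofReal_ofNat 7]
          refine ENNReal.ofReal_le_ofReal ?_
          linarith [Real.pi_lt_d2]
        have hle : 1 / p.toReal ≤ 1 := by
          rcases eq_or_ne p ∞ with rfl | hp
          · simp
          · rw [div_le_one (ENNReal.toReal_pos (zero_lt_one.trans_le hp1).ne' hp),
              ← ENNReal.toReal_one]
            exact ENNReal.toReal_mono hp hp1
        calc (ENNReal.ofReal (2 * Real.pi)) ^ (1 / p.toReal) ≤ 7 ^ (1 / p.toReal) := by gcongr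
          _ ≤ 7 ^ (1 : ℝ) := ENNReal.rpow_le_rpow_of_exponent_le (by norm_num) hle
          _ = 7 := ENNReal.rpow_one _

end

/-! ### Approximation order of the quasi-interpolation operators -/

/-- The frequencies of the `m`-th dyadic block: `2^{m-1} ≤ |k| ≤ 2^{m+1}` for `m ≥ 1` and `|k| ≤ 2`
for `m = 0`. -/
def dyadicSet (m : ℕ) : Set ℤ := {k | |(k : ℝ)| ≤ 2 * 2 ^ m ∧ (1 ≤ m → (2 : ℝ) ^ m ≤ 2 * |(k : ℝ)|)}

/-- On the points `x = 0` and `1/2 ≤ |x| ≤ 2`, the power `x^s` agrees with a compactly supported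
Lipschitz function. -/
theorem exists_lipschitz_eq_branchPow {κ : ℂ} (hκ : ‖κ‖ = 1) {s : ℝ} (hs : 0 < s) :
    ∃ (a : ℝ → ℂ) (L : ℝ≥0), 0 < L ∧ (∀ x, ‖a x‖ ≤ L) ∧ (∀ x y, ‖a x - a y‖ ≤ L * |x - y|) ∧
      (∀ x, a x ≠ 0 → |x| < 3) ∧
      ∀ x, (x = 0 ∨ (1 / 2 ≤ |x| ∧ |x| ≤ 2)) → a x = branchPow κ s x := by
  -- `τ` is a cut-off equal to `1` on `[1/2, 2]` and `y` truncates `x` to `[1/2, 2]`, so that `g` is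
  -- `x^s` on `[1/2, 2]` and vanishes outside `[1/4, 3]`.
  let τ : ℝ → ℝ := fun x => max 0 (min 1 (min (4 * x - 1) (3 - x)))
  let y : ℝ → ℝ := fun x => max (1 / 2) (min x 2)
  let g : ℝ → ℝ := fun x => τ x * y x ^ s
  have hτ0 : ∀ x, 0 ≤ τ x := fun x => le_max_left _ _
  have hτ1 : ∀ x, τ x ≤ 1 := fun x => max_le zero_le_one (min_le_left _ _)
  have hτL : ∀ x x', |τ x - τ x'| ≤ 4 * |x - x'| := fun x x' => by
    have h1 : |min (4 * x - 1) (3 - x) - min (4 * x' - 1) (3 - x')| ≤ 4 * |x - x'| := by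
      refine (abs_min_sub_min_le_max _ _ _ _).trans (max_le ?_ ?_)
      · rw [show 4 * x - 1 - (4 * x' - 1) = 4 * (x - x') by ring, abs_mul]
        simp
      · rw [show 3 - x - (3 - x') = -(x - x') by ring, abs_neg]
        linarith [abs_nonneg (x - x')]
    have h2 : |min 1 (min (4 * x - 1) (3 - x)) - min 1 (min (4 * x' - 1) (3 - x'))|
        ≤ 4 * |x - x'| := by
      refine (abs_min_sub_min_le_max _ _ _ _).trans (max_le ?_ h1)
      simp
    refine (abs_max_sub_max_le_max _ _ _ _).trans (max_le ?_ h2)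
    simp
  have hy1 : ∀ x, y x ∈ Set.Icc (1 / 2 : ℝ) 2 := fun x =>
    ⟨le_max_left _ _, max_le (by norm_num) (min_le_right _ _)⟩
  have hyL : ∀ x x', |y x - y x'| ≤ |x - x'| := fun x x' => by
    have h1 : |min x 2 - min x' 2| ≤ |x - x'| := by
      refine (abs_min_sub_min_le_max _ _ _ _).trans (max_le le_rfl ?_)
      simp
    refine (abs_max_sub_max_le_max _ _ _ _).trans (max_le ?_ h1)
    simp
  obtain ⟨D, hD⟩ := isCompact_Icc.exists_bound_of_continuousOn (s := Set.Icc (1 / 2 : ℝ) 2)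
    (f := fun x : ℝ => s * x ^ (s - 1)) (by
      refine ContinuousOn.mul continuousOn_const ?_
      exact ContinuousOn.rpow_const continuousOn_id fun x hx => Or.inl (by
        have := hx.1
        exact (by linarith : (0 : ℝ) < x).ne'))
  have hD0 : 0 ≤ D := (norm_nonneg _).trans (hD 1 (by norm_num))
  have hpL : ∀ u ∈ Set.Icc (1 / 2 : ℝ) 2, ∀ v ∈ Set.Icc (1 / 2 : ℝ) 2,
      |u ^ s - v ^ s| ≤ D * |u - v| := fun u hu v hv => by
    have := Convex.norm_image_sub_le_of_norm_hasDerivWithin_le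
      (f := fun x : ℝ => x ^ s) (f' := fun x : ℝ => s * x ^ (s - 1)) (s := Set.Icc (1 / 2 : ℝ) 2)
      (C := D) (fun x hx => (Real.hasDerivAt_rpow_const
        (Or.inl (by linarith [hx.1]))).hasDerivWithinAt) hD (convex_Icc _ _) hv hu
    simpa [Real.norm_eq_abs] using this
  have hy0 : ∀ x, 0 ≤ y x ^ s := fun x => Real.rpow_nonneg (by linarith [(hy1 x).1]) _
  have hyB : ∀ x, y x ^ s ≤ 2 ^ s := fun x =>
    Real.rpow_le_rpow (by linarith [(hy1 x).1]) (hy1 x).2 hs.le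
  have h2s : (0 : ℝ) < 2 ^ s := by positivity
  have hg0 : ∀ x, 0 ≤ g x := fun x => mul_nonneg (hτ0 x) (hy0 x)
  have hgB : ∀ x, g x ≤ 2 ^ s := fun x => by
    calc g x ≤ 1 * 2 ^ s := mul_le_mul (hτ1 x) (hyB x) (hy0 x) zero_le_one
      _ = _ := one_mul _
  have hgL : ∀ x x', |g x - g x'| ≤ (4 * 2 ^ s + D) * |x - x'| := fun x x' => by
    have e : g x - g x' = (τ x - τ x') * y x ^ s + τ x' * (y x ^ s - y x' ^ s) := by
      simp only [g]
      ring
    rw [e]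
    refine (abs_add_le _ _).trans ?_
    rw [abs_mul, abs_mul, abs_of_nonneg (hy0 x), abs_of_nonneg (hτ0 x')]
    have h1 : |τ x - τ x'| * y x ^ s ≤ 4 * |x - x'| * 2 ^ s :=
      mul_le_mul (hτL x x') (hyB x) (hy0 x) (by positivity)
    have h2 : τ x' * |y x ^ s - y x' ^ s| ≤ 1 * (D * |x - x'|) := by
      refine mul_le_mul (hτ1 x') ?_ (abs_nonneg _) zero_le_one
      refine (hpL _ (hy1 x) _ (hy1 x')).trans ?_
      exact mul_le_mul_of_nonneg_left (hyL x x') hD0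
    linarith
  have hgneg : ∀ x, x ≤ 1 / 4 → g x = 0 := fun x hx => by
    have : τ x = 0 := max_eq_left ((min_le_right _ _).trans ((min_le_left _ _).trans (by linarith)))
    simp only [g, this, zero_mul]
  have hgbig : ∀ x, 3 ≤ x → g x = 0 := fun x hx => by
    have : τ x = 0 := max_eq_left ((min_le_right _ _).trans ((min_le_right _ _).trans (by linarith)))
    simp only [g, this, zero_mul]
  have hgeq : ∀ x, 1 / 2 ≤ x → x ≤ 2 → g x = x ^ s := fun x h1 h2 => by
    have ht : τ x = 1 := by
      have : min 1 (min (4 * x - 1) (3 - x)) = 1 :=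
        min_eq_left (le_min (by linarith) (by linarith))
      simp only [τ, this]
      norm_num
    have hy : y x = x := by
      simp only [y, min_eq_left h2, max_eq_right h1]
    simp only [g, ht, hy, one_mul]
  obtain ⟨L, hL⟩ : ∃ L : ℝ≥0, (L : ℝ) = 2 * (4 * 2 ^ s + D) :=
    ⟨Real.toNNReal (2 * (4 * 2 ^ s + D)), Real.coe_toNNReal _ (by positivity)⟩
  refine ⟨fun x => (g x : ℂ) + κ * (g (-x) : ℂ), L, ?_, ?_, ?_, ?_, ?_⟩
  · rw [← NNReal.coe_pos, hL]
    positivity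
  · intro x
    rw [hL]
    refine (norm_add_le _ _).trans ?_
    rw [norm_mul, hκ, one_mul, Complex.norm_real, Complex.norm_real,
      Real.norm_of_nonneg (hg0 _), Real.norm_of_nonneg (hg0 _)]
    linarith [hgB x, hgB (-x)]
  · intro x x'
    rw [hL]
    have e : (g x : ℂ) + κ * (g (-x) : ℂ) - ((g x' : ℂ) + κ * (g (-x') : ℂ))
        = ((g x - g x' : ℝ) : ℂ) + κ * ((g (-x) - g (-x') : ℝ) : ℂ) := by
      push_cast
      ring
    rw [e]
    refine (norm_add_le _ _).trans ?_
    rw [norm_mul, hκ, one_mul, Complex.norm_real, Complex.norm_real, Real.norm_eq_abs,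
      Real.norm_eq_abs]
    have h1 := hgL x x'
    have h2 := hgL (-x) (-x')
    rw [show -x - -x' = -(x - x') by ring, abs_neg] at h2
    linarith
  · intro x hx
    by_contra! h
    apply hx
    rcases le_abs.1 h with h | h
    · simp [hgbig x h, hgneg (-x) (by linarith)]
    · simp [hgbig (-x) h, hgneg x (by linarith)]
  · intro x hx
    rcases hx with rfl | ⟨h1, h2⟩
    · simp [hgneg 0 (by norm_num), branchPow, Real.zero_rpow hs.ne']
    · rcases le_or_gt 0 x with h | h
      · rw [abs_of_nonneg h] at h1 h2
        simp [branchPow, not_lt.2 h, abs_of_nonneg h, hgeq x h1 h2, hgneg (-x) (by linarith)]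
      · rw [abs_of_neg h] at h1 h2
        simp [branchPow, h, abs_of_neg h, hgeq (-x) h1 h2, hgneg x (by linarith)]

/-- A fractional Bernstein inequality on dyadic blocks: on the block, the symbol `(2^{-m} k)^s` agrees
with a Lipschitz function at scale `2^m`. -/
theorem exists_bernstein (p : ℝ≥0∞) [Fact (1 ≤ p)] {κ : ℂ} (hκ : ‖κ‖ = 1) {s : ℝ} (hs : 0 < s) :
    ∃ L : ℝ≥0, ∀ (m : ℕ) (F : Finset ℤ) (c : ℤ → ℂ), (F : Set ℤ) ⊆ dyadicSet m →
      eLpNorm (trigSum F fun k => branchPow κ s ((k : ℝ) / 2 ^ m) * c k) p volume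
        ≤ L * eLpNorm (trigSum F c) p volume := by
  obtain ⟨a, L, hL, hb, hl, hsupp, ha⟩ := exists_lipschitz_eq_branchPow hκ hs
  refine ⟨8 * L, fun m F c hF => ?_⟩
  have h2m : (0 : ℝ) < 2 ^ m := by positivity
  have hone : 1 ≤ 2 ^ m := Nat.one_le_two_pow
  have hM : MultBound p (fun k : ℤ => a ((k : ℝ) / 2 ^ m)) (8 * L) := by
    refine multBound_of_lipschitz hL (N := 2 ^ m) (R := 3 * 2 ^ m) (by positivity) (by omega)
      (fun k hk => ?_) (fun k => hb _) fun k => ?_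
    · have := hsupp _ hk
      rw [abs_div, abs_of_pos h2m, div_lt_iff₀ h2m] at this
      exact_mod_cast this
    · refine (hl _ _).trans (le_of_eq ?_)
      have : ((k + 1 : ℤ) : ℝ) / 2 ^ m - (k : ℝ) / 2 ^ m = (2 ^ m)⁻¹ := by
        push_cast
        ring
      rw [this, abs_of_pos (by positivity)]
      push_cast
      rw [div_eq_mul_inv]
  have : trigSum F (fun k => branchPow κ s ((k : ℝ) / 2 ^ m) * c k)
      = trigSum F (fun k => a ((k : ℝ) / 2 ^ m) * c k) := by
    refine trigSum_congr fun k hk => ?_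
    rw [ha]
    obtain ⟨h1, h2⟩ := hF hk
    rcases eq_or_ne k 0 with rfl | hk0
    · left
      simp
    · right
      rw [abs_div, abs_of_pos h2m, div_le_iff₀ h2m, le_div_iff₀ h2m]
      refine ⟨?_, h1⟩
      rcases Nat.eq_zero_or_pos m with rfl | hm
      · have : 1 ≤ |k| := Int.one_le_abs hk0
        have : (1 : ℝ) ≤ |(k : ℝ)| := by exact_mod_cast this
        norm_num
        linarith
      · linarith [h2 hm]
  rw [this]
  exact hM F c

theorem continuous_of_mem_trigPoly {j : ℕ} {f : Torus → ℂ} (hf : f ∈ trigPoly j) :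
    Continuous f := by
  rw [eq_trigSum_of_mem_trigPoly hf]
  exact continuous_trigSum _ _

theorem continuous_quasiInterp {φ φt : ℕ → Torus → ℂ} {j : ℕ} (hφ : Continuous (φ j))
    (h : Torus → ℂ) : Continuous (quasiInterp φ φt j h) := by
  unfold quasiInterp
  fun_prop

theorem conv_trigSum_left {g : Torus → ℂ} (hg : Integrable g volume) (F : Finset ℤ) (c : ℤ → ℂ)
    (x : Torus) : conv (trigSum F c) g x = trigSum F (fun k => fourierCoeff g k * c k) x := by
  have h1 : ∀ t : Torus, trigSum F c (x - t) * g t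
      = ∑ k ∈ F, (c k * fourier k x) * (fourier (-k) t • g t) := fun t => by
    rw [trigSum, Finset.sum_mul]
    refine Finset.sum_congr rfl fun k _ => ?_
    rw [fourier_sub_apply, smul_eq_mul]
    ring
  rw [conv]
  simp_rw [h1]
  rw [integral_finsetSum]
  · rw [trigSum, Finset.mul_sum]
    refine Finset.sum_congr rfl fun k hk => ?_
    rw [integral_const_mul, fourierCoeff, AddCircle.integral_haarAddCircle]
    simp only [Complex.real_smul]
    ring
  · intro k _
    refine Integrable.const_mul ?_ _
    simp only [smul_eq_mul]
    refine hg.bdd_mul (c := 1) (by fun_prop) (Filter.Eventually.of_forall fun t => ?_)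
    rw [fourier_apply]
    exact (Circle.norm_coe _).le

/-- On low frequencies there is no aliasing, and the quasi-interpolation operator acts as the
multiplier with the symbol `φ̂_j φt̂_j`. -/
theorem quasiInterp_trigSum {φ φt : ℕ → Torus → ℂ} {j : ℕ} (hφ : φ j ∈ trigPoly j)
    (hφt : Integrable (φt j) volume) {ε : ℝ} (hε : ε ≤ 1)
    (hband : ∀ k : ℤ, (1 - ε) * 2 ^ j < |(k : ℝ)| → fourierCoeff (φ j) k = 0)
    {F : Finset ℤ} (hF : ∀ k ∈ F, |(k : ℝ)| < ε * 2 ^ j) (c : ℤ → ℂ) :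
    quasiInterp φ φt j (trigSum F c)
      = trigSum F (fun k => fourierCoeff (φ j) k * fourierCoeff (φt j) k * c k) := by
  have hN : ((2 ^ j : ℕ) : ℂ) ≠ 0 := by
    push_cast
    exact pow_ne_zero _ two_ne_zero
  have h2j : (0 : ℝ) < 2 ^ j := by positivity
  funext x
  have h1 := sum_nodeIdx j (fun y => conv (trigSum F c) (φt j) y * φ j (x - y))
  set I := Finset.Ico (-((2 ^ j : ℕ) : ℤ)) (2 ^ j : ℕ) with hI
  have hFI : F ⊆ I := fun k hk => by
    have h2 := hF k hk
    have h3 : |(k : ℝ)| < 2 ^ j := h2.trans_le (by nlinarith)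
    have h4 : |k| < 2 ^ j := by exact_mod_cast h3
    rw [abs_lt] at h4
    rw [hI, Finset.mem_Ico]
    push_cast
    omega
  have h2 : quasiInterp φ φt j (trigSum F c) x = (((2 ^ j : ℕ) : ℂ))⁻¹ * ∑ a : ZMod (2 ^ j),
      trigSum F (fun k => fourierCoeff (φt j) k * c k) (nodeHom (2 ^ j) a) *
        trigSum I (fourierCoeff (φ j)) (x - nodeHom (2 ^ j) a) := by
    rw [quasiInterp, h1, ← eq_trigSum_of_mem_trigPoly hφ]
    simp_rw [conv_trigSum_left hφt]
    push_cast
    rfl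
  rw [h2, sum_translates_trigSum]
  have h3 : trigSum F (fun k => fourierCoeff (φ j) k * fourierCoeff (φt j) k * c k) = trigSum I
      (fun k => fourierCoeff (φ j) k * if k ∈ F then fourierCoeff (φt j) k * c k else 0) := by
    rw [← trigSum_subset hFI]
    · exact trigSum_congr fun k hk => by simp only [if_pos hk, mul_assoc]
    · intro k _ hk
      rw [if_neg hk, mul_zero]
  rw [h3]
  refine congrFun (trigSum_congr fun l hl => ?_) x
  by_cases hl0 : fourierCoeff (φ j) l = 0
  · rw [hl0, zero_mul, zero_mul]
  congr 1
  have hl1 : |(l : ℝ)| ≤ (1 - ε) * 2 ^ j := by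
    by_contra! h
    exact hl0 (hband l h)
  -- The frequencies `k` of the polynomial and `l` of `φ_j` differ by less than `2^j`, so sampling does
  -- not identify them.
  have h4 : ∀ k ∈ F, ∑ a : ZMod (2 ^ j), (fourier k (nodeHom (2 ^ j) a) : ℂ)
      * fourier (-l) (nodeHom (2 ^ j) a) = if k = l then ((2 ^ j : ℕ) : ℂ) else 0 := by
    intro k hk
    simp_rw [← fourier_add]
    rw [sum_fourier_nodeHom]
    refine if_congr ⟨fun h => ?_, fun h => ?_⟩ rfl rfl
    · have h5 : |(k : ℝ) + -l| < 2 ^ j := by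
        refine (abs_add_le _ _).trans_lt ?_
        rw [abs_neg]
        have := hF k hk
        linarith
      have h6 : |k + -l| < ((2 ^ j : ℕ) : ℤ) := by
        push_cast
        exact_mod_cast h5
      have := Int.eq_zero_of_abs_lt_dvd h h6
      omega
    · simp [h]
  calc (((2 ^ j : ℕ) : ℂ))⁻¹ * ∑ a : ZMod (2 ^ j),
        trigSum F (fun k => fourierCoeff (φt j) k * c k) (nodeHom (2 ^ j) a)
          * fourier (-l) (nodeHom (2 ^ j) a)
      = (((2 ^ j : ℕ) : ℂ))⁻¹ * ∑ k ∈ F, (fourierCoeff (φt j) k * c k) *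
        ∑ a : ZMod (2 ^ j), (fourier k (nodeHom (2 ^ j) a) : ℂ)
          * fourier (-l) (nodeHom (2 ^ j) a) := by
        simp only [trigSum, Finset.sum_mul, Finset.mul_sum]
        rw [Finset.sum_comm]
        simp only [mul_assoc]
    _ = (((2 ^ j : ℕ) : ℂ))⁻¹ * ∑ k ∈ F, if k = l then
          (fourierCoeff (φt j) k * c k) * ((2 ^ j : ℕ) : ℂ) else 0 := by
        congr 1
        refine Finset.sum_congr rfl fun k hk => ?_
        rw [h4 k hk, mul_ite, mul_zero]
    _ = _ := by
        rw [Finset.sum_ite_eq' F l]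
        split_ifs
        · field_simp
        · simp

theorem resolution_zero_eq_one {ψ : ℕ → ℝ → ℂ} (hψ : IsSmoothResolution ψ) {ξ : ℝ}
    (hξ : |ξ| < 1) : ψ 0 ξ = 1 := by
  refine (hasSum_single 0 fun j hj => ?_).unique (hψ.sum_eq_one ξ)
  by_contra h
  have h1 := (hψ.support_pos j (Nat.one_le_iff_ne_zero.2 hj) ξ h).1
  have h2 : (1 : ℝ) ≤ (2 : ℝ) ^ ((j : ℤ) - 1) := one_le_zpow₀ one_le_two (by omega)
  linarith

theorem branchPow_mul (κ : ℂ) (s : ℝ) {t : ℝ} (ht : 0 < t) (x : ℝ) :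
    branchPow κ s (t * x) = ((t ^ s : ℝ) : ℂ) * branchPow κ s x := by
  have h1 : t * x < 0 ↔ x < 0 := by
    constructor
    · intro h
      by_contra! hx
      exact absurd h (not_lt.2 (mul_nonneg ht.le hx))
    · exact fun h => mul_neg_of_pos_of_neg ht h
  rw [branchPow, branchPow, abs_mul, abs_of_pos ht, Real.mul_rpow ht.le (abs_nonneg x)]
  simp only [h1]
  push_cast
  ring

theorem branchPow_ne_zero {κ : ℂ} (hκ : ‖κ‖ = 1) (s : ℝ) {x : ℝ} (hx : x ≠ 0) :
    branchPow κ s x ≠ 0 := by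
  refine mul_ne_zero ?_ ?_
  · split_ifs
    · intro h
      simp [h] at hκ
    · exact one_ne_zero
  · exact_mod_cast (Real.rpow_pos_of_pos (abs_pos.2 hx) s).ne'

theorem eLpNorm_real_smul_trigSum (p : ℝ≥0∞) {t : ℝ} (ht : 0 ≤ t) (F : Finset ℤ) (c : ℤ → ℂ) :
    eLpNorm (trigSum F fun k => (t : ℂ) * c k) p volume
      = ENNReal.ofReal t * eLpNorm (trigSum F c) p volume := by
  have : (trigSum F fun k => (t : ℂ) * c k) = (t : ℂ) • trigSum F c := by
    funext x
    simp [trigSum, Finset.mul_sum, mul_assoc]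
  rw [this, eLpNorm_const_smul, ← ofReal_norm, Complex.norm_real, Real.norm_of_nonneg ht]

theorem UniformlyBoundedMultipliers.exists_multBound {p : ℝ≥0∞} (hp : 1 ≤ p) {lam : ℕ → ℤ → ℂ}
    (h : UniformlyBoundedMultipliers p lam) : ∃ M : ℝ≥0, ∀ j, MultBound p (lam j) M := by
  refine ⟨(⨆ j, multiplierNorm p (lam j)).toNNReal, fun j => multBound_of_multiplierNorm_le hp ?_⟩
  rw [ENNReal.coe_toNNReal h.2.ne]
  exact le_iSup (fun j => multiplierNorm p (lam j)) j

/-- The decay factor `2^{-s max(j - m, 0)}`. -/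
def decay (s : ℝ) (j m : ℕ) : ℝ := 2 ^ (-(s * ((j - m : ℕ) : ℝ)))

theorem decay_pos (s : ℝ) (j m : ℕ) : 0 < decay s j m := Real.rpow_pos_of_pos two_pos _

/-- Approximation order `s`: on the `m`-th dyadic block, `I - Q_j` has norm `O(2^{-s(j-m)})`. If
`j - m` is large, then `Q_j` acts as a multiplier and the compatibility condition combines with the
Bernstein inequality; otherwise the uniform boundedness of `Q_j` suffices. -/
theorem exists_approximation_bound {p : ℝ≥0∞} [Fact (1 ≤ p)] {s : ℝ} (hs : 0 < s)
    {ψ : ℕ → ℝ → ℂ} (hψ : IsSmoothResolution ψ) {κ : ℂ} (hκ : ‖κ‖ = 1) {φ φt : ℕ → Torus → ℂ}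
    (hφ : ∀ j, φ j ∈ trigPoly j)
    (hband : ∃ ε : ℝ, 0 < ε ∧ ∀ (j : ℕ) (k : ℤ),
      (1 - ε) * 2 ^ j < |(k : ℝ)| → fourierCoeff (φ j) k = 0)
    (hφt : ∀ j, Integrable (φt j) volume) (hwc : Compatibility ψ φ φt p κ s) {C₁ : ℝ≥0}
    (hQ : ∀ j h, MemLp h p volume →
      eLpNorm (quasiInterp φ φt j h) p volume ≤ C₁ * eLpNorm h p volume) :
    ∃ C : ℝ≥0, ∀ (m j : ℕ) (F : Finset ℤ) (c : ℤ → ℂ), (F : Set ℤ) ⊆ dyadicSet m → m ≤ j →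
      eLpNorm (trigSum F c - quasiInterp φ φt j (trigSum F c)) p volume
        ≤ C * ENNReal.ofReal (decay s j m) * eLpNorm (trigSum F c) p volume := by
  obtain ⟨h00, δ, hδ, hcompat⟩ := hwc
  obtain ⟨ε₀, hε₀, hb₀⟩ := hband
  obtain ⟨M, hM⟩ := hcompat.exists_multBound Fact.out
  obtain ⟨L, hL⟩ := exists_bernstein p hκ hs
  set ε := min ε₀ 1 with hε
  have hεpos : 0 < ε := lt_min hε₀ one_pos
  have hb : ∀ (j : ℕ) (k : ℤ), (1 - ε) * 2 ^ j < |(k : ℝ)| → fourierCoeff (φ j) k = 0 :=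
    fun j k h => hb₀ j k (lt_of_le_of_lt (by gcongr; exact min_le_left _ _) h)
  -- If `j ≥ m + a`, then the block lies in `|k| < ε 2^j`, where there is no aliasing, and in the region
  -- where `ψ_0(δ 2^{-j} k) = 1`.
  obtain ⟨a, ha⟩ := pow_unbounded_of_one_lt (max (2 / ε) (2 * δ)) (one_lt_two (α := ℝ))
  have ha1 : 2 < ε * 2 ^ a := by
    have := (le_max_left _ _).trans_lt ha
    rwa [div_lt_iff₀ hεpos, mul_comm] at this
  have ha2 : δ * 2 < 2 ^ a := by
    have := (le_max_right _ _).trans_lt ha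
    linarith
  obtain ⟨B, hB⟩ : ∃ B : ℝ≥0, (B : ℝ) = 2 ^ (s * a) :=
    ⟨Real.toNNReal (2 ^ (s * a)), Real.coe_toNNReal _ (by positivity)⟩
  refine ⟨max (M * L) ((1 + C₁) * B), fun m j F c hF hmj => ?_⟩
  have hcont := fun j => continuous_of_mem_trigPoly (hφ j)
  by_cases hj : m + a ≤ j
  · have h2 : (2 : ℝ) ^ m * 2 ^ a ≤ 2 ^ j := by
      rw [← pow_add]
      exact pow_le_pow_right₀ one_le_two hj
    have h2m : (0 : ℝ) < 2 ^ m := by positivity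
    have h2j : (0 : ℝ) < 2 ^ j := by positivity
    have hlow : ∀ k ∈ F, |(k : ℝ)| < ε * 2 ^ j := fun k hk => by
      calc |(k : ℝ)| ≤ 2 * 2 ^ m := (hF hk).1
        _ < ε * 2 ^ a * 2 ^ m := by gcongr
        _ = ε * (2 ^ m * 2 ^ a) := by ring
        _ ≤ ε * 2 ^ j := by gcongr
    have hlow' : ∀ k ∈ F, |δ * ((k : ℝ) / 2 ^ j)| < 1 := fun k hk => by
      rw [abs_mul, abs_of_pos hδ, abs_div, abs_of_pos h2j, ← mul_div_assoc, div_lt_one h2j]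
      calc δ * |(k : ℝ)| ≤ δ * (2 * 2 ^ m) := by gcongr; exact (hF hk).1
        _ = δ * 2 * 2 ^ m := by ring
        _ < 2 ^ a * 2 ^ m := by gcongr
        _ ≤ 2 ^ j := by linarith
    have hbr : ∀ k : ℤ, branchPow κ s ((k : ℝ) / 2 ^ j)
        = (decay s j m : ℂ) * branchPow κ s ((k : ℝ) / 2 ^ m) := fun k => by
      have h3 : (k : ℝ) / 2 ^ j = 2 ^ (-((j - m : ℕ) : ℝ)) * ((k : ℝ) / 2 ^ m) := by
        rw [Real.rpow_neg two_pos.le, Real.rpow_natCast]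
        have : (2 : ℝ) ^ j = 2 ^ (j - m) * 2 ^ m := by rw [← pow_add, Nat.sub_add_cancel hmj]
        rw [this]
        field_simp
      rw [h3, branchPow_mul _ _ (by positivity), ← Real.rpow_mul two_pos.le, decay]
      congr 4
      ring
    rw [quasiInterp_trigSum (hφ j) (hφt j) (min_le_right _ _) (hb j) hlow]
    have e1 : trigSum F c - trigSum F (fun k => fourierCoeff (φ j) k * fourierCoeff (φt j) k * c k)
        = trigSum F (fun k => compatSeq ψ φ φt κ s δ j k *
          ((decay s j m : ℂ) * (branchPow κ s ((k : ℝ) / 2 ^ m) * c k))) := by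
      funext x
      rw [Pi.sub_apply, trigSum, trigSum, ← Finset.sum_sub_distrib]
      refine Finset.sum_congr rfl fun k hk => ?_
      beta_reduce
      rw [← mul_assoc (decay s j m : ℂ), ← hbr, compatSeq,
        resolution_zero_eq_one hψ (hlow' k hk), mul_one]
      rcases eq_or_ne k 0 with rfl | hk0
      · rw [h00 j]
        simp
      · have : branchPow κ s ((k : ℝ) / 2 ^ j) ≠ 0 :=
          branchPow_ne_zero hκ s (div_ne_zero (by exact_mod_cast hk0) h2j.ne')
        field_simp
    rw [e1]
    calc _ ≤ M * eLpNorm (trigSum F fun k =>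
          (decay s j m : ℂ) * (branchPow κ s ((k : ℝ) / 2 ^ m) * c k)) p volume := hM j F _
      _ = M * (ENNReal.ofReal (decay s j m) *
          eLpNorm (trigSum F fun k => branchPow κ s ((k : ℝ) / 2 ^ m) * c k) p volume) := by
          rw [eLpNorm_real_smul_trigSum p (decay_pos s j m).le]
      _ ≤ M * (ENNReal.ofReal (decay s j m) * (L * eLpNorm (trigSum F c) p volume)) := by
          gcongr
          exact hL m F c hF
      _ = (M * L : ℝ≥0) * ENNReal.ofReal (decay s j m) * eLpNorm (trigSum F c) p volume := by
          push_cast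
          ring
      _ ≤ _ := by
          gcongr
          exact le_max_left _ _
  · have hmem := continuous_memLp (μ := (volume : Measure Torus)) (continuous_trigSum F c) p
    have hdec : 1 ≤ (B : ℝ) * decay s j m := by
      rw [hB, decay, ← Real.rpow_add two_pos]
      refine Real.one_le_rpow one_le_two ?_
      have : ((j - m : ℕ) : ℝ) ≤ a := by exact_mod_cast (by omega : j - m ≤ a)
      nlinarith
    have hdec' : (1 : ℝ≥0∞) ≤ B * ENNReal.ofReal (decay s j m) := by
      rw [← ENNReal.ofReal_coe_nnreal, ← ENNReal.ofReal_mul (by positivity), ENNReal.one_le_ofReal]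
      exact hdec
    calc eLpNorm (trigSum F c - quasiInterp φ φt j (trigSum F c)) p volume
        ≤ eLpNorm (trigSum F c) p volume + eLpNorm (quasiInterp φ φt j (trigSum F c)) p volume :=
          eLpNorm_sub_le hmem.1
            (continuous_quasiInterp (hcont j) _).aestronglyMeasurable_of_compactSpace Fact.out
      _ ≤ eLpNorm (trigSum F c) p volume + C₁ * eLpNorm (trigSum F c) p volume := by
          gcongr
          exact hQ j _ hmem
      _ = (1 + C₁) * 1 * eLpNorm (trigSum F c) p volume := by ring
      _ ≤ (1 + C₁) * (B * ENNReal.ofReal (decay s j m)) * eLpNorm (trigSum F c) p volume := by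
          gcongr
      _ = ((1 + C₁) * B : ℝ≥0) * ENNReal.ofReal (decay s j m) * eLpNorm (trigSum F c) p volume := by
          push_cast
          ring
      _ ≤ _ := by
          gcongr
          exact le_max_right _ _

/-- The differences `Q_j - Q_{j-1}` on the `m`-th dyadic block. For `j > m` both operators are close to
the identity, and passing from `j - 1` to `j` costs a factor `2^s`; for `j ≤ m` boundedness suffices. -/
theorem exists_quasiInterpDiff_bound {p : ℝ≥0∞} [Fact (1 ≤ p)] {s : ℝ}
    {φ φt : ℕ → Torus → ℂ} (hφ : ∀ j, Continuous (φ j)) {C₁ C₂ : ℝ≥0}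
    (hQ : ∀ j h, MemLp h p volume →
      eLpNorm (quasiInterp φ φt j h) p volume ≤ C₁ * eLpNorm h p volume)
    (hA : ∀ (m j : ℕ) (F : Finset ℤ) (c : ℤ → ℂ), (F : Set ℤ) ⊆ dyadicSet m → m ≤ j →
      eLpNorm (trigSum F c - quasiInterp φ φt j (trigSum F c)) p volume
        ≤ C₂ * ENNReal.ofReal (decay s j m) * eLpNorm (trigSum F c) p volume) :
    ∃ C : ℝ≥0, ∀ (m j : ℕ) (F : Finset ℤ) (c : ℤ → ℂ), (F : Set ℤ) ⊆ dyadicSet m →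
      eLpNorm (quasiInterpDiff φ φt j (trigSum F c)) p volume
        ≤ C * ENNReal.ofReal (decay s j m) * eLpNorm (trigSum F c) p volume := by
  obtain ⟨B, hB⟩ : ∃ B : ℝ≥0, (B : ℝ) = 2 ^ s :=
    ⟨Real.toNNReal (2 ^ s), Real.coe_toNNReal _ (by positivity)⟩
  refine ⟨max (C₁ + C₁) (C₂ * B + C₂), fun m j F c hF => ?_⟩
  have hmem := continuous_memLp (μ := (volume : Measure Torus)) (continuous_trigSum F c) p
  have hmQ : ∀ j, AEStronglyMeasurable (quasiInterp φ φt j (trigSum F c)) volume := fun j =>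
    (continuous_quasiInterp (hφ j) _).aestronglyMeasurable_of_compactSpace
  by_cases hj : j ≤ m
  · have hd : decay s j m = 1 := by simp [decay, Nat.sub_eq_zero_of_le hj]
    have h1 : eLpNorm (quasiInterpDiff φ φt j (trigSum F c)) p volume
        ≤ (C₁ + C₁ : ℝ≥0) * eLpNorm (trigSum F c) p volume := by
      cases j with
      | zero =>
        refine (hQ 0 _ hmem).trans ?_
        gcongr
        exact le_add_self
      | succ j =>
        change eLpNorm (quasiInterp φ φt (j + 1) (trigSum F c) - quasiInterp φ φt j (trigSum F c))
          p volume ≤ _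
        refine (eLpNorm_sub_le (hmQ _) (hmQ _) Fact.out).trans ?_
        push_cast
        rw [add_mul]
        exact add_le_add (hQ _ _ hmem) (hQ _ _ hmem)
    rw [hd, ENNReal.ofReal_one, mul_one]
    refine h1.trans ?_
    gcongr
    exact le_max_left _ _
  · obtain ⟨i, rfl⟩ : ∃ i, j = i + 1 := ⟨j - 1, by omega⟩
    have hmi : m ≤ i := by omega
    have e : quasiInterpDiff φ φt (i + 1) (trigSum F c)
        = (trigSum F c - quasiInterp φ φt i (trigSum F c))
          - (trigSum F c - quasiInterp φ φt (i + 1) (trigSum F c)) := by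
      funext x
      simp [quasiInterpDiff]
    have hd : ENNReal.ofReal (decay s i m) = B * ENNReal.ofReal (decay s (i + 1) m) := by
      rw [← ENNReal.ofReal_coe_nnreal, ← ENNReal.ofReal_mul (by positivity), hB, decay, decay,
        ← Real.rpow_add two_pos]
      congr 2
      rw [Nat.succ_sub hmi]
      push_cast
      ring
    rw [e]
    refine (eLpNorm_sub_le (hmem.1.sub (hmQ _)) (hmem.1.sub (hmQ _)) Fact.out).trans ?_
    refine (add_le_add (hA m i F c hF hmi) (hA m (i + 1) F c hF (by omega))).trans ?_
    rw [hd]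
    calc _ = (C₂ * B + C₂ : ℝ≥0) * ENNReal.ofReal (decay s (i + 1) m)
          * eLpNorm (trigSum F c) p volume := by
          push_cast
          ring
      _ ≤ _ := by
          gcongr
          exact le_max_right _ _

theorem exists_mem_dyadicSet (k : ℤ) : ∃ m, k ∈ dyadicSet m := by
  rcases eq_or_ne k 0 with rfl | hk
  · exact ⟨0, by simp [dyadicSet]⟩
  · have h0 : k.natAbs ≠ 0 := Int.natAbs_ne_zero.2 hk
    have h1 := Nat.pow_log_le_self 2 h0
    have h2 := Nat.lt_pow_succ_log_self one_lt_two k.natAbs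
    have h3 : |(k : ℝ)| = (k.natAbs : ℝ) := by
      rw [Nat.cast_natAbs, Int.cast_abs]
    refine ⟨Nat.log 2 k.natAbs, ?_, fun _ => ?_⟩
    · rw [h3]
      rw [pow_succ, mul_comm] at h2
      exact_mod_cast h2.le
    · rw [h3]
      have : (2 : ℝ) ^ Nat.log 2 k.natAbs ≤ (k.natAbs : ℝ) := by exact_mod_cast h1
      linarith [(Nat.cast_nonneg k.natAbs : (0 : ℝ) ≤ _)]

/-- The Fourier multiplier of `Q_n` tends to `1` at each frequency, by the approximation bound for a
single character. -/
theorem tendsto_quasiInterp_symbol {p : ℝ≥0∞} [Fact (1 ≤ p)] {s : ℝ} (hs : 0 < s)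
    {φ φt : ℕ → Torus → ℂ} (hφ : ∀ j, φ j ∈ trigPoly j)
    (hband : ∃ ε : ℝ, 0 < ε ∧ ∀ (j : ℕ) (k : ℤ),
      (1 - ε) * 2 ^ j < |(k : ℝ)| → fourierCoeff (φ j) k = 0)
    (hφt : ∀ j, Integrable (φt j) volume) {C₂ : ℝ≥0}
    (hA : ∀ (m j : ℕ) (F : Finset ℤ) (c : ℤ → ℂ), (F : Set ℤ) ⊆ dyadicSet m → m ≤ j →
      eLpNorm (trigSum F c - quasiInterp φ φt j (trigSum F c)) p volume
        ≤ C₂ * ENNReal.ofReal (decay s j m) * eLpNorm (trigSum F c) p volume) (k : ℤ) :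
    ∃ lam : ℕ → ℂ, Filter.Tendsto lam Filter.atTop (nhds 1) ∧ ∃ j₀, ∀ j, j₀ ≤ j →
      quasiInterp φ φt j (fun x => fourier k x) = fun x => lam j * fourier k x := by
  obtain ⟨m, hm⟩ := exists_mem_dyadicSet k
  obtain ⟨ε₀, hε₀, hb₀⟩ := hband
  set ε := min ε₀ 1 with hε
  have hεpos : 0 < ε := lt_min hε₀ one_pos
  have hb : ∀ (j : ℕ) (k : ℤ), (1 - ε) * 2 ^ j < |(k : ℝ)| → fourierCoeff (φ j) k = 0 :=
    fun j k h => hb₀ j k (lt_of_le_of_lt (by gcongr; exact min_le_left _ _) h)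
  obtain ⟨a, ha⟩ := pow_unbounded_of_one_lt (|(k : ℝ)| / ε) (one_lt_two (α := ℝ))
  have hek : (fun x : Torus => (fourier k x : ℂ)) = trigSum {k} (fun _ => 1) := by
    funext x
    simp only [trigSum, Finset.sum_singleton, one_mul]
  set lam : ℕ → ℂ := fun j => fourierCoeff (φ j) k * fourierCoeff (φt j) k with hlam
  have hQe : ∀ j, a ≤ j → quasiInterp φ φt j (fun x => fourier k x)
      = fun x => lam j * fourier k x := fun j hj => by
    rw [hek, quasiInterp_trigSum (hφ j) (hφt j) (min_le_right _ _) (hb j)]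
    · funext x
      simp only [trigSum, Finset.sum_singleton, mul_one, hlam]
    · intro l hl
      rw [Finset.mem_singleton.1 hl]
      rw [div_lt_iff₀ hεpos] at ha
      refine ha.trans_le ?_
      rw [mul_comm]
      gcongr
      exact one_le_two
  refine ⟨lam, ?_, a, hQe⟩
  have hdec : Filter.Tendsto (fun j => (C₂ : ℝ) * decay s j m) Filter.atTop (nhds 0) := by
    rw [← mul_zero (C₂ : ℝ)]
    refine Filter.Tendsto.const_mul _ ?_
    have h1 := (tendsto_pow_atTop_nhds_zero_of_lt_one (r := (2 : ℝ) ^ (-s)) (by positivity)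
      (Real.rpow_lt_one_of_one_lt_of_neg one_lt_two (by linarith))).comp
      (Filter.tendsto_sub_atTop_nat m)
    refine h1.congr fun j => ?_
    simp only [Function.comp_apply]
    rw [decay, ← neg_mul, Real.rpow_mul two_pos.le, Real.rpow_natCast]
  rw [tendsto_iff_norm_sub_tendsto_zero]
  refine squeeze_zero' (Filter.Eventually.of_forall fun _ => norm_nonneg _) ?_ hdec
  filter_upwards [Filter.eventually_ge_atTop (max a m)] with j hj
  have h1 := hA m j {k} (fun _ => 1) (by simpa using hm) ((le_max_right _ _).trans hj)
  rw [← hek, hQe j ((le_max_left _ _).trans hj)] at h1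
  have e : (fun x : Torus => (fourier k x : ℂ)) - (fun x => lam j * fourier k x)
      = (1 - lam j) • (fun x : Torus => (fourier k x : ℂ)) := by
    funext x
    simp only [Pi.sub_apply, Pi.smul_apply, smul_eq_mul]
    ring
  have hcont : Continuous fun x : Torus => (fourier k x : ℂ) := by fun_prop
  rw [e, eLpNorm_const_smul, ENNReal.mul_le_mul_iff_left] at h1
  · rw [← ofReal_norm, ← ENNReal.ofReal_coe_nnreal, ← ENNReal.ofReal_mul (by positivity),
      ENNReal.ofReal_le_ofReal_iff (mul_nonneg (by positivity) (decay_pos s j m).le)] at h1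
    rw [norm_sub_rev]
    exact h1
  · rw [Ne, eLpNorm_eq_zero_iff hcont.aestronglyMeasurable_of_compactSpace
      (zero_lt_one.trans_le (Fact.out : 1 ≤ p)).ne']
    intro h0
    have h2 := (hcont.ae_eq_iff_eq volume continuous_zero).1 h0
    have h3 := congrFun h2 0
    simp at h3
  · exact (continuous_memLp hcont p).eLpNorm_ne_top

/-! ### Univariate operators acting in one variable -/

section Slices
variable {Y X : Type*} [MeasurableSpace Y] [MeasurableSpace X] {μ : Measure Y} {ν : Measure X}
  [SFinite ν]

theorem memLp_slices {p : ℝ≥0∞} (hp : 1 ≤ p) {F : Y × X → ℂ} (hF : MemLp F p (μ.prod ν)) :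
    ∀ᵐ y ∂μ, MemLp (fun x => F (y, x)) p ν := by
  have hm : ∀ᵐ y ∂μ, AEStronglyMeasurable (fun x => F (y, x)) ν := hF.1.prodMk_left
  have hp0 : p ≠ 0 := (zero_lt_one.trans_le hp).ne'
  rcases eq_or_ne p ∞ with rfl | hpt
  · have h1 : ∀ᵐ z ∂(μ.prod ν), ‖F z‖ₑ ≤ eLpNorm F ∞ (μ.prod ν) := by
      rw [eLpNorm_exponent_top]
      exact enorm_ae_le_eLpNormEssSup F _
    filter_upwards [hm, Measure.ae_ae_of_ae_prod h1] with y hy1 hy2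
    refine ⟨hy1, ?_⟩
    rw [eLpNorm_exponent_top]
    exact (eLpNormEssSup_le_of_ae_enorm_bound hy2).trans_lt hF.2
  · have h1 : ∫⁻ z, ‖F z‖ₑ ^ p.toReal ∂(μ.prod ν) < ∞ :=
      lintegral_rpow_enorm_lt_top_of_eLpNorm_lt_top hp0 hpt hF.2
    rw [lintegral_prod _ (hF.1.enorm.pow_const _)] at h1
    have h2 := ae_lt_top' (hF.1.enorm.pow_const p.toReal).lintegral_prod_right' h1.ne
    filter_upwards [hm, h2] with y hy1 hy2
    exact ⟨hy1, (eLpNorm_lt_top_iff_lintegral_rpow_enorm_lt_top hp0 hpt).2 hy2⟩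

/-- A bound of `L_p` norms on almost all slices implies the bound on the product. -/
theorem eLpNorm_prod_le_of_slices {p : ℝ≥0∞} (hp : 1 ≤ p) {F G : Y × X → ℂ}
    (hF : AEStronglyMeasurable F (μ.prod ν)) (hG : AEStronglyMeasurable G (μ.prod ν)) {C : ℝ≥0}
    (h : ∀ᵐ y ∂μ, eLpNorm (fun x => G (y, x)) p ν ≤ C * eLpNorm (fun x => F (y, x)) p ν) :
    eLpNorm G p (μ.prod ν) ≤ C * eLpNorm F p (μ.prod ν) := by
  have hp0 : p ≠ 0 := (zero_lt_one.trans_le hp).ne'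
  rcases eq_or_ne p ∞ with rfl | hpt
  · have h1 : ∀ᵐ z ∂(μ.prod ν), ‖F z‖ₑ ≤ eLpNorm F ∞ (μ.prod ν) := by
      rw [eLpNorm_exponent_top]
      exact enorm_ae_le_eLpNormEssSup F _
    have h2 : ∀ᵐ y ∂μ, ∀ᵐ x ∂ν, ‖G (y, x)‖ₑ ≤ C * eLpNorm F ∞ (μ.prod ν) := by
      filter_upwards [h, Measure.ae_ae_of_ae_prod h1] with y hy1 hy2
      have h3 : eLpNorm (fun x => F (y, x)) ∞ ν ≤ eLpNorm F ∞ (μ.prod ν) := by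
        rw [eLpNorm_exponent_top]
        exact eLpNormEssSup_le_of_ae_enorm_bound hy2
      have h4 : ∀ᵐ x ∂ν, ‖G (y, x)‖ₑ ≤ eLpNorm (fun x => G (y, x)) ∞ ν := by
        rw [eLpNorm_exponent_top]
        exact enorm_ae_le_eLpNormEssSup _ _
      filter_upwards [h4] with x hx
      exact hx.trans (hy1.trans (by gcongr))
    have h5 : ∀ᵐ y ∂μ, ∀ᵐ x ∂ν, ‖hG.mk G (y, x)‖ₑ ≤ C * eLpNorm F ∞ (μ.prod ν) := by
      filter_upwards [h2, Measure.ae_ae_of_ae_prod hG.ae_eq_mk] with y hy1 hy2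
      filter_upwards [hy1, hy2] with x hx1 hx2
      rwa [← hx2]
    have h6 : ∀ᵐ z ∂(μ.prod ν), ‖hG.mk G z‖ₑ ≤ C * eLpNorm F ∞ (μ.prod ν) :=
      (Measure.ae_prod_iff_ae_ae (measurableSet_le hG.stronglyMeasurable_mk.enorm
        measurable_const)).2 h5
    rw [eLpNorm_exponent_top (f := G)]
    refine eLpNormEssSup_le_of_ae_enorm_bound ?_
    filter_upwards [h6, hG.ae_eq_mk] with z hz1 hz2
    rwa [hz2]
  · have hp1 : 0 < p.toReal := ENNReal.toReal_pos hp0 hpt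
    rw [eLpNorm_eq_lintegral_rpow_enorm_toReal hp0 hpt,
      eLpNorm_eq_lintegral_rpow_enorm_toReal hp0 hpt, lintegral_prod _ (hF.enorm.pow_const _),
      lintegral_prod _ (hG.enorm.pow_const _)]
    have h1 : ∀ᵐ y ∂μ, ∫⁻ x, ‖G (y, x)‖ₑ ^ p.toReal ∂ν
        ≤ (C : ℝ≥0∞) ^ p.toReal * ∫⁻ x, ‖F (y, x)‖ₑ ^ p.toReal ∂ν := by
      filter_upwards [h] with y hy
      rw [eLpNorm_eq_lintegral_rpow_enorm_toReal hp0 hpt,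
        eLpNorm_eq_lintegral_rpow_enorm_toReal hp0 hpt] at hy
      have := ENNReal.rpow_le_rpow hy hp1.le
      rwa [ENNReal.mul_rpow_of_nonneg _ _ hp1.le, one_div, ENNReal.rpow_inv_rpow hp1.ne',
        ENNReal.rpow_inv_rpow hp1.ne'] at this
    have h2 := lintegral_mono_ae h1
    rw [lintegral_const_mul' _ _ (by finiteness)] at h2
    refine (ENNReal.rpow_le_rpow h2 (by positivity)).trans (le_of_eq ?_)
    rw [ENNReal.mul_rpow_of_nonneg _ _ (by positivity), one_div, ENNReal.rpow_rpow_inv hp1.ne']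

end Slices

section Insert
variable {n : ℕ}

/-- The measurable equivalence that inserts the `i`-th coordinate. -/
def insertEquiv (i : Fin (n + 1)) : TorusD n × Torus ≃ᵐ TorusD (n + 1) :=
  MeasurableEquiv.prodComm.trans (MeasurableEquiv.piFinSuccAbove (fun _ => Torus) i).symm

theorem insertEquiv_apply (i : Fin (n + 1)) (z : TorusD n × Torus) :
    insertEquiv i z = i.insertNth z.2 z.1 := rfl

theorem measurePreserving_insertEquiv (i : Fin (n + 1)) :
    MeasurePreserving (insertEquiv (n := n) i) (volume.prod volume) volume :=
  (volume_preserving_piFinSuccAbove (fun _ => Torus) i).symm.comp Measure.measurePreserving_swap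

theorem ae_eq_of_comp_insertEquiv {i : Fin (n + 1)} {f g : TorusD (n + 1) → ℂ}
    (h : f ∘ insertEquiv i =ᵐ[volume.prod volume] g ∘ insertEquiv i) : f =ᵐ[volume] g := by
  have := (measurePreserving_insertEquiv i).symm.quasiMeasurePreserving.ae_eq_comp h
  simpa [Function.comp_assoc] using this

theorem update_insertEquiv (i : Fin (n + 1)) (z : TorusD n × Torus) (t : Torus) :
    Function.update (insertEquiv i z) i t = insertEquiv i (z.1, t) := by
  rw [insertEquiv_apply, insertEquiv_apply, Fin.update_insertNth]

theorem inVariable_insertEquiv (i : Fin (n + 1)) (U : (Torus → ℂ) → Torus → ℂ)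
    (f : TorusD (n + 1) → ℂ) (z : TorusD n × Torus) :
    inVariable i U f (insertEquiv i z) = U (fun t => f (insertEquiv i (z.1, t))) z.2 := by
  simp only [inVariable, update_insertEquiv]
  congr 1
  rw [insertEquiv_apply, Fin.insertNth_apply_same]

/-- The slicing principle: a bound on all slices in the variable `x_i` carries over to the
`d`-variate functions. -/
theorem eLpNorm_le_of_slices {d : ℕ} {p : ℝ≥0∞} (hp : 1 ≤ p) (i : Fin d)
    {f g : TorusD d → ℂ} (hf : MemLp f p volume) (hg : AEStronglyMeasurable g volume) {C : ℝ≥0}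
    (h : ∀ x : TorusD d, MemLp (fun t => f (Function.update x i t)) p volume →
      eLpNorm (fun t => g (Function.update x i t)) p volume
        ≤ C * eLpNorm (fun t => f (Function.update x i t)) p volume) :
    eLpNorm g p volume ≤ C * eLpNorm f p volume := by
  obtain ⟨n, rfl⟩ : ∃ n, d = n + 1 := ⟨d - 1, by have := i.pos; omega⟩
  have hmp := measurePreserving_insertEquiv i
  rw [← eLpNorm_comp_measurePreserving hf.1 hmp, ← eLpNorm_comp_measurePreserving hg hmp]
  refine eLpNorm_prod_le_of_slices hp (hf.1.comp_measurePreserving hmp)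
    (hg.comp_measurePreserving hmp) ?_
  filter_upwards [memLp_slices hp (hf.comp_measurePreserving hmp)] with y hy
  have := h (insertEquiv i (y, 0))
  simp only [update_insertEquiv] at this
  exact this hy

theorem inVariable_update {d : ℕ} (i : Fin d) (U : (Torus → ℂ) → Torus → ℂ) (f : TorusD d → ℂ)
    (x : TorusD d) (t : Torus) : inVariable i U f (Function.update x i t)
      = U (fun t' => f (Function.update x i t')) t := by
  simp only [inVariable, Function.update_idem, Function.update_self]

end Insert

/-- A univariate operator that depends only on the almost-everywhere class of its argument, is
linear and bounded by `C` on `L_p`, and can be applied measurably to slices. -/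
structure BoundedUnivariate (p : ℝ≥0∞) (C : ℝ≥0) (U : (Torus → ℂ) → Torus → ℂ) : Prop where
  congr : ∀ h h' : Torus → ℂ, h =ᵐ[volume] h' → U h = U h'
  add : ∀ h h' : Torus → ℂ, MemLp h p volume → MemLp h' p volume → U (h + h') = U h + U h'
  smul : ∀ (a : ℂ) (h : Torus → ℂ), U (a • h) = a • U h
  bound : ∀ h : Torus → ℂ, MemLp h p volume → eLpNorm (U h) p volume ≤ C * eLpNorm h p volume
  meas : ∀ (n : ℕ) (F : TorusD n × Torus → ℂ), MemLp F p (volume.prod volume) →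
    AEStronglyMeasurable (fun z : TorusD n × Torus => U (fun t => F (z.1, t)) z.2)
      (volume.prod volume)

namespace BoundedUnivariate
variable {p : ℝ≥0∞} {C : ℝ≥0} {U : (Torus → ℂ) → Torus → ℂ} {d : ℕ}

theorem inVariable_congr (hU : BoundedUnivariate p C U) (i : Fin d) {f g : TorusD d → ℂ}
    (h : f =ᵐ[volume] g) : inVariable i U f =ᵐ[volume] inVariable i U g := by
  obtain ⟨n, rfl⟩ : ∃ n, d = n + 1 := ⟨d - 1, by have := i.pos; omega⟩
  have h1 := (measurePreserving_insertEquiv i).quasiMeasurePreserving.ae_eq_comp h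
  refine ae_eq_of_comp_insertEquiv (i := i) ?_
  have h2 := Measure.ae_ae_of_ae_prod h1
  have h3 : ∀ᵐ z ∂((volume : Measure (TorusD n)).prod (volume : Measure Torus)),
      (fun t => f (insertEquiv i (z.1, t))) =ᵐ[volume] fun t => g (insertEquiv i (z.1, t)) :=
    Measure.quasiMeasurePreserving_fst.ae h2
  filter_upwards [h3] with z hz
  simp only [Function.comp_apply, inVariable_insertEquiv]
  rw [hU.congr _ _ hz]

theorem inVariable_add (hU : BoundedUnivariate p C U) (hp : 1 ≤ p) (i : Fin d)
    {f g : TorusD d → ℂ} (hf : MemLp f p volume) (hg : MemLp g p volume) :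
    inVariable i U (f + g) =ᵐ[volume] inVariable i U f + inVariable i U g := by
  obtain ⟨n, rfl⟩ : ∃ n, d = n + 1 := ⟨d - 1, by have := i.pos; omega⟩
  refine ae_eq_of_comp_insertEquiv (i := i) ?_
  have hmp := measurePreserving_insertEquiv i
  filter_upwards [Measure.quasiMeasurePreserving_fst.ae
      (memLp_slices hp (hf.comp_measurePreserving hmp)),
    Measure.quasiMeasurePreserving_fst.ae (memLp_slices hp (hg.comp_measurePreserving hmp))]
    with z hz1 hz2
  simp only [Function.comp_apply, inVariable_insertEquiv, Pi.add_apply]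
  exact congrFun (hU.add _ _ hz1 hz2) z.2

theorem memLp_inVariable (hU : BoundedUnivariate p C U) (hp : 1 ≤ p) (i : Fin d)
    {f : TorusD d → ℂ} (hf : MemLp f p volume) : MemLp (inVariable i U f) p volume ∧
      eLpNorm (inVariable i U f) p volume ≤ C * eLpNorm f p volume := by
  have hm : AEStronglyMeasurable (inVariable i U f) volume := by
    obtain ⟨n, rfl⟩ : ∃ n, d = n + 1 := ⟨d - 1, by have := i.pos; omega⟩
    have hmp := measurePreserving_insertEquiv i
    have h1 := hU.meas n (f ∘ insertEquiv i) (hf.comp_measurePreserving hmp)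
    have h2 : AEStronglyMeasurable (inVariable i U f ∘ insertEquiv i) (volume.prod volume) := by
      refine h1.congr (Filter.Eventually.of_forall fun z => ?_)
      simp only [Function.comp_apply, inVariable_insertEquiv]
    have h3 := h2.comp_measurePreserving hmp.symm
    simpa [Function.comp_assoc] using h3
  have hb := eLpNorm_le_of_slices hp i hf hm fun x hx => by
    simp only [inVariable_update]
    exact hU.bound _ hx
  exact ⟨⟨hm, hb.trans_lt (ENNReal.mul_lt_top ENNReal.coe_lt_top hf.2)⟩, hb⟩

theorem sub {U' : (Torus → ℂ) → Torus → ℂ} (hp : 1 ≤ p) (hU : BoundedUnivariate p C U)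
    (hU' : BoundedUnivariate p C U')
    (hm : ∀ h, AEStronglyMeasurable (U h) volume) (hm' : ∀ h, AEStronglyMeasurable (U' h) volume) :
    BoundedUnivariate p (C + C) (fun h x => U h x - U' h x) where
  congr h h' e := by rw [hU.congr _ _ e, hU'.congr _ _ e]
  add h h' m m' := by
    funext x
    simp only [hU.add _ _ m m', hU'.add _ _ m m', Pi.add_apply]
    ring
  smul a h := by
    funext x
    simp only [hU.smul, hU'.smul, Pi.smul_apply, smul_sub]
  bound h m := by
    push_cast
    rw [add_mul]
    exact (eLpNorm_sub_le (hm h) (hm' h) hp).trans (add_le_add (hU.bound h m) (hU'.bound h m))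
  meas n F hF := (hU.meas n F hF).sub (hU'.meas n F hF)

theorem mono {C' : ℝ≥0} (hU : BoundedUnivariate p C U) (h : C ≤ C') : BoundedUnivariate p C' U where
  congr := hU.congr
  add := hU.add
  smul := hU.smul
  bound h' m := (hU.bound h' m).trans (by gcongr)
  meas := hU.meas

end BoundedUnivariate

theorem conv_congr_ae {h h' g : Torus → ℂ} (e : h =ᵐ[volume] h') (x : Torus) :
    conv h g x = conv h' g x := by
  rw [conv, conv]
  congr 1
  refine integral_congr_ae ?_
  have := (measurePreserving_torus_sub_left x).quasiMeasurePreserving.ae_eq_comp e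
  filter_upwards [this] with t ht
  simp only [Function.comp_apply] at ht
  rw [ht]

theorem boundedUnivariate_quasiInterp {p q : ℝ≥0∞} [Fact (1 ≤ p)] [ENNReal.HolderConjugate p q]
    {φ φt : ℕ → Torus → ℂ} {j : ℕ} (hφ : Continuous (φ j)) (hφt : MemLp (φt j) q volume) {C : ℝ≥0}
    (hC : ∀ h, MemLp h p volume →
      eLpNorm (quasiInterp φ φt j h) p volume ≤ C * eLpNorm h p volume) :
    BoundedUnivariate p C (quasiInterp φ φt j) where
  congr h h' e := by
    funext x
    simp only [quasiInterp, conv_congr_ae e]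
  add h h' m m' := by
    have hc : ∀ x, conv (h + h') (φt j) x = conv h (φt j) x + conv h' (φt j) x := fun x => by
      have i1 : Integrable (fun t => h (x - t) * φt j t) volume :=
        MemLp.integrable_mul (m.comp_measurePreserving (measurePreserving_torus_sub_left x)) hφt
      have i2 : Integrable (fun t => h' (x - t) * φt j t) volume :=
        MemLp.integrable_mul (m'.comp_measurePreserving (measurePreserving_torus_sub_left x)) hφt
      rw [conv, conv, conv, ← mul_add, ← integral_add i1 i2]
      simp only [Pi.add_apply, add_mul]
    funext x
    simp only [quasiInterp, hc, Pi.add_apply, add_mul, Finset.sum_add_distrib, mul_add]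
  smul a h := by
    have hc : ∀ x, conv (a • h) (φt j) x = a * conv h (φt j) x := fun x => by
      simp only [conv, Pi.smul_apply, smul_eq_mul, mul_assoc, integral_const_mul]
      ring
    funext x
    simp only [quasiInterp, hc, Pi.smul_apply, smul_eq_mul, Finset.mul_sum]
    exact Finset.sum_congr rfl fun k _ => by ring
  bound := hC
  meas n F hF := by
    unfold quasiInterp
    refine AEStronglyMeasurable.const_mul ?_ _
    refine Finset.aestronglyMeasurable_fun_sum _ fun k _ => ?_
    refine AEStronglyMeasurable.mul ?_ ?_
    · refine AEStronglyMeasurable.comp_fst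
        (f := fun y : TorusD n => conv (fun t => F (y, t)) (φt j) ((node j k : ℝ) : Torus)) ?_
      unfold conv
      refine AEStronglyMeasurable.const_mul ?_ _
      refine AEStronglyMeasurable.integral_prod_right'
        (f := fun z : TorusD n × Torus => F (z.1, ((node j k : ℝ) : Torus) - z.2) * φt j z.2) ?_
      refine AEStronglyMeasurable.mul ?_ hφt.1.comp_snd
      exact hF.1.comp_measurePreserving ((MeasurePreserving.id volume).prod
        (measurePreserving_torus_sub_left ((node j k : ℝ) : Torus)))
    · have : Continuous fun z : TorusD n × Torus => φ j (z.2 - ((node j k : ℝ) : Torus)) := by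
        fun_prop
      exact this.aestronglyMeasurable_of_compactSpace

theorem boundedUnivariate_quasiInterpDiff {p q : ℝ≥0∞} [Fact (1 ≤ p)]
    [ENNReal.HolderConjugate p q]
    {φ φt : ℕ → Torus → ℂ} (hφ : ∀ j, Continuous (φ j)) (hφt : ∀ j, MemLp (φt j) q volume) {C : ℝ≥0}
    (hC : ∀ j h, MemLp h p volume →
      eLpNorm (quasiInterp φ φt j h) p volume ≤ C * eLpNorm h p volume) (j : ℕ) :
    BoundedUnivariate p (C + C) (quasiInterpDiff φ φt j) := by
  have hQ := fun j => boundedUnivariate_quasiInterp (hφ j) (hφt j) (hC j)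
  have hm := fun j h => (continuous_quasiInterp (φt := φt) (hφ j)
    h).aestronglyMeasurable_of_compactSpace (μ := volume)
  cases j with
  | zero => exact (hQ 0).mono le_self_add
  | succ j => exact (hQ _).sub Fact.out (hQ _) (hm _) (hm _)

/-! ### Composition over the variables -/

/-- Composition of univariate operators acting in the variables listed in `l`. -/
def composeVars {d : ℕ} (U : Fin d → (Torus → ℂ) → Torus → ℂ) (l : List (Fin d))
    (f : TorusD d → ℂ) : TorusD d → ℂ :=
  l.foldr (fun i g => inVariable i (U i) g) f

section Compose
variable {d : ℕ} {p : ℝ≥0∞} {C : ℝ≥0} {U : Fin d → (Torus → ℂ) → Torus → ℂ}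

theorem composeVars_congr (hU : ∀ i, BoundedUnivariate p C (U i)) (l : List (Fin d))
    {f g : TorusD d → ℂ} (h : f =ᵐ[volume] g) : composeVars U l f =ᵐ[volume] composeVars U l g := by
  induction l with
  | nil => exact h
  | cons i l ih => exact (hU i).inVariable_congr i ih

theorem memLp_composeVars (hU : ∀ i, BoundedUnivariate p C (U i)) (hp : 1 ≤ p) (l : List (Fin d))
    {f : TorusD d → ℂ} (hf : MemLp f p volume) : MemLp (composeVars U l f) p volume ∧
      eLpNorm (composeVars U l f) p volume ≤ (C ^ l.length : ℝ≥0) * eLpNorm f p volume := by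
  induction l with
  | nil => exact ⟨hf, by simp [composeVars]⟩
  | cons i l ih =>
    obtain ⟨h1, h2⟩ := (hU i).memLp_inVariable hp i ih.1
    refine ⟨h1, h2.trans ?_⟩
    calc (C : ℝ≥0∞) * eLpNorm (composeVars U l f) p volume
        ≤ C * ((C ^ l.length : ℝ≥0) * eLpNorm f p volume) := by gcongr; exact ih.2
      _ = _ := by
        rw [List.length_cons, pow_succ]
        push_cast
        ring

theorem composeVars_add (hU : ∀ i, BoundedUnivariate p C (U i)) (hp : 1 ≤ p) (l : List (Fin d))
    {f g : TorusD d → ℂ} (hf : MemLp f p volume) (hg : MemLp g p volume) :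
    composeVars U l (f + g) =ᵐ[volume] composeVars U l f + composeVars U l g := by
  induction l with
  | nil => exact Filter.EventuallyEq.rfl
  | cons i l ih =>
    exact ((hU i).inVariable_congr i ih).trans ((hU i).inVariable_add hp i
      (memLp_composeVars hU hp l hf).1 (memLp_composeVars hU hp l hg).1)

end Compose

/-! ### Multivariate trigonometric polynomials -/

section
variable {d : ℕ}

/-- The product function `x ↦ ∏_i v_i(x_i)`. -/
def tensor (v : Fin d → Torus → ℂ) (x : TorusD d) : ℂ := ∏ i, v i (x i)

/-- The trigonometric polynomial `∑_{k ∈ F} c_k e^{i(k,x)}` in `d` variables. -/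
def mTrigSum (F : Finset (Fin d → ℤ)) (c : (Fin d → ℤ) → ℂ) (x : TorusD d) : ℂ :=
  ∑ k ∈ F, c k * mChar k x

/-- The span of the characters `x ↦ e^{i(k,x)}` with `k_i ∈ S_i` for all `i`. -/
def mTrigSpan (S : Fin d → Set ℤ) : Submodule ℂ (TorusD d → ℂ) :=
  Submodule.span ℂ (mChar '' {k | ∀ i, k i ∈ S i})

theorem continuous_mChar (k : Fin d → ℤ) : Continuous (mChar k) := by
  unfold mChar
  fun_prop

theorem norm_mChar (k : Fin d → ℤ) (x : TorusD d) : ‖mChar k x‖ = 1 := by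
  rw [mChar, norm_prod]
  exact Finset.prod_eq_one fun i _ => by
    rw [fourier_apply]
    exact Circle.norm_coe _

theorem continuous_mTrigSum (F : Finset (Fin d → ℤ)) (c : (Fin d → ℤ) → ℂ) :
    Continuous (mTrigSum F c) := by
  have := continuous_mChar (d := d)
  unfold mTrigSum
  fun_prop

theorem mChar_update (k : Fin d → ℤ) (x : TorusD d) (i : Fin d) (t : Torus) :
    mChar k (Function.update x i t)
      = (∏ i' ∈ Finset.univ.erase i, (fourier (k i') (x i') : ℂ)) * fourier (k i) t := by
  rw [mChar, ← Finset.mul_prod_erase _ _ (Finset.mem_univ i), Function.update_self, mul_comm]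
  congr 1
  refine Finset.prod_congr rfl fun i' hi' => ?_
  rw [Function.update_of_ne (Finset.ne_of_mem_erase hi')]

theorem exists_mTrigSum_of_mem {S : Fin d → Set ℤ} {f : TorusD d → ℂ} (hf : f ∈ mTrigSpan S) :
    ∃ (F : Finset (Fin d → ℤ)) (c : (Fin d → ℤ) → ℂ),
      (∀ k ∈ F, ∀ i, k i ∈ S i) ∧ f = mTrigSum F c := by
  obtain ⟨l, hl, rfl⟩ := (Finsupp.mem_span_image_iff_linearCombination ℂ).1 hf
  refine ⟨l.support, l, fun k hk => hl hk, ?_⟩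
  funext x
  rw [Finsupp.linearCombination_apply, Finsupp.sum, Finset.sum_apply]
  rfl

theorem mTrigSum_mem {S : Fin d → Set ℤ} {F : Finset (Fin d → ℤ)} {c : (Fin d → ℤ) → ℂ}
    (hF : ∀ k ∈ F, c k ≠ 0 → ∀ i, k i ∈ S i) : mTrigSum F c ∈ mTrigSpan S := by
  have : mTrigSum F c = ∑ k ∈ F, c k • mChar k := by
    funext x
    rw [Finset.sum_apply]
    rfl
  rw [this]
  refine Submodule.sum_mem _ fun k hk => ?_
  by_cases h : c k = 0
  · rw [h, zero_smul]
    exact Submodule.zero_mem _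
  · exact Submodule.smul_mem _ _ (Submodule.subset_span ⟨k, hF k hk h, rfl⟩)

theorem continuous_of_mem_mTrigSpan {S : Fin d → Set ℤ} {f : TorusD d → ℂ} (hf : f ∈ mTrigSpan S) :
    Continuous f := by
  obtain ⟨F, c, _, rfl⟩ := exists_mTrigSum_of_mem hf
  exact continuous_mTrigSum F c

theorem memLp_of_mem_mTrigSpan {S : Fin d → Set ℤ} {f : TorusD d → ℂ} (hf : f ∈ mTrigSpan S)
    (p : ℝ≥0∞) : MemLp f p volume := continuous_memLp (continuous_of_mem_mTrigSpan hf) p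

/-- The slices of a trigonometric polynomial in the variable `x_i`. -/
theorem mTrigSum_update (F : Finset (Fin d → ℤ)) (c : (Fin d → ℤ) → ℂ) (lam : ℤ → ℂ) (x : TorusD d)
    (i : Fin d) : (fun t => mTrigSum F (fun k => lam (k i) * c k) (Function.update x i t))
      = trigSum (F.image fun k => k i) (fun n => lam n * ∑ k ∈ F with k i = n,
          c k * ∏ i' ∈ Finset.univ.erase i, (fourier (k i') (x i') : ℂ)) := by
  funext t
  rw [mTrigSum, trigSum, ← Finset.sum_fiberwise_of_maps_to (t := F.image fun k => k i)
    (g := fun k => k i) fun k hk => Finset.mem_image_of_mem _ hk]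
  refine Finset.sum_congr rfl fun n _ => ?_
  rw [Finset.mul_sum, Finset.sum_mul]
  refine Finset.sum_congr rfl fun k hk => ?_
  rw [mChar_update, (Finset.mem_filter.1 hk).2]
  ring

theorem exists_slice_eq_trigSum {S : Fin d → Set ℤ} {f : TorusD d → ℂ} (hf : f ∈ mTrigSpan S)
    (x : TorusD d) (i : Fin d) : ∃ (F : Finset ℤ) (c : ℤ → ℂ), (F : Set ℤ) ⊆ S i ∧
      (fun t => f (Function.update x i t)) = trigSum F c := by
  classical
  obtain ⟨F, c, hF, rfl⟩ := exists_mTrigSum_of_mem hf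
  have := mTrigSum_update F c (fun _ => 1) x i
  simp only [one_mul] at this
  refine ⟨F.image fun k => k i, _, ?_, this⟩
  intro n hn
  obtain ⟨k, hk, rfl⟩ := Finset.mem_image.1 hn
  exact hF k hk i

/-- A univariate multiplier acting in the variable `x_i`. -/
theorem MultBound.mTrigSum {p : ℝ≥0∞} (hp : 1 ≤ p) {lam : ℤ → ℂ} {M : ℝ≥0} (h : MultBound p lam M)
    (i : Fin d) (F : Finset (Fin d → ℤ)) (c : (Fin d → ℤ) → ℂ) :
    eLpNorm (mTrigSum F fun k => lam (k i) * c k) p volume ≤ M * eLpNorm (mTrigSum F c) p volume := by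
  refine eLpNorm_le_of_slices hp i (continuous_memLp (continuous_mTrigSum _ _) p)
    (continuous_mTrigSum _ _).aestronglyMeasurable_of_compactSpace fun x _ => ?_
  have h1 := mTrigSum_update F c (fun _ => 1) x i
  simp only [one_mul] at h1
  rw [mTrigSum_update, h1]
  exact h _ _

theorem eLpNorm_mTrigSum_prod_le {p : ℝ≥0∞} (hp : 1 ≤ p) {lam : Fin d → ℤ → ℂ} {M : ℝ≥0}
    (h : ∀ i, MultBound p (lam i) M) (F : Finset (Fin d → ℤ)) (c : (Fin d → ℤ) → ℂ) :
    eLpNorm (mTrigSum F fun k => (∏ i, lam i (k i)) * c k) p volume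
      ≤ (M ^ d : ℝ≥0) * eLpNorm (mTrigSum F c) p volume := by
  have key : ∀ s : Finset (Fin d),
      eLpNorm (mTrigSum F fun k => (∏ i ∈ s, lam i (k i)) * c k) p volume
        ≤ (M ^ s.card : ℝ≥0) * eLpNorm (mTrigSum F c) p volume := fun s => by
    induction s using Finset.induction_on with
    | empty => simp
    | insert i s hi ih =>
      have h1 := (h i).mTrigSum hp i F fun k => (∏ i ∈ s, lam i (k i)) * c k
      simp only [← mul_assoc] at h1
      simp only [Finset.prod_insert hi]
      refine h1.trans ?_
      rw [Finset.card_insert_of_notMem hi, pow_succ]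
      calc _ ≤ (M : ℝ≥0∞) * ((M ^ s.card : ℝ≥0) * eLpNorm (mTrigSum F c) p volume) := by gcongr
        _ = _ := by
          push_cast
          ring
  have := key Finset.univ
  rwa [Finset.card_univ, Fintype.card_fin] at this

/-! ### Composed univariate operators on trigonometric polynomials -/

theorem inVariable_tensor {p : ℝ≥0∞} {C : ℝ≥0} {U : (Torus → ℂ) → Torus → ℂ}
    (hU : BoundedUnivariate p C U) (i : Fin d) (v : Fin d → Torus → ℂ) :
    inVariable i U (tensor v) = tensor (Function.update v i (U (v i))) := by
  funext x
  have h1 : (fun t => tensor v (Function.update x i t))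
      = (∏ i' ∈ Finset.univ.erase i, v i' (x i')) • v i := by
    funext t
    rw [tensor, ← Finset.mul_prod_erase _ _ (Finset.mem_univ i), Function.update_self, mul_comm,
      Pi.smul_apply, smul_eq_mul]
    congr 1
    refine Finset.prod_congr rfl fun i' hi' => ?_
    rw [Function.update_of_ne (Finset.ne_of_mem_erase hi')]
  rw [inVariable, h1, hU.smul, tensor, ← Finset.mul_prod_erase _ _ (Finset.mem_univ i),
    Function.update_self, mul_comm, Pi.smul_apply, smul_eq_mul]
  congr 1
  refine Finset.prod_congr rfl fun i' hi' => ?_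
  rw [Function.update_of_ne (Finset.ne_of_mem_erase hi')]

theorem mChar_eq_tensor (k : Fin d → ℤ) :
    mChar k = tensor fun i => (fun t : Torus => (fourier (k i) t : ℂ)) := rfl

theorem composeVars_mChar {p : ℝ≥0∞} {C : ℝ≥0} {U : Fin d → (Torus → ℂ) → Torus → ℂ}
    (hU : ∀ i, BoundedUnivariate p C (U i)) (k : Fin d → ℤ) (l : List (Fin d)) (hl : l.Nodup) :
    composeVars U l (mChar k) = tensor fun i =>
      if i ∈ l then U i (fun t => fourier (k i) t) else fun t => fourier (k i) t := by
  induction l with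
  | nil =>
    simp only [composeVars, List.foldr_nil, List.not_mem_nil, if_false]
    rfl
  | cons i l ih =>
    rw [List.nodup_cons] at hl
    change inVariable i (U i) (composeVars U l (mChar k)) = _
    rw [ih hl.2, inVariable_tensor (hU i)]
    congr 1
    funext i'
    rcases eq_or_ne i' i with rfl | h
    · simp [hl.1]
    · simp [h]

theorem inVariable_add_of_continuous {p : ℝ≥0∞} {C : ℝ≥0} {U : (Torus → ℂ) → Torus → ℂ}
    (hU : BoundedUnivariate p C U) (i : Fin d) {f g : TorusD d → ℂ} (hf : Continuous f)
    (hg : Continuous g) : inVariable i U (f + g) = inVariable i U f + inVariable i U g := by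
  funext x
  have h1 : Continuous fun t => f (Function.update x i t) := by fun_prop
  have h2 : Continuous fun t => g (Function.update x i t) := by fun_prop
  have := hU.add _ _ (continuous_memLp h1 p) (continuous_memLp h2 p)
  simp only [inVariable, Pi.add_apply]
  exact congrFun this (x i)

theorem inVariable_mem_mTrigSpan {p : ℝ≥0∞} {C : ℝ≥0} {U : (Torus → ℂ) → Torus → ℂ}
    (hU : BoundedUnivariate p C U) (i : Fin d) {S : Fin d → Set ℤ} {S' : Set ℤ}
    (hS' : ∀ k : ℤ, U (fun t => fourier k t) ∈ trigSpan S') {f : TorusD d → ℂ}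
    (hf : f ∈ mTrigSpan S) : inVariable i U f ∈ mTrigSpan (Function.update S i S') := by
  induction hf using Submodule.span_induction with
  | mem f hf =>
    obtain ⟨k, hk, rfl⟩ := hf
    rw [mChar_eq_tensor, inVariable_tensor hU]
    obtain ⟨F, c, hF, hc⟩ := exists_trigSum_of_mem_trigSpan (hS' (k i))
    have h1 : tensor (Function.update (fun i => (fun t : Torus => (fourier (k i) t : ℂ))) i
        (U fun t => fourier (k i) t)) = ∑ n ∈ F, c n • mChar (Function.update k i n) := by
      funext x
      rw [tensor, ← Finset.mul_prod_erase _ _ (Finset.mem_univ i), Function.update_self, hc, trigSum,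
        Finset.sum_mul, Finset.sum_apply]
      refine Finset.sum_congr rfl fun n _ => ?_
      rw [Pi.smul_apply, smul_eq_mul, mChar, ← Finset.mul_prod_erase _ _ (Finset.mem_univ i),
        Function.update_self, mul_assoc]
      congr 2
      refine Finset.prod_congr rfl fun i' hi' => ?_
      rw [Function.update_of_ne (Finset.ne_of_mem_erase hi'),
        Function.update_of_ne (Finset.ne_of_mem_erase hi')]
    rw [h1]
    refine Submodule.sum_mem _ fun n hn => Submodule.smul_mem _ _ (Submodule.subset_span
      ⟨_, fun i' => ?_, rfl⟩)
    rcases eq_or_ne i' i with rfl | h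
    · rw [Function.update_self, Function.update_self]
      exact hF hn
    · rw [Function.update_of_ne h, Function.update_of_ne h]
      exact hk i'
  | zero =>
    have : inVariable i U (0 : TorusD d → ℂ) = 0 := by
      funext x
      have h := hU.smul 0 0
      rw [zero_smul, zero_smul] at h
      exact congrFun h (x i)
    rw [this]
    exact Submodule.zero_mem _
  | add f g hf hg ihf ihg =>
    rw [inVariable_add_of_continuous hU i (continuous_of_mem_mTrigSpan hf)
      (continuous_of_mem_mTrigSpan hg)]
    exact Submodule.add_mem _ ihf ihg
  | smul a f _ ih =>
    have : inVariable i U (a • f) = a • inVariable i U f := by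
      funext x
      exact congrFun (hU.smul a fun t => f (Function.update x i t)) (x i)
    rw [this]
    exact Submodule.smul_mem _ _ ih

/-- Spectrum and norm of composed univariate operators: an operator acting in `x_i` does not change
the spectrum in the other variables, so that the one-dimensional bounds on spectral sets multiply. -/
theorem composeVars_mTrigSpan {p : ℝ≥0∞} (hp : 1 ≤ p) {C : ℝ≥0}
    {U : Fin d → (Torus → ℂ) → Torus → ℂ} (hU : ∀ i, BoundedUnivariate p C (U i))
    {S S' : Fin d → Set ℤ} (hS' : ∀ i (k : ℤ), U i (fun t => fourier k t) ∈ trigSpan (S' i))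
    {A : Fin d → ℝ≥0} (hA : ∀ i (F : Finset ℤ) (c : ℤ → ℂ), (F : Set ℤ) ⊆ S i →
      eLpNorm (U i (trigSum F c)) p volume ≤ A i * eLpNorm (trigSum F c) p volume)
    (l : List (Fin d)) (hl : l.Nodup) {f : TorusD d → ℂ} (hf : f ∈ mTrigSpan S) :
    composeVars U l f ∈ mTrigSpan (fun i => if i ∈ l then S' i else S i) ∧
      eLpNorm (composeVars U l f) p volume ≤ ((l.map A).prod : ℝ≥0) * eLpNorm f p volume := by
  induction l with
  | nil => simpa [composeVars] using hf
  | cons i l ih =>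
    rw [List.nodup_cons] at hl
    obtain ⟨ih1, ih2⟩ := ih hl.2
    have hm := inVariable_mem_mTrigSpan (hU i) i (hS' i) ih1
    refine ⟨?_, ?_⟩
    · have : (fun i' => if i' ∈ i :: l then S' i' else S i')
          = Function.update (fun i' => if i' ∈ l then S' i' else S i') i (S' i) := by
        funext i'
        rcases eq_or_ne i' i with rfl | h
        · simp
        · simp [h]
      rw [this]
      exact hm
    · change eLpNorm (inVariable i (U i) (composeVars U l f)) p volume ≤ _
      have h1 : eLpNorm (inVariable i (U i) (composeVars U l f)) p volume
          ≤ A i * eLpNorm (composeVars U l f) p volume := by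
        refine eLpNorm_le_of_slices hp i (memLp_of_mem_mTrigSpan ih1 p)
          (memLp_of_mem_mTrigSpan hm p).1 fun x _ => ?_
        obtain ⟨F, c, hF, hFc⟩ := exists_slice_eq_trigSum ih1 x i
        simp only [inVariable_update]
        rw [hFc]
        refine hA i F c ?_
        rwa [if_neg hl.1] at hF
      refine h1.trans ?_
      rw [List.map_cons, List.prod_cons]
      push_cast
      rw [mul_assoc]
      gcongr

theorem translate_mem_trigSpan {S : Set ℤ} {f : Torus → ℂ} (hf : f ∈ trigSpan S) (y : Torus) :
    (fun x => f (x - y)) ∈ trigSpan S := by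
  obtain ⟨F, c, hF, rfl⟩ := exists_trigSum_of_mem_trigSpan hf
  have : (fun x => trigSum F c (x - y)) = trigSum F (fun k => c k * fourier (-k) y) := by
    funext x
    simp only [trigSum, fourier_sub_apply]
    exact Finset.sum_congr rfl fun k _ => by ring
  rw [this]
  exact trigSum_mem_trigSpan hF _

theorem quasiInterp_mem_trigPoly {φ φt : ℕ → Torus → ℂ} {j : ℕ} (hφ : φ j ∈ trigPoly j)
    (h : Torus → ℂ) : quasiInterp φ φt j h ∈ trigPoly j := by
  have : quasiInterp φ φt j h = ((2 : ℂ) ^ j)⁻¹ • ∑ k ∈ nodeIdx j,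
      conv h (φt j) ((node j k : ℝ) : Torus) • fun x => φ j (x - ((node j k : ℝ) : Torus)) := by
    funext x
    simp [quasiInterp]
  rw [this]
  exact Submodule.smul_mem _ _ (Submodule.sum_mem _ fun k _ =>
    Submodule.smul_mem _ _ (translate_mem_trigSpan hφ _))

theorem quasiInterpDiff_mem_trigPoly {φ φt : ℕ → Torus → ℂ} (hφ : ∀ j, φ j ∈ trigPoly j) (j : ℕ)
    (h : Torus → ℂ) : quasiInterpDiff φ φt j h ∈ trigPoly j := by
  cases j with
  | zero => exact quasiInterp_mem_trigPoly (hφ 0) h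
  | succ j =>
    refine Submodule.sub_mem _ (quasiInterp_mem_trigPoly (hφ _) h) ?_
    have hle : trigPoly j ≤ trigPoly (j + 1) := by
      have : (2 : ℤ) ^ j ≤ 2 ^ (j + 1) := pow_le_pow_right₀ one_le_two (Nat.le_succ j)
      exact Submodule.span_mono (Set.image_mono (Set.Ico_subset_Ico (by omega) this))
    exact hle (quasiInterp_mem_trigPoly (hφ _) h)

end

/-! ### Fourier coefficients and dyadic blocks on the `d`-dimensional torus -/

section
variable {d : ℕ}

theorem mChar_add (k l : Fin d → ℤ) (x : TorusD d) : mChar (k + l) x = mChar k x * mChar l x := by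
  simp only [mChar, Pi.add_apply, fourier_add, Finset.prod_mul_distrib]

theorem integral_mChar (k : Fin d → ℤ) :
    ∫ x, mChar k x = if k = 0 then (((2 * Real.pi) ^ d : ℝ) : ℂ) else 0 := by
  have h1 : ∀ n : ℤ, ∫ t : Torus, (fourier n t : ℂ) = if n = 0 then ((2 * Real.pi : ℝ) : ℂ) else 0 :=
    fun n => by
      have h2 := fourierCoeff_fourier (T := 2 * Real.pi) n
      have h3 := congrFun h2 0
      rw [fourierCoeff, AddCircle.integral_haarAddCircle, inv_smul_eq_iff₀ (by positivity)] at h3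
      simp only [neg_zero, fourier_zero, one_smul] at h3
      rw [h3, Pi.single_apply]
      split_ifs with h h' h'
      · simp
      · exact absurd h.symm h'
      · exact absurd h'.symm h
      · simp
  unfold mChar
  rw [integral_fintype_prod_volume_eq_prod (fun i (t : Torus) => (fourier (k i) t : ℂ))]
  simp only [h1]
  split_ifs with h
  · simp [h]
  · obtain ⟨i, hi⟩ := Function.ne_iff.1 h
    exact Finset.prod_eq_zero (Finset.mem_univ i) (by simpa using hi)

theorem Integrable.mul_mChar {f : TorusD d → ℂ} (hf : Integrable f volume) (k : Fin d → ℤ) :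
    Integrable (fun x => f x * mChar k x) volume :=
  hf.mul_bdd (c := 1) (continuous_mChar k).aestronglyMeasurable_of_compactSpace
    (Filter.Eventually.of_forall fun x => (norm_mChar k x).le)

theorem mCoeff_congr_ae {f g : TorusD d → ℂ} (h : f =ᵐ[volume] g) (k : Fin d → ℤ) :
    mCoeff f k = mCoeff g k := by
  rw [mCoeff, mCoeff]
  congr 1
  refine integral_congr_ae ?_
  filter_upwards [h] with x hx
  rw [hx]

theorem mCoeff_add {f g : TorusD d → ℂ} (hf : Integrable f volume) (hg : Integrable g volume)
    (k : Fin d → ℤ) : mCoeff (f + g) k = mCoeff f k + mCoeff g k := by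
  rw [mCoeff, mCoeff, mCoeff, ← mul_add,
    ← integral_add (Integrable.mul_mChar hf _) (Integrable.mul_mChar hg _)]
  simp only [Pi.add_apply, add_mul]

theorem mCoeff_smul (a : ℂ) (f : TorusD d → ℂ) (k : Fin d → ℤ) :
    mCoeff (a • f) k = a * mCoeff f k := by
  simp only [mCoeff, Pi.smul_apply, smul_eq_mul, mul_assoc, integral_const_mul]
  ring

theorem mCoeff_mChar (l k : Fin d → ℤ) : mCoeff (mChar l) k = if l = k then 1 else 0 := by
  rw [mCoeff]
  simp_rw [← mChar_add, integral_mChar, ← sub_eq_add_neg, sub_eq_zero]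
  split_ifs
  · rw [← Complex.ofReal_mul, inv_mul_cancel₀ (by positivity), Complex.ofReal_one]
  · rw [mul_zero]

theorem mCoeff_mTrigSum (F : Finset (Fin d → ℤ)) (c : (Fin d → ℤ) → ℂ) (k : Fin d → ℤ) :
    mCoeff (mTrigSum F c) k = if k ∈ F then c k else 0 := by
  have hi : ∀ l, Integrable (mChar l) (volume : Measure (TorusD d)) := fun l =>
    (continuous_memLp (p := 1) (continuous_mChar l)).integrable le_rfl
  have key : ∀ G : Finset (Fin d → ℤ), mCoeff (mTrigSum G c) k = if k ∈ G then c k else 0 := by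
    intro G
    induction G using Finset.induction_on with
    | empty => simp [mTrigSum, mCoeff]
    | insert l G hl ih =>
      have e : mTrigSum (insert l G) c = c l • mChar l + mTrigSum G c := by
        funext x
        simp [mTrigSum, Finset.sum_insert hl]
      rw [e, mCoeff_add ((hi l).smul _) ((continuous_memLp (p := 1)
        (continuous_mTrigSum G c)).integrable le_rfl), ih, mCoeff_smul, mCoeff_mChar]
      rcases eq_or_ne l k with rfl | h
      · simp [hl]
      · simp [h, h.symm]
  exact key F

theorem norm_mCoeff_le (f : TorusD d → ℂ) (k : Fin d → ℤ) :
    ‖mCoeff f k‖ ≤ ((2 * Real.pi) ^ d)⁻¹ * ∫ x, ‖f x‖ := by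
  rw [mCoeff, norm_mul, Complex.norm_real, Real.norm_of_nonneg (by positivity)]
  gcongr
  refine (norm_integral_le_integral_norm _).trans (le_of_eq ?_)
  simp only [norm_mul, norm_mChar, mul_one]

/-- An integrable function on the torus is determined by its Fourier coefficients. -/
theorem ae_eq_zero_of_mCoeff_eq_zero {f : TorusD d → ℂ} (hf : Integrable f volume)
    (h : ∀ k, mCoeff f k = 0) : f =ᵐ[volume] 0 := by
  let e : (Fin d → ℤ) → C(TorusD d, ℂ) := fun k => ⟨mChar k, continuous_mChar k⟩
  let A : StarSubalgebra ℂ C(TorusD d, ℂ) :=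
    { toSubalgebra := Algebra.adjoin ℂ (Set.range e)
      star_mem' := by
        change Algebra.adjoin ℂ (Set.range e) ≤ star (Algebra.adjoin ℂ (Set.range e))
        refine Algebra.adjoin_le ?_
        rintro - ⟨k, rfl⟩
        refine Algebra.subset_adjoin ⟨-k, ?_⟩
        ext x
        simp [e, mChar] }
  have hspan : Subalgebra.toSubmodule A.toSubalgebra = Submodule.span ℂ (Set.range e) := by
    have hsub : ∀ g ∈ Submonoid.closure (Set.range e), g ∈ Set.range e := fun g hg => by
      induction hg using Submonoid.closure_induction with
      | mem _ h => exact h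
      | one => exact ⟨0, by ext x; simp [e, mChar]⟩
      | mul _ _ _ _ h1 h2 =>
        obtain ⟨m, rfl⟩ := h1
        obtain ⟨n, rfl⟩ := h2
        exact ⟨m + n, by ext x; exact mChar_add m n x⟩
    exact Algebra.adjoin_eq_span_of_subset ℂ (fun g hg => Submodule.subset_span (hsub g hg))
  have hsep : A.SeparatesPoints := by
    intro x y hxy
    obtain ⟨i, hi⟩ := Function.ne_iff.1 hxy
    refine ⟨_, ⟨e (Pi.single i 1), Algebra.subset_adjoin ⟨_, rfl⟩, rfl⟩, ?_⟩
    have hs : ∀ z : TorusD d, mChar (Pi.single i 1) z = fourier 1 (z i) := fun z => by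
      rw [mChar, Finset.prod_eq_single i]
      · rw [Pi.single_eq_same]
      · intro b _ hb
        rw [Pi.single_eq_of_ne hb, fourier_zero]
      · exact fun h => absurd (Finset.mem_univ i) h
    change mChar (Pi.single i 1) x ≠ mChar (Pi.single i 1) y
    rw [hs, hs, fourier_one, fourier_one]
    contrapose hi
    exact AddCircle.injective_toCircle Real.two_pi_pos.ne' (Circle.ext hi)
  have hdense : (Submodule.span ℂ (Set.range e)).topologicalClosure = ⊤ := by
    rw [← hspan]
    exact congr_arg (Subalgebra.toSubmodule <| StarSubalgebra.toSubalgebra ·)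
      (ContinuousMap.starSubalgebra_topologicalClosure_eq_top_of_separatesPoints A hsep)
  have hint : ∀ g : C(TorusD d, ℂ), Integrable (fun x => g x * f x) volume := fun g =>
    hf.bdd_mul (c := ‖g‖) g.continuous.aestronglyMeasurable_of_compactSpace
      (Filter.Eventually.of_forall fun x => g.norm_coe_le_norm x)
  let L : C(TorusD d, ℂ) →L[ℂ] ℂ := LinearMap.mkContinuous
    { toFun := fun g => ∫ x, g x * f x
      map_add' := fun g g' => by
        rw [← integral_add (hint g) (hint g')]
        simp only [ContinuousMap.add_apply, add_mul]
      map_smul' := fun a g => by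
        simp only [ContinuousMap.smul_apply, smul_eq_mul, mul_assoc, integral_const_mul,
          RingHom.id_apply] } (∫ x, ‖f x‖) fun g => by
      change ‖∫ x, g x * f x‖ ≤ _
      rw [mul_comm (∫ x, ‖f x‖) ‖g‖, ← integral_const_mul]
      refine (norm_integral_le_integral_norm _).trans
        (integral_mono (hint g).norm (hf.norm.const_mul _) fun x => ?_)
      simp only [norm_mul]
      gcongr
      exact g.norm_coe_le_norm x
  have hL : ∀ g, L g = 0 := fun g => by
    have hle : (Submodule.span ℂ (Set.range e)).topologicalClosure ≤ LinearMap.ker L.toLinearMap := by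
      refine Submodule.topologicalClosure_minimal _ (Submodule.span_le.2 ?_) L.isClosed_ker
      rintro - ⟨k, rfl⟩
      have h1 := h (-k)
      rw [mCoeff, neg_neg, mul_eq_zero] at h1
      rcases h1 with h1 | h1
      · have : ((2 * Real.pi) ^ d)⁻¹ ≠ 0 := by positivity
        exact absurd (by exact_mod_cast h1) this
      · change ∫ x, mChar k x * f x = 0
        simpa only [mul_comm] using h1
    rw [hdense] at hle
    exact hle Submodule.mem_top
  refine ae_eq_zero_of_forall_setIntegral_isClosed_eq_zero hf fun s hs => ?_
  -- The indicator of a closed set is the limit of a bounded sequence of continuous functions.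
  let u : ℕ → TorusD d → ℂ := fun n x => ((hs.apprSeq n x : ℝ) : ℂ)
  have hu : ∀ n, Continuous (u n) := fun n =>
    Complex.continuous_ofReal.comp (NNReal.continuous_coe.comp (hs.apprSeq n).continuous)
  have h0 : ∀ n, ∫ x, u n x * f x = 0 := fun n => hL ⟨u n, hu n⟩
  have hlim : Filter.Tendsto (fun n => ∫ x, u n x * f x) Filter.atTop
      (nhds (∫ x, s.indicator f x)) := by
    refine tendsto_integral_of_dominated_convergence (fun x => ‖f x‖)
      (fun n => (hint ⟨u n, hu n⟩).aestronglyMeasurable) hf.norm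
      (fun n => Filter.Eventually.of_forall fun x => ?_) (Filter.Eventually.of_forall fun x => ?_)
    · rw [norm_mul, Complex.norm_real, Real.norm_of_nonneg (NNReal.coe_nonneg _)]
      have := HasOuterApproxClosed.apprSeq_apply_le_one hs n x
      have h2 : (hs.apprSeq n x : ℝ) ≤ 1 := by exact_mod_cast this
      exact mul_le_of_le_one_left (norm_nonneg _) h2
    · have h1 := (tendsto_pi_nhds.1 (HasOuterApproxClosed.tendsto_apprSeq hs)) x
      have h2 : Filter.Tendsto (fun n => u n x) Filter.atTop
          (nhds (((s.indicator (fun _ => (1 : ℝ≥0)) x : ℝ≥0) : ℝ) : ℂ)) :=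
        (Complex.continuous_ofReal.tendsto _).comp ((NNReal.continuous_coe.tendsto _).comp h1)
      have h3 := h2.mul_const (f x)
      convert h3 using 2
      by_cases hx : x ∈ s <;> simp [hx]
  rw [← integral_indicator hs.measurableSet]
  simp_rw [h0] at hlim
  exact (tendsto_nhds_unique hlim tendsto_const_nhds)

/-! ### The blocks of a dyadic resolution of unity -/

theorem resolution_mem_dyadicSet {ψ : ℕ → ℝ → ℂ} (hψ : IsSmoothResolution ψ) {m : ℕ} {k : ℤ}
    (h : ψ m k ≠ 0) : k ∈ dyadicSet m := by
  cases m with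
  | zero =>
    refine ⟨?_, fun h => by omega⟩
    simpa using hψ.support_zero _ h
  | succ m =>
    obtain ⟨h1, h2⟩ := hψ.support_pos (m + 1) (by omega) _ h
    refine ⟨?_, fun _ => ?_⟩
    · rw [pow_succ'] at h2
      exact h2
    · have : (2 : ℝ) ^ (((m + 1 : ℕ) : ℤ) - 1) = 2 ^ m := by
        rw [← zpow_natCast]
        congr 1
        push_cast
        ring
      rw [this] at h1
      rw [pow_succ']
      linarith

/-- The functions of a smooth resolution of unity are uniformly bounded multipliers on all `L_p`. -/
theorem resolution_multBound {ψ : ℕ → ℝ → ℂ} (hψ : IsSmoothResolution ψ) (p : ℝ≥0∞)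
    [Fact (1 ≤ p)] : ∃ M : ℝ≥0, ∀ m, MultBound p (fun k => ψ m k) M := by
  obtain ⟨c₀, hc₀⟩ := hψ.deriv_bound 0
  obtain ⟨c₁, hc₁⟩ := hψ.deriv_bound 1
  obtain ⟨A, hA⟩ : ∃ A : ℝ≥0, (A : ℝ) = max (max c₀ c₁) 1 :=
    ⟨Real.toNNReal (max (max c₀ c₁) 1), Real.coe_toNNReal _ (by positivity)⟩
  have hA0 : c₀ ≤ A := by rw [hA]; exact (le_max_left _ _).trans (le_max_left _ _)
  have hA1 : c₁ ≤ A := by rw [hA]; exact (le_max_right _ _).trans (le_max_left _ _)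
  have hApos : 0 < A := by
    rw [← NNReal.coe_pos, hA]
    positivity
  refine ⟨8 * A, fun m => ?_⟩
  have hone : 1 ≤ 2 ^ m := Nat.one_le_two_pow
  have h2m : (0 : ℝ) < 2 ^ m := by positivity
  refine multBound_of_lipschitz hApos (N := 2 ^ m) (R := 2 * 2 ^ m + 1) (by positivity) (by omega)
    (fun k hk => ?_) (fun k => ?_) fun k => ?_
  · have h1 := (resolution_mem_dyadicSet hψ hk).1
    have h2 : |k| ≤ 2 * 2 ^ m := by exact_mod_cast h1
    push_cast
    omega
  · have := hc₀ m k
    simp only [mul_zero, pow_zero, one_mul, iteratedDeriv_zero] at this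
    exact this.trans hA0
  · have hdiff : Differentiable ℝ (ψ m) := (hψ.smooth m).differentiable (by simp)
    have hb : ∀ x : ℝ, ‖deriv (ψ m) x‖ ≤ A / 2 ^ m := fun x => by
      have := hc₁ m x
      rw [mul_one, iteratedDeriv_one] at this
      rw [le_div_iff₀ h2m, mul_comm]
      exact this.trans hA1
    have := Convex.norm_image_sub_le_of_norm_deriv_le (f := ψ m) (s := Set.univ)
      (fun x _ => hdiff x) (fun x _ => hb x) convex_univ (Set.mem_univ (k : ℝ))
      (Set.mem_univ ((k + 1 : ℤ) : ℝ))
    refine this.trans (le_of_eq ?_)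
    push_cast
    rw [add_sub_cancel_left, norm_one, mul_one]

/-- A finite set of frequencies containing the spectrum of the dyadic block `δ_j`. -/
def blockBox (j : Fin d → ℕ) : Finset (Fin d → ℤ) :=
  Fintype.piFinset fun i => Finset.Icc (-(2 * 2 ^ j i : ℤ)) (2 * 2 ^ j i)

theorem mem_dyadicSet_of_prod_ne_zero {ψ : ℕ → ℝ → ℂ} (hψ : IsSmoothResolution ψ) {j : Fin d → ℕ}
    {k : Fin d → ℤ} (h : ∏ i, ψ (j i) (k i : ℝ) ≠ 0) (i : Fin d) : k i ∈ dyadicSet (j i) :=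
  resolution_mem_dyadicSet hψ (Finset.prod_ne_zero_iff.1 h i (Finset.mem_univ i))

theorem mem_blockBox_of_prod_ne_zero {ψ : ℕ → ℝ → ℂ} (hψ : IsSmoothResolution ψ) {j : Fin d → ℕ}
    {k : Fin d → ℤ} (h : ∏ i, ψ (j i) (k i : ℝ) ≠ 0) : k ∈ blockBox j := by
  refine Fintype.mem_piFinset.2 fun i => ?_
  have h1 := (mem_dyadicSet_of_prod_ne_zero hψ h i).1
  have h2 : |k i| ≤ 2 * 2 ^ j i := by exact_mod_cast h1
  rw [Finset.mem_Icc]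
  exact abs_le.1 h2

/-- The series defining `δ_j(f)` is a finite sum. -/
theorem dyadicBlock_eq {ψ : ℕ → ℝ → ℂ} (hψ : IsSmoothResolution ψ) (j : Fin d → ℕ)
    (f : TorusD d → ℂ) : dyadicBlock ψ j f
      = mTrigSum (blockBox j) (fun k => (∏ i, ψ (j i) (k i : ℝ)) * mCoeff f k) := by
  funext x
  rw [dyadicBlock, mTrigSum]
  refine tsum_eq_sum fun k hk => ?_
  have : ∏ i, ψ (j i) (k i : ℝ) = 0 := by
    by_contra h
    exact hk (mem_blockBox_of_prod_ne_zero hψ h)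
  rw [this, zero_mul, zero_mul]

theorem dyadicBlock_mem {ψ : ℕ → ℝ → ℂ} (hψ : IsSmoothResolution ψ) (j : Fin d → ℕ)
    (f : TorusD d → ℂ) : dyadicBlock ψ j f ∈ mTrigSpan fun i => dyadicSet (j i) := by
  rw [dyadicBlock_eq hψ]
  exact mTrigSum_mem fun k _ hk i => mem_dyadicSet_of_prod_ne_zero hψ (left_ne_zero_of_mul hk) i

/-- The blocks of a trigonometric polynomial are obtained by applying a univariate multiplier in each
variable. -/
theorem eLpNorm_dyadicBlock_le {ψ : ℕ → ℝ → ℂ} (hψ : IsSmoothResolution ψ) {p : ℝ≥0∞} (hp : 1 ≤ p)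
    {M : ℝ≥0} (hM : ∀ m, MultBound p (fun k => ψ m k) M) (j : Fin d → ℕ) {S : Fin d → Set ℤ}
    {f : TorusD d → ℂ} (hf : f ∈ mTrigSpan S) :
    eLpNorm (dyadicBlock ψ j f) p volume ≤ (M ^ d : ℝ≥0) * eLpNorm f p volume := by
  obtain ⟨F, c, _, rfl⟩ := exists_mTrigSum_of_mem hf
  have h1 : dyadicBlock ψ j (mTrigSum F c)
      = mTrigSum F fun k => (∏ i, ψ (j i) (k i : ℝ)) * c k := by
    rw [dyadicBlock_eq hψ]
    funext x
    simp only [mTrigSum, mCoeff_mTrigSum]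
    rw [Finset.sum_congr rfl (g := fun k => if k ∈ F then
      (∏ i, ψ (j i) (k i : ℝ)) * c k * mChar k x else 0) fun k _ => by split_ifs <;> simp]
    rw [← Finset.sum_filter]
    refine Finset.sum_subset (fun k hk => (Finset.mem_filter.1 hk).2) fun k hk hk' => ?_
    have : ∏ i, ψ (j i) (k i : ℝ) = 0 := by
      by_contra h
      exact hk' (Finset.mem_filter.2 ⟨mem_blockBox_of_prod_ne_zero hψ h, hk⟩)
    rw [this, zero_mul, zero_mul]
  rw [h1]
  exact eLpNorm_mTrigSum_prod_le hp (fun i => hM (j i)) F c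

/-- The symbols of the dyadic blocks form a resolution of unity on `ℤ^d`. -/
theorem hasSum_prod_resolution {ψ : ℕ → ℝ → ℂ} (hψ : IsSmoothResolution ψ) (k : Fin d → ℤ) :
    HasSum (fun j : Fin d → ℕ => ∏ i, ψ (j i) (k i : ℝ)) 1 := by
  have h1 : ∀ n : ℤ, ∃ B : ℕ, ∀ m, B ≤ m → ψ m (n : ℝ) = 0 := fun n => by
    obtain ⟨B, hB⟩ := pow_unbounded_of_one_lt (2 * |(n : ℝ)|) (one_lt_two (α := ℝ))
    refine ⟨B + 1, fun m hm => ?_⟩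
    by_contra h
    have h2 := (resolution_mem_dyadicSet hψ h).2 (by omega)
    have h3 : (2 : ℝ) ^ B ≤ 2 ^ m := pow_le_pow_right₀ one_le_two (by omega)
    linarith
  choose B hB using h1
  have h2 : ∀ n : ℤ, ∑ m ∈ Finset.range (B n), ψ m (n : ℝ) = 1 := fun n =>
    (hasSum_sum_of_ne_finset_zero fun m hm => hB n m (by simpa using hm)).unique
      (hψ.sum_eq_one n)
  have h3 := hasSum_sum_of_ne_finset_zero (L := SummationFilter.unconditional _)
    (f := fun j : Fin d → ℕ => ∏ i, ψ (j i) (k i : ℝ))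
    (s := Fintype.piFinset fun i => Finset.range (B (k i))) (fun j hj => by
      rw [Fintype.mem_piFinset] at hj
      push Not at hj
      obtain ⟨i, hi⟩ := hj
      exact Finset.prod_eq_zero (Finset.mem_univ i) (hB (k i) _ (by simpa using hi)))
  have h4 := Finset.prod_univ_sum (fun i => Finset.range (B (k i)))
    (fun i (m : ℕ) => ψ m (k i : ℝ))
  rw [← h4] at h3
  simpa only [h2, Finset.prod_const_one] using h3

end

/-! ### Weighted sequence spaces and Schur's test -/

section
variable {ι : Type*}

/-- The norm of `ℓ_θ` of a family in `[0, ∞]`. -/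
def ellNorm (θ : ℝ≥0∞) (a : ι → ℝ≥0∞) : ℝ≥0∞ :=
  if θ = ∞ then ⨆ j, a j else (∑' j, a j ^ θ.toReal) ^ (1 / θ.toReal)

theorem ellNorm_mono {θ : ℝ≥0∞} {a b : ι → ℝ≥0∞} (h : ∀ j, a j ≤ b j) :
    ellNorm θ a ≤ ellNorm θ b := by
  unfold ellNorm
  split_ifs with ht
  · exact iSup_mono h
  · have h1 : ∑' j, a j ^ θ.toReal ≤ ∑' j, b j ^ θ.toReal :=
      ENNReal.tsum_le_tsum fun j => ENNReal.rpow_le_rpow (h j) ENNReal.toReal_nonneg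
    exact ENNReal.rpow_le_rpow h1 (by positivity)

theorem one_le_toReal {θ : ℝ≥0∞} (hθ : 1 ≤ θ) (ht : θ ≠ ∞) : 1 ≤ θ.toReal := by
  have := ENNReal.toReal_mono ht hθ
  simpa using this

theorem le_ellNorm {θ : ℝ≥0∞} (hθ : 1 ≤ θ) (a : ι → ℝ≥0∞) (j : ι) : a j ≤ ellNorm θ a := by
  unfold ellNorm
  split_ifs with ht
  · exact le_iSup a j
  · have h1 := one_le_toReal hθ ht
    have h0 : θ.toReal ≠ 0 := by positivity
    calc a j = (a j ^ θ.toReal) ^ (1 / θ.toReal) := by rw [one_div, ENNReal.rpow_rpow_inv h0]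
      _ ≤ _ := by
        refine ENNReal.rpow_le_rpow ?_ (by positivity)
        exact ENNReal.le_tsum (f := fun j => a j ^ θ.toReal) j

theorem ellNorm_const_mul {θ : ℝ≥0∞} (hθ : 1 ≤ θ) (c : ℝ≥0∞) (a : ι → ℝ≥0∞) :
    ellNorm θ (fun j => c * a j) = c * ellNorm θ a := by
  unfold ellNorm
  split_ifs with ht
  · rw [ENNReal.mul_iSup]
  · have h1 := one_le_toReal hθ ht
    have h0 : θ.toReal ≠ 0 := by positivity
    simp_rw [ENNReal.mul_rpow_of_nonneg _ _ (zero_le_one.trans h1)]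
    rw [ENNReal.tsum_mul_left, ENNReal.mul_rpow_of_nonneg _ _ (by positivity), one_div,
      ENNReal.rpow_rpow_inv h0]

/-- Schur's test: a nonnegative kernel with bounded row sums and column sums is bounded on `ℓ_θ`. -/
theorem ellNorm_kernel_le {θ : ℝ≥0∞} (hθ : 1 ≤ θ) {k : ι → ι → ℝ≥0∞} {A : ℝ≥0∞}
    (h1 : ∀ j, ∑' m, k j m ≤ A) (h2 : ∀ m, ∑' j, k j m ≤ A) (a : ι → ℝ≥0∞) :
    ellNorm θ (fun j => ∑' m, k j m * a m) ≤ A * ellNorm θ a := by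
  by_cases ht : θ = ∞
  · rw [ellNorm, if_pos ht]
    refine iSup_le fun j => ?_
    calc ∑' m, k j m * a m ≤ ∑' m, k j m * ellNorm θ a :=
          ENNReal.tsum_le_tsum fun m => mul_le_mul_right (le_ellNorm hθ a m) _
      _ = (∑' m, k j m) * ellNorm θ a := ENNReal.tsum_mul_right
      _ ≤ _ := by gcongr; exact h1 j
  have hone := one_le_toReal hθ ht
  simp only [ellNorm, if_neg ht]
  set t := θ.toReal
  have ht0 : 0 < t := by positivity
  have hinv : 0 ≤ 1 - t⁻¹ := by
    have := inv_le_one_of_one_le₀ hone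
    linarith
  have hrow : ∀ j, ∑' m, k j m * a m ≤ A ^ (1 - t⁻¹) * (∑' m, k j m * a m ^ t) ^ t⁻¹ := fun j => by
    rw [ENNReal.tsum_eq_iSup_sum]
    refine iSup_le fun s => (ENNReal.inner_le_weight_mul_Lp_of_nonneg s hone _ _).trans ?_
    gcongr
    · exact (ENNReal.sum_le_tsum s).trans (h1 j)
    · exact ENNReal.sum_le_tsum s
  have hrow' : ∀ j, (∑' m, k j m * a m) ^ t ≤ A ^ (t - 1) * ∑' m, k j m * a m ^ t := fun j => by
    refine (ENNReal.rpow_le_rpow (hrow j) ht0.le).trans (le_of_eq ?_)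
    rw [ENNReal.mul_rpow_of_nonneg _ _ ht0.le, ENNReal.rpow_inv_rpow ht0.ne', ← ENNReal.rpow_mul]
    congr 2
    field_simp
  have hsum : ∑' j, (∑' m, k j m * a m) ^ t ≤ A ^ t * ∑' m, a m ^ t := by
    calc ∑' j, (∑' m, k j m * a m) ^ t ≤ ∑' j, A ^ (t - 1) * ∑' m, k j m * a m ^ t :=
          ENNReal.tsum_le_tsum hrow'
      _ = A ^ (t - 1) * ∑' m, (∑' j, k j m) * a m ^ t := by
          rw [ENNReal.tsum_mul_left, ENNReal.tsum_comm]
          simp_rw [ENNReal.tsum_mul_right]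
      _ ≤ A ^ (t - 1) * ∑' m, A * a m ^ t := by
          gcongr with m
          exact h2 m
      _ = A ^ (t - 1) * A ^ (1 : ℝ) * ∑' m, a m ^ t := by
          rw [ENNReal.tsum_mul_left, ENNReal.rpow_one, mul_assoc]
      _ = _ := by
          rw [← ENNReal.rpow_add_of_nonneg _ _ (by linarith) zero_le_one, sub_add_cancel]
  refine (ENNReal.rpow_le_rpow hsum (by positivity)).trans (le_of_eq ?_)
  rw [ENNReal.mul_rpow_of_nonneg _ _ (by positivity), one_div, ENNReal.rpow_rpow_inv ht0.ne']

end

section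
variable {d : ℕ}

theorem tsum_prod_le {α : Fin d → ℕ → ℝ≥0∞} {A : ℝ≥0∞} (h : ∀ i, ∑' n, α i n ≤ A) :
    ∑' m : Fin d → ℕ, ∏ i, α i (m i) ≤ A ^ d := by
  rw [ENNReal.tsum_eq_iSup_sum]
  refine iSup_le fun s => ?_
  have hsub : s ⊆ Fintype.piFinset fun i => s.image fun m => m i := fun m hm =>
    Fintype.mem_piFinset.2 fun i => Finset.mem_image_of_mem (fun m => m i) hm
  calc ∑ m ∈ s, ∏ i, α i (m i)
      ≤ ∑ m ∈ Fintype.piFinset fun i => s.image fun m => m i, ∏ i, α i (m i) :=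
        Finset.sum_le_sum_of_subset hsub
    _ = ∏ i, ∑ n ∈ s.image fun m => m i, α i n := (Finset.prod_univ_sum _ _).symm
    _ ≤ ∏ _i : Fin d, A := Finset.prod_le_prod' fun i _ => (ENNReal.sum_le_tsum _).trans (h i)
    _ = A ^ d := by simp

/-- The exponential kernel `∏_i 2^{-τ|j_i - m_i|}`. -/
def expKernel (τ : ℝ) (j m : Fin d → ℕ) : ℝ≥0∞ :=
  ∏ i, ENNReal.ofReal ((2 : ℝ) ^ (-(τ * |(j i : ℝ) - m i|)))

theorem expKernel_comm (τ : ℝ) (j m : Fin d → ℕ) : expKernel τ j m = expKernel τ m j := by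
  simp only [expKernel, abs_sub_comm]

theorem exists_tsum_expKernel_le (d : ℕ) {τ : ℝ} (hτ : 0 < τ) :
    ∃ A : ℝ≥0, ∀ j : Fin d → ℕ, ∑' m, expKernel τ j m ≤ A := by
  let g : ℤ → ℝ≥0∞ := fun n => ENNReal.ofReal ((2 : ℝ) ^ (-(τ * |(n : ℝ)|)))
  have hρ : ENNReal.ofReal ((2 : ℝ) ^ (-τ)) < 1 := by
    rw [ENNReal.ofReal_lt_one]
    exact Real.rpow_lt_one_of_one_lt_of_neg one_lt_two (by linarith)
  have hgeo : ∑' n : ℕ, ENNReal.ofReal ((2 : ℝ) ^ (-(τ * n))) < ∞ := by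
    have : ∀ n : ℕ, ENNReal.ofReal ((2 : ℝ) ^ (-(τ * n)))
        = ENNReal.ofReal ((2 : ℝ) ^ (-τ)) ^ n := fun n => by
      rw [← ENNReal.ofReal_pow (by positivity), ← Real.rpow_natCast, ← Real.rpow_mul (by positivity)]
      ring_nf
    simp_rw [this]
    rw [ENNReal.tsum_geometric, ENNReal.inv_lt_top]
    exact tsub_pos_of_lt hρ
  have hg : ∑' n, g n < ∞ := by
    have h1 := HasSum.of_nat_of_neg_add_one (f := g)
      (ENNReal.summable (f := fun n : ℕ => g n)).hasSum
      (ENNReal.summable (f := fun n : ℕ => g (-(n + 1 : ℤ)))).hasSum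
    rw [h1.tsum_eq]
    refine ENNReal.add_lt_top.2 ⟨by simpa [g] using hgeo, lt_of_le_of_lt ?_ hgeo⟩
    refine ENNReal.tsum_le_tsum fun n => ENNReal.ofReal_le_ofReal ?_
    refine Real.rpow_le_rpow_of_exponent_le one_le_two (neg_le_neg ?_)
    refine mul_le_mul_of_nonneg_left ?_ hτ.le
    push_cast
    rw [abs_neg, abs_of_nonneg (by positivity)]
    linarith
  refine ⟨(∑' n, g n).toNNReal ^ d, fun j => ?_⟩
  rw [ENNReal.coe_pow, ENNReal.coe_toNNReal hg.ne]
  unfold expKernel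
  refine tsum_prod_le (α := fun i n => ENNReal.ofReal ((2 : ℝ) ^ (-(τ * |(j i : ℝ) - n|))))
    fun i => ?_
  have hinj : Function.Injective fun n : ℕ => (j i : ℤ) - n := fun a b h => by
    simpa using h
  refine le_trans (le_of_eq ?_) (ENNReal.tsum_comp_le_tsum_of_injective hinj g)
  simp [g]

/-- The weight `2^{r|j|_1}`. -/
def weight (r : ℝ) (j : Fin d → ℕ) : ℝ≥0∞ := ∏ i, ENNReal.ofReal ((2 : ℝ) ^ (r * (j i : ℝ)))

theorem weight_ne_zero (r : ℝ) (j : Fin d → ℕ) : weight r j ≠ 0 :=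
  Finset.prod_ne_zero_iff.2 fun i _ => by
    rw [Ne, ENNReal.ofReal_eq_zero, not_le]
    positivity

theorem weight_ne_top (r : ℝ) (j : Fin d → ℕ) : weight r j ≠ ∞ :=
  ENNReal.prod_ne_top fun _ _ => ENNReal.ofReal_ne_top

theorem inv_weight (r : ℝ) (j : Fin d → ℕ) : (weight r j)⁻¹ = expKernel r 0 j := by
  rw [← one_mul (weight r j)⁻¹]
  refine (ENNReal.eq_div_iff (weight_ne_zero r j) (weight_ne_top r j)).2 ?_ |>.symm
  rw [weight, expKernel, ← Finset.prod_mul_distrib]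
  refine Finset.prod_eq_one fun i _ => ?_
  rw [← ENNReal.ofReal_mul (by positivity), ← Real.rpow_add two_pos]
  simp

theorem ellLpNorm_weighted (θ p : ℝ≥0∞) (r : ℝ) (g : (Fin d → ℕ) → TorusD d → ℂ) :
    ellLpNorm θ p (weighted r g) = ellNorm θ fun j => weight r j * eLpNorm (g j) p volume := by
  have h : ∀ j, eLpNorm (weighted r g j) p volume = weight r j * eLpNorm (g j) p volume :=
    fun j => by
      have e : weighted r g j
          = (((2 : ℝ) ^ (r * ∑ i, (j i : ℝ)) : ℝ) : ℂ) • g j := rfl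
      rw [e, eLpNorm_const_smul, weight, ← ENNReal.ofReal_prod_of_nonneg fun _ _ => by positivity,
        ← Real.rpow_sum_of_pos two_pos, ← Finset.mul_sum, ← ofReal_norm,
        Complex.norm_real, Real.norm_of_nonneg (by positivity)]
  unfold ellLpNorm ellNorm
  simp only [h]

/-- Schur's test for the exponential kernel, with a constant that does not depend on the families. -/
theorem ellNorm_le_of_le_expKernel (d : ℕ) {θ : ℝ≥0∞} (hθ : 1 ≤ θ) {τ : ℝ} (hτ : 0 < τ) :
    ∃ A : ℝ≥0, ∀ (K : ℝ≥0∞) (a b : (Fin d → ℕ) → ℝ≥0∞),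
      (∀ j, b j ≤ ∑' m, K * expKernel τ j m * a m) → ellNorm θ b ≤ K * A * ellNorm θ a := by
  obtain ⟨A, hA⟩ := exists_tsum_expKernel_le d hτ
  refine ⟨A, fun K a b h => ?_⟩
  refine (ellNorm_mono h).trans ?_
  simp_rw [mul_assoc, ENNReal.tsum_mul_left]
  rw [ellNorm_const_mul hθ]
  gcongr
  refine ellNorm_kernel_le hθ hA (fun m => ?_) a
  simp_rw [expKernel_comm τ _ m]
  exact hA m

/-- The decay of the differences in `j - m` beats the weight `2^{r(j - m)}` on both sides of the
diagonal. -/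
theorem weight_mul_prod_decay_le {r s : ℝ} (j m : Fin d → ℕ) :
    weight r j * ∏ i, ENNReal.ofReal (decay s (j i) (m i))
      ≤ expKernel (min r (s - r)) j m * weight r m := by
  rw [weight, weight, expKernel, ← Finset.prod_mul_distrib, ← Finset.prod_mul_distrib]
  refine Finset.prod_le_prod' fun i _ => ?_
  rw [← ENNReal.ofReal_mul (by positivity), ← ENNReal.ofReal_mul (by positivity)]
  refine ENNReal.ofReal_le_ofReal ?_
  rw [decay, ← Real.rpow_add two_pos, ← Real.rpow_add two_pos]
  refine Real.rpow_le_rpow_of_exponent_le one_le_two ?_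
  rcases le_total (j i) (m i) with h | h
  · have h' : (j i : ℝ) ≤ m i := by exact_mod_cast h
    rw [Nat.sub_eq_zero_of_le h, abs_of_nonpos (by linarith)]
    have := mul_le_mul_of_nonneg_right (min_le_left r (s - r)) (sub_nonneg.2 h')
    push_cast
    linarith
  · have h' : (m i : ℝ) ≤ j i := by exact_mod_cast h
    rw [Nat.cast_sub h, abs_of_nonneg (by linarith)]
    have := mul_le_mul_of_nonneg_right (min_le_right r (s - r)) (sub_nonneg.2 h')
    linarith

/-- For `j_i ≤ m_i + 1` the weight `2^{r(j_i - m_i)}` decays in `|j_i - m_i|`; the factor `2^{2r}` accounts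
for the case `j_i = m_i + 1`. -/
theorem weight_le_expKernel {r : ℝ} (hr : 0 ≤ r) {j m : Fin d → ℕ} (h : ∀ i, j i ≤ m i + 1) :
    weight r j ≤ ENNReal.ofReal ((2 : ℝ) ^ (2 * r)) ^ d * expKernel r j m * weight r m := by
  have e : ENNReal.ofReal ((2 : ℝ) ^ (2 * r)) ^ d
      = ∏ _i : Fin d, ENNReal.ofReal ((2 : ℝ) ^ (2 * r)) := by simp
  rw [e, weight, weight, expKernel, ← Finset.prod_mul_distrib, ← Finset.prod_mul_distrib]
  refine Finset.prod_le_prod' fun i _ => ?_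
  rw [← ENNReal.ofReal_mul (by positivity), ← ENNReal.ofReal_mul (by positivity)]
  refine ENNReal.ofReal_le_ofReal ?_
  rw [← Real.rpow_add two_pos, ← Real.rpow_add two_pos]
  refine Real.rpow_le_rpow_of_exponent_le one_le_two ?_
  have h' : (j i : ℝ) ≤ m i + 1 := by exact_mod_cast h i
  have h2 : |(j i : ℝ) - m i| ≤ 2 + (m i : ℝ) - j i := abs_le.2 ⟨by linarith, by linarith⟩
  nlinarith [mul_le_mul_of_nonneg_left h2 hr]

end

/-! ### The operators on `L_p(𝕋^d)` -/

section
variable {d : ℕ} {p : ℝ≥0∞} [Fact (1 ≤ p)]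

theorem integrable_coe_Lp (x : Lp ℂ p (volume : Measure (TorusD d))) : Integrable x volume :=
  (Lp.memLp x).integrable Fact.out

theorem exists_mCoeff_clm (p : ℝ≥0∞) [Fact (1 ≤ p)] (k : Fin d → ℤ) :
    ∃ L : Lp ℂ p (volume : Measure (TorusD d)) →L[ℂ] ℂ, ∀ x, L x = mCoeff x k := by
  set V : ℝ≥0∞ := (volume : Measure (TorusD d)) Set.univ ^ (1 / (1 : ℝ≥0∞).toReal - 1 / p.toReal)
  have hV : V ≠ ∞ := by
    refine ENNReal.rpow_ne_top_of_nonneg ?_ (measure_ne_top _ _)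
    by_cases hp : p = ∞
    · simp [hp]
    · have h1 := one_le_toReal (Fact.out : 1 ≤ p) hp
      simp only [ENNReal.toReal_one, div_one, one_div, sub_nonneg]
      exact inv_le_one_of_one_le₀ h1
  have hb : ∀ x : Lp ℂ p (volume : Measure (TorusD d)), ∫ t, ‖x t‖ ≤ V.toReal * ‖x‖ := fun x => by
    rw [integral_norm_eq_lintegral_enorm (Lp.aestronglyMeasurable x), ← eLpNorm_one_eq_lintegral_enorm,
      Lp.norm_def, ← ENNReal.toReal_mul]
    refine ENNReal.toReal_mono (ENNReal.mul_ne_top hV (Lp.eLpNorm_ne_top x)) ?_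
    rw [mul_comm V]
    exact eLpNorm_le_eLpNorm_mul_rpow_measure_univ Fact.out (Lp.aestronglyMeasurable x)
  refine ⟨LinearMap.mkContinuous
    { toFun := fun x => mCoeff x k
      map_add' := fun x y => by
        rw [mCoeff_congr_ae (Lp.coeFn_add x y), mCoeff_add (integrable_coe_Lp x)
          (integrable_coe_Lp y)]
      map_smul' := fun a x => by
        rw [mCoeff_congr_ae (Lp.coeFn_smul a x), mCoeff_smul, RingHom.id_apply, smul_eq_mul] }
    (((2 * Real.pi) ^ d)⁻¹ * V.toReal) fun x => ?_, fun x => rfl⟩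
  refine (norm_mCoeff_le x k).trans ?_
  rw [mul_assoc]
  gcongr
  exact hb x

/-- The block operator `δ_j` acts continuously on `L_p(𝕋^d)`. -/
theorem exists_dyadicBlock_clm {ψ : ℕ → ℝ → ℂ} (hψ : IsSmoothResolution ψ) (p : ℝ≥0∞)
    [Fact (1 ≤ p)] (j : Fin d → ℕ) :
    ∃ D : Lp ℂ p (volume : Measure (TorusD d)) →L[ℂ] Lp ℂ p (volume : Measure (TorusD d)),
      ∀ x, D x =ᵐ[volume] dyadicBlock ψ j x := by
  choose L hL using fun k : Fin d → ℤ => exists_mCoeff_clm p k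
  let e : (Fin d → ℤ) → Lp ℂ p (volume : Measure (TorusD d)) := fun k =>
    (continuous_memLp (continuous_mChar k) p).toLp (mChar k)
  refine ⟨∑ k ∈ blockBox j, (∏ i, ψ (j i) (k i : ℝ)) • (L k).smulRight (e k), fun x => ?_⟩
  have key : ∀ G : Finset (Fin d → ℤ),
      ((∑ k ∈ G, (∏ i, ψ (j i) (k i : ℝ)) • (L k).smulRight (e k)) x :
        Lp ℂ p (volume : Measure (TorusD d)))
      =ᵐ[volume] mTrigSum G fun k => (∏ i, ψ (j i) (k i : ℝ)) * mCoeff x k := fun G => by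
    induction G using Finset.induction_on with
    | empty =>
      rw [Finset.sum_empty, zero_apply]
      filter_upwards [Lp.coeFn_zero ℂ p (volume : Measure (TorusD d))] with t ht
      rw [ht]
      simp [mTrigSum]
    | insert k G hk ih =>
      rw [Finset.sum_insert hk, add_apply, smul_apply,
        ContinuousLinearMap.smulRight_apply, smul_smul, hL]
      filter_upwards [Lp.coeFn_add (((∏ i, ψ (j i) (k i : ℝ)) * mCoeff x k) • e k)
        ((∑ k ∈ G, (∏ i, ψ (j i) (k i : ℝ)) • (L k).smulRight (e k)) x), ih,
        Lp.coeFn_smul ((∏ i, ψ (j i) (k i : ℝ)) * mCoeff x k) (e k),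
        (continuous_memLp (continuous_mChar k) p).coeFn_toLp] with t h1 h2 h3 h4
      rw [h1, Pi.add_apply, h2, h3, Pi.smul_apply, h4]
      simp [mTrigSum, Finset.sum_insert hk]
  rw [dyadicBlock_eq hψ]
  exact key _

theorem dyadicBlock_congr_ae {ψ : ℕ → ℝ → ℂ} (hψ : IsSmoothResolution ψ) (j : Fin d → ℕ)
    {f g : TorusD d → ℂ} (h : f =ᵐ[volume] g) : dyadicBlock ψ j f = dyadicBlock ψ j g := by
  simp only [dyadicBlock_eq hψ, mCoeff_congr_ae h]

theorem mCoeff_dyadicBlock {ψ : ℕ → ℝ → ℂ} (hψ : IsSmoothResolution ψ) (j : Fin d → ℕ)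
    (f : TorusD d → ℂ) (k : Fin d → ℤ) :
    mCoeff (dyadicBlock ψ j f) k = (∏ i, ψ (j i) (k i : ℝ)) * mCoeff f k := by
  rw [dyadicBlock_eq hψ, mCoeff_mTrigSum]
  split_ifs with h
  · rfl
  · have : ∏ i, ψ (j i) (k i : ℝ) = 0 := by
      by_contra h'
      exact h (mem_blockBox_of_prod_ne_zero hψ h')
    rw [this, zero_mul]

/-- The block `δ_j(f)` as an element of `L_p(𝕋^d)`. -/
def blockLp {ψ : ℕ → ℝ → ℂ} (hψ : IsSmoothResolution ψ) (p : ℝ≥0∞) (f : TorusD d → ℂ)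
    (j : Fin d → ℕ) : Lp ℂ p (volume : Measure (TorusD d)) :=
  (memLp_of_mem_mTrigSpan (dyadicBlock_mem hψ j f) p).toLp _

theorem coeFn_blockLp {p : ℝ≥0∞} {ψ : ℕ → ℝ → ℂ} (hψ : IsSmoothResolution ψ) (f : TorusD d → ℂ)
    (j : Fin d → ℕ) : blockLp hψ p f j =ᵐ[volume] dyadicBlock ψ j f :=
  MemLp.coeFn_toLp _

theorem enorm_blockLp {p : ℝ≥0∞} {ψ : ℕ → ℝ → ℂ} (hψ : IsSmoothResolution ψ) (f : TorusD d → ℂ)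
    (j : Fin d → ℕ) : ‖blockLp hψ p f j‖ₑ = eLpNorm (dyadicBlock ψ j f) p volume :=
  Lp.enorm_toLp _

theorem summable_of_tsum_enorm_lt_top {ι X : Type*} [NormedAddCommGroup X] [CompleteSpace X]
    {v : ι → X} (h : ∑' j, ‖v j‖ₑ < ∞) : Summable v := by
  refine Summable.of_norm ?_
  have h1 : Summable fun j => (‖v j‖ₑ).toReal := ENNReal.summable_toReal h.ne
  simpa using h1

/-- An integrable function with absolutely summable blocks lies in `L_p` and is the sum of its
blocks: both have the same Fourier coefficients. -/
theorem hasSum_blockLp {ψ : ℕ → ℝ → ℂ} (hψ : IsSmoothResolution ψ) {f : TorusD d → ℂ}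
    (hf : Integrable f volume) (h : ∑' j, ‖blockLp hψ p f j‖ₑ < ∞) :
    ∃ hf' : MemLp f p volume, HasSum (blockLp hψ p f) (hf'.toLp f) := by
  obtain ⟨g, hg⟩ := summable_of_tsum_enorm_lt_top h
  have hcoeff : ∀ k, mCoeff g k = mCoeff f k := fun k => by
    obtain ⟨L, hL⟩ := exists_mCoeff_clm p k
    have h1 := hg.mapL L
    have h2 := (hasSum_prod_resolution hψ k).mul_right (mCoeff f k)
    simp only [hL, mCoeff_congr_ae (coeFn_blockLp hψ f _), mCoeff_dyadicBlock hψ] at h1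
    rw [one_mul] at h2
    exact h1.unique h2
  have hsub : Integrable (f + (-1 : ℂ) • (g : TorusD d → ℂ)) volume :=
    hf.add ((integrable_coe_Lp g).smul _)
  have h0 := ae_eq_zero_of_mCoeff_eq_zero hsub fun k => by
    rw [mCoeff_add hf ((integrable_coe_Lp g).smul _), mCoeff_smul, hcoeff]
    ring
  have hfg : f =ᵐ[volume] g := by
    filter_upwards [h0] with t ht
    simp only [Pi.add_apply, Pi.smul_apply, smul_eq_mul, neg_mul, one_mul, Pi.zero_apply] at ht
    exact add_neg_eq_zero.1 ht
  have hf' : MemLp f p volume := (memLp_congr_ae hfg).2 (Lp.memLp g)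
  refine ⟨hf', ?_⟩
  have : hf'.toLp f = g := by
    rw [← Lp.toLp_coeFn g (Lp.memLp g)]
    exact MemLp.toLp_congr _ _ hfg
  rwa [this]

/-- The classes of trigonometric polynomials with spectrum in `∏_i S_i`. -/
def trigLp (p : ℝ≥0∞) (S : Fin d → Set ℤ) :
    AddSubgroup (Lp ℂ p (volume : Measure (TorusD d))) where
  carrier := {x | ∃ g ∈ mTrigSpan S, x =ᵐ[volume] g}
  zero_mem' := ⟨0, Submodule.zero_mem _, Lp.coeFn_zero _ _ _⟩
  add_mem' := by
    rintro x y ⟨g, hg, hx⟩ ⟨g', hg', hy⟩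
    exact ⟨g + g', Submodule.add_mem _ hg hg', (Lp.coeFn_add x y).trans (hx.add hy)⟩
  neg_mem' := by
    rintro x ⟨g, hg, hx⟩
    exact ⟨-g, Submodule.neg_mem _ hg, (Lp.coeFn_neg x).trans hx.neg⟩

/-- The blocks of a limit of trigonometric polynomials are bounded with a constant independent of the
block. -/
theorem enorm_blockClm_le {ψ : ℕ → ℝ → ℂ} (hψ : IsSmoothResolution ψ) {M : ℝ≥0}
    (hM : ∀ m, MultBound p (fun k => ψ m k) M) {j : Fin d → ℕ}
    {D : Lp ℂ p (volume : Measure (TorusD d)) →L[ℂ] Lp ℂ p (volume : Measure (TorusD d))}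
    (hD : ∀ x, D x =ᵐ[volume] dyadicBlock ψ j x) {S : Fin d → Set ℤ}
    {x : Lp ℂ p (volume : Measure (TorusD d))} (hx : x ∈ (trigLp p S).topologicalClosure) :
    ‖D x‖ₑ ≤ (M ^ d : ℝ≥0) * ‖x‖ₑ := by
  have hcl : IsClosed {x : Lp ℂ p (volume : Measure (TorusD d)) | ‖D x‖ ≤ (M : ℝ) ^ d * ‖x‖} :=
    isClosed_le (by fun_prop) (by fun_prop)
  have h1 : x ∈ {x : Lp ℂ p (volume : Measure (TorusD d)) | ‖D x‖ ≤ (M : ℝ) ^ d * ‖x‖} := by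
    refine closure_minimal ?_ hcl hx
    rintro y ⟨g, hg, hy⟩
    have h2 := eLpNorm_dyadicBlock_le hψ Fact.out hM j hg
    rw [← dyadicBlock_congr_ae hψ j hy, ← eLpNorm_congr_ae hy, ← eLpNorm_congr_ae (hD y)] at h2
    have h3 := ENNReal.toReal_mono (ENNReal.mul_ne_top ENNReal.coe_ne_top (Lp.eLpNorm_ne_top y)) h2
    rw [ENNReal.toReal_mul] at h3
    simpa [Lp.norm_def] using h3
  rw [← ofReal_norm, ← ofReal_norm]
  refine (ENNReal.ofReal_le_ofReal h1).trans (le_of_eq ?_)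
  rw [ENNReal.ofReal_mul (by positivity), ENNReal.ofReal_pow (by positivity), ENNReal.ofReal_coe_nnreal,
    ENNReal.coe_pow]

/-- A block vanishes on limits of trigonometric polynomials whose spectrum avoids it in one variable. -/
theorem blockClm_eq_zero {ψ : ℕ → ℝ → ℂ} (hψ : IsSmoothResolution ψ) {j : Fin d → ℕ}
    {D : Lp ℂ p (volume : Measure (TorusD d)) →L[ℂ] Lp ℂ p (volume : Measure (TorusD d))}
    (hD : ∀ x, D x =ᵐ[volume] dyadicBlock ψ j x) {S : Fin d → Set ℤ} {i : Fin d}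
    (hS : Disjoint (S i) (dyadicSet (j i)))
    {x : Lp ℂ p (volume : Measure (TorusD d))} (hx : x ∈ (trigLp p S).topologicalClosure) :
    D x = 0 := by
  have hcl : IsClosed {x : Lp ℂ p (volume : Measure (TorusD d)) | D x = 0} :=
    isClosed_eq D.continuous continuous_const
  refine closure_minimal ?_ hcl hx
  rintro y ⟨g, hg, hy⟩
  obtain ⟨F, c, hF, rfl⟩ := exists_mTrigSum_of_mem hg
  have h0 : dyadicBlock ψ j (mTrigSum F c) = 0 := by
    rw [dyadicBlock_eq hψ]
    funext t
    refine Finset.sum_eq_zero fun k _ => ?_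
    simp only [mCoeff_mTrigSum]
    split_ifs with hk
    · have : ∏ i, ψ (j i) (k i : ℝ) = 0 := by
        by_contra h'
        exact Set.disjoint_left.1 hS (hF k hk i) (mem_dyadicSet_of_prod_ne_zero hψ h' i)
      rw [this, zero_mul, zero_mul]
    · rw [mul_zero, zero_mul]
  refine Lp.ext ((hD y).trans ?_)
  rw [dyadicBlock_congr_ae hψ j hy, h0]
  exact (Lp.coeFn_zero _ _ _).symm

theorem composeVars_smul {p : ℝ≥0∞} {C : ℝ≥0} {U : Fin d → (Torus → ℂ) → Torus → ℂ}
    (hU : ∀ i, BoundedUnivariate p C (U i)) (l : List (Fin d)) (a : ℂ) (f : TorusD d → ℂ) :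
    composeVars U l (a • f) = a • composeVars U l f := by
  induction l with
  | nil => rfl
  | cons i l ih =>
    change inVariable i (U i) (composeVars U l (a • f)) = a • inVariable i (U i) (composeVars U l f)
    rw [ih]
    funext x
    exact congrFun ((hU i).smul a fun t => composeVars U l f (Function.update x i t)) (x i)

/-- A composition of bounded univariate operators, as a continuous linear map of `L_p(𝕋^d)`. -/
theorem exists_composeVars_clm {C : ℝ≥0} {U : Fin d → (Torus → ℂ) → Torus → ℂ}
    (hU : ∀ i, BoundedUnivariate p C (U i)) (l : List (Fin d)) :
    ∃ E : Lp ℂ p (volume : Measure (TorusD d)) →L[ℂ] Lp ℂ p (volume : Measure (TorusD d)),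
      ∀ x, E x =ᵐ[volume] composeVars U l x := by
  have hm := fun x : Lp ℂ p (volume : Measure (TorusD d)) =>
    memLp_composeVars hU Fact.out l (Lp.memLp x)
  refine ⟨LinearMap.mkContinuous
    { toFun := fun x => (hm x).1.toLp _
      map_add' := fun x y => by
        rw [← MemLp.toLp_add]
        refine MemLp.toLp_congr _ _ ?_
        exact (composeVars_congr hU l (Lp.coeFn_add x y)).trans
          (composeVars_add hU Fact.out l (Lp.memLp x) (Lp.memLp y))
      map_smul' := fun a x => by
        rw [RingHom.id_apply, ← MemLp.toLp_const_smul]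
        refine MemLp.toLp_congr _ _ ((composeVars_congr hU l (Lp.coeFn_smul a x)).trans ?_)
        rw [composeVars_smul hU] } ((C : ℝ) ^ l.length) fun x => ?_,
    fun x => (hm x).1.coeFn_toLp⟩
  change ‖(hm x).1.toLp _‖ ≤ _
  rw [Lp.norm_toLp, Lp.norm_def]
  have h := ENNReal.toReal_mono
    (ENNReal.mul_ne_top ENNReal.coe_ne_top (Lp.eLpNorm_ne_top x)) (hm x).2
  rwa [ENNReal.toReal_mul, ENNReal.coe_toReal, NNReal.coe_pow] at h

end

/-! ### Mixed differences of dyadic blocks -/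

section
variable {d : ℕ} {p : ℝ≥0∞} {φ φt : ℕ → Torus → ℂ}

theorem sum_quasiInterpDiff (n : ℕ) (h : Torus → ℂ) (x : Torus) :
    ∑ j ∈ Finset.range (n + 1), quasiInterpDiff φ φt j h x = quasiInterp φ φt n h x := by
  induction n with
  | zero => simp [quasiInterpDiff]
  | succ n ih =>
    rw [Finset.sum_range_succ, ih, quasiInterpDiff]
    ring

theorem mixedDiff_mChar {C : ℝ≥0} (hU : ∀ j, BoundedUnivariate p C (quasiInterpDiff φ φt j))
    (j : Fin d → ℕ) (k : Fin d → ℤ) :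
    mixedDiff φ φt j (mChar k)
      = tensor fun i => quasiInterpDiff φ φt (j i) fun t => fourier (k i) t := by
  have h := composeVars_mChar (U := fun i => quasiInterpDiff φ φt (j i)) (fun i => hU (j i)) k
    (List.finRange d) (List.nodup_finRange d)
  simp only [List.mem_finRange, if_true] at h
  exact h

/-- The mixed differences over the box `j_i ≤ n` telescope to the tensor product of `Q_n`. -/
theorem sum_mixedDiff_mChar {C : ℝ≥0} (hU : ∀ j, BoundedUnivariate p C (quasiInterpDiff φ φt j))
    (n : ℕ) (k : Fin d → ℤ) (x : TorusD d) :
    ∑ j ∈ Fintype.piFinset fun _ : Fin d => Finset.range (n + 1), mixedDiff φ φt j (mChar k) x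
      = ∏ i, quasiInterp φ φt n (fun t => fourier (k i) t) (x i) := by
  simp only [mixedDiff_mChar hU, tensor, ← sum_quasiInterpDiff n]
  exact (Finset.prod_univ_sum (fun _ => Finset.range (n + 1)) fun i m =>
    quasiInterpDiff φ φt m (fun t => fourier (k i) t) (x i)).symm

theorem mixedDiff_mTrigSpan (hp : 1 ≤ p) (hφ : ∀ j, φ j ∈ trigPoly j) {C C' : ℝ≥0}
    (hU : ∀ j, BoundedUnivariate p C (quasiInterpDiff φ φt j)) {s : ℝ}
    (hΔ : ∀ (m j : ℕ) (F : Finset ℤ) (c : ℤ → ℂ), (F : Set ℤ) ⊆ dyadicSet m →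
      eLpNorm (quasiInterpDiff φ φt j (trigSum F c)) p volume
        ≤ C' * ENNReal.ofReal (decay s j m) * eLpNorm (trigSum F c) p volume)
    (j m : Fin d → ℕ) {g : TorusD d → ℂ} (hg : g ∈ mTrigSpan fun i => dyadicSet (m i)) :
    mixedDiff φ φt j g ∈ mTrigSpan (fun i => Set.Ico (-(2 : ℤ) ^ j i) (2 ^ j i)) ∧
      eLpNorm (mixedDiff φ φt j g) p volume
        ≤ C' ^ d * (∏ i, ENNReal.ofReal (decay s (j i) (m i))) * eLpNorm g p volume := by
  obtain ⟨h1, h2⟩ := composeVars_mTrigSpan hp (U := fun i => quasiInterpDiff φ φt (j i))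
    (fun i => hU (j i)) (S' := fun i => Set.Ico (-(2 : ℤ) ^ j i) (2 ^ j i))
    (fun i k => quasiInterpDiff_mem_trigPoly hφ (j i) _)
    (A := fun i => C' * Real.toNNReal (decay s (j i) (m i)))
    (fun i F c hF => by
      rw [ENNReal.coe_mul]
      exact hΔ (m i) (j i) F c hF) (List.finRange d) (List.nodup_finRange d) hg
  simp only [List.mem_finRange, if_true] at h1
  refine ⟨h1, h2.trans (le_of_eq ?_)⟩
  rw [← List.ofFn_eq_map, List.prod_ofFn, Finset.prod_mul_distrib]
  simp [ENNReal.ofReal]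

end

section
variable {d : ℕ} {p : ℝ≥0∞} [Fact (1 ≤ p)] {φ φt : ℕ → Torus → ℂ}
  {E : (Fin d → ℕ) → Lp ℂ p (volume : Measure (TorusD d)) →L[ℂ] Lp ℂ p (volume : Measure (TorusD d))}

theorem coeFn_sum_Lp {p : ℝ≥0∞} {ι : Type*} (G : Finset ι) (v : ι → Lp ℂ p (volume : Measure (TorusD d)))
    (g : ι → TorusD d → ℂ) (h : ∀ i, v i =ᵐ[volume] g i) :
    ((∑ i ∈ G, v i : Lp ℂ p (volume : Measure (TorusD d))) : TorusD d → ℂ)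
      =ᵐ[volume] fun x => ∑ i ∈ G, g i x := by
  classical
  induction G using Finset.induction_on with
  | empty =>
    simp only [Finset.sum_empty]
    exact Lp.coeFn_zero _ _ _
  | insert i G hi ih =>
    rw [Finset.sum_insert hi]
    filter_upwards [Lp.coeFn_add (v i) (∑ i ∈ G, v i), h i, ih] with x h1 h2 h3
    rw [h1, Pi.add_apply, h2, h3, Finset.sum_insert hi]

/-- On trigonometric polynomials the expansion into mixed differences converges along boxes. -/
theorem tendsto_sum_mixedDiff_trigLp {C : ℝ≥0}
    (hU : ∀ j, BoundedUnivariate p C (quasiInterpDiff φ φt j))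
    (hlim : ∀ k : ℤ, ∃ lam : ℕ → ℂ, Filter.Tendsto lam Filter.atTop (nhds 1) ∧ ∃ j₀, ∀ j, j₀ ≤ j →
      quasiInterp φ φt j (fun x => fourier k x) = fun x => lam j * fourier k x)
    (hE : ∀ j x, E j x =ᵐ[volume] mixedDiff φ φt j x) {S : Fin d → Set ℤ}
    {x : Lp ℂ p (volume : Measure (TorusD d))} (hx : x ∈ trigLp p S) :
    Filter.Tendsto (fun n : ℕ =>
      ∑ j ∈ Fintype.piFinset fun _ : Fin d => Finset.range (n + 1), E j x) Filter.atTop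
      (nhds x) := by
  obtain ⟨g, hg, hxg⟩ := hx
  induction hg using Submodule.span_induction generalizing x with
  | mem g hg =>
    obtain ⟨k, -, rfl⟩ := hg
    choose lam hlam j₀ hj₀ using hlim
    have h1 : ∀ n ≥ ∑ i, j₀ (k i), ∑ j ∈ Fintype.piFinset fun _ : Fin d => Finset.range (n + 1), E j x
        = (∏ i, lam (k i) n) • x := fun n hn => by
      refine Lp.ext ((coeFn_sum_Lp _ _ (fun j => mixedDiff φ φt j (mChar k)) fun j =>
        (hE j x).trans ?_).trans ?_)
      · exact composeVars_congr (U := fun i => quasiInterpDiff φ φt (j i)) (fun i => hU (j i))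
          (List.finRange d) hxg
      · filter_upwards [Lp.coeFn_smul (∏ i, lam (k i) n) x, hxg] with t h2 h3
        rw [h2, Pi.smul_apply, h3, sum_mixedDiff_mChar hU, smul_eq_mul, mChar,
          ← Finset.prod_mul_distrib]
        refine Finset.prod_congr rfl fun i _ => ?_
        have hi : j₀ (k i) ≤ n := (Finset.single_le_sum (f := fun i => j₀ (k i))
          (fun _ _ => Nat.zero_le _) (Finset.mem_univ i)).trans hn
        rw [hj₀ (k i) n hi]
    have h2 : Filter.Tendsto (fun n => (∏ i, lam (k i) n) • x) Filter.atTop (nhds x) := by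
      have h3 := tendsto_finsetProd Finset.univ fun i _ => hlam (k i)
      have h4 := h3.smul_const x
      simpa using h4
    refine h2.congr' ?_
    filter_upwards [Filter.eventually_ge_atTop (∑ i, j₀ (k i))] with n hn
    exact (h1 n hn).symm
  | zero =>
    have : x = 0 := Lp.ext (hxg.trans (Lp.coeFn_zero _ _ _).symm)
    simp [this]
  | add g g' hg hg' ih ih' =>
    have e : x = (memLp_of_mem_mTrigSpan hg p).toLp g + (memLp_of_mem_mTrigSpan hg' p).toLp g' := by
      rw [← MemLp.toLp_add]
      exact Lp.ext (hxg.trans (MemLp.coeFn_toLp _).symm)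
    have h := (ih (MemLp.coeFn_toLp (memLp_of_mem_mTrigSpan hg p))).add
      (ih' (MemLp.coeFn_toLp (memLp_of_mem_mTrigSpan hg' p)))
    rw [← e] at h
    refine h.congr fun n => ?_
    rw [← Finset.sum_add_distrib]
    refine Finset.sum_congr rfl fun j _ => ?_
    rw [e, map_add]
  | smul a g hg ih =>
    have e : x = a • (memLp_of_mem_mTrigSpan hg p).toLp g := by
      rw [← MemLp.toLp_const_smul]
      exact Lp.ext (hxg.trans (MemLp.coeFn_toLp _).symm)
    have h := (ih (MemLp.coeFn_toLp (memLp_of_mem_mTrigSpan hg p))).const_smul a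
    rw [← e] at h
    refine h.congr fun n => ?_
    rw [Finset.smul_sum]
    refine Finset.sum_congr rfl fun j _ => ?_
    rw [e, map_smul]

theorem tendsto_box_atTop : Filter.Tendsto (fun n : ℕ =>
    Fintype.piFinset fun _ : Fin d => Finset.range (n + 1)) Filter.atTop Filter.atTop := by
  refine Filter.tendsto_atTop_finset_of_monotone (fun a b hab => ?_) fun j => ⟨∑ i, j i, ?_⟩
  · exact Fintype.piFinset_subset _ _ fun _ => Finset.range_mono (by omega)
  · refine Fintype.mem_piFinset.2 fun i => Finset.mem_range.2 (Nat.lt_succ_of_le ?_)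
    exact Finset.single_le_sum (f := j) (fun _ _ => Nat.zero_le _) (Finset.mem_univ i)

/-- If `f = ∑_m v_m` and each `v_m` is the sum of the `E_j v_m`, then `f` is the sum of the `E_j f`,
provided that the double family is absolutely summable. -/
theorem hasSum_of_hasSum_double {ι X : Type*} [NormedAddCommGroup X] [NormedSpace ℂ X]
    [CompleteSpace X] {E : ι → X →L[ℂ] X} {v : ι → X} {f : X} (hv : HasSum v f)
    (hE : ∀ m, HasSum (fun j => E j (v m)) (v m)) (hs : ∑' j, ∑' m, ‖E j (v m)‖ₑ < ∞) :
    HasSum (fun j => E j f) f := by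
  have h1 : Summable fun z : ι × ι => E z.1 (v z.2) := by
    refine summable_of_tsum_enorm_lt_top ?_
    rwa [ENNReal.tsum_prod (f := fun j m => ‖E j (v m)‖ₑ)]
  have h2 := h1.hasSum
  have h3 : HasSum (fun j => E j f) (∑' z : ι × ι, E z.1 (v z.2)) :=
    h2.prod_fiberwise fun j => hv.mapL (E j)
  have h4 : HasSum v (∑' z : ι × ι, E z.1 (v z.2)) :=
    ((Equiv.prodComm ι ι).hasSum_iff.2 h2).prod_fiberwise hE
  rwa [h4.unique hv] at h3

end

/-! ### The norm equivalence -/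

section
variable {d : ℕ} {p θ : ℝ≥0∞} [Fact (1 ≤ p)] {φ φt : ℕ → Torus → ℂ} {ψ : ℕ → ℝ → ℂ} {r s : ℝ}
  {E : (Fin d → ℕ) → Lp ℂ p (volume : Measure (TorusD d)) →L[ℂ] Lp ℂ p (volume : Measure (TorusD d))}

theorem besovNorm_eq (hψ : IsSmoothResolution ψ) (f : TorusD d → ℂ) : besovNorm ψ p θ r f
    = ellNorm θ fun m => weight r m * ‖blockLp hψ p f m‖ₑ := by
  simp only [besovNorm, ellLpNorm_weighted, enorm_blockLp]

theorem enorm_blockLp_le (hψ : IsSmoothResolution ψ) (hθ : 1 ≤ θ) (f : TorusD d → ℂ)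
    (m : Fin d → ℕ) : ‖blockLp hψ p f m‖ₑ ≤ expKernel r 0 m * besovNorm ψ p θ r f := by
  have h : weight r m * ‖blockLp hψ p f m‖ₑ ≤ besovNorm ψ p θ r f := by
    rw [besovNorm_eq hψ]
    exact le_ellNorm hθ (fun m => weight r m * ‖blockLp hψ p f m‖ₑ) m
  rw [← inv_weight]
  calc ‖blockLp hψ p f m‖ₑ = (weight r m)⁻¹ * (weight r m * ‖blockLp hψ p f m‖ₑ) := by
        rw [← mul_assoc, ENNReal.inv_mul_cancel (weight_ne_zero r m) (weight_ne_top r m), one_mul]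
    _ ≤ _ := by gcongr

theorem tsum_enorm_blockLp_lt_top (hψ : IsSmoothResolution ψ) (hθ : 1 ≤ θ) (hr : 0 < r)
    {f : TorusD d → ℂ} (hf : besovNorm ψ p θ r f < ∞) : ∑' m, ‖blockLp hψ p f m‖ₑ < ∞ := by
  obtain ⟨A, hA⟩ := exists_tsum_expKernel_le d hr
  refine (ENNReal.tsum_le_tsum (enorm_blockLp_le (r := r) hψ hθ f)).trans_lt ?_
  rw [ENNReal.tsum_mul_right]
  exact ENNReal.mul_lt_top ((hA 0).trans_lt ENNReal.coe_lt_top) hf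

/-- The differences of the blocks decay exponentially off the diagonal, in the weighted norms. -/
theorem weight_mul_enorm_le (hψ : IsSmoothResolution ψ) {C' : ℝ≥0}
    (hu : ∀ f j m, ‖E j (blockLp hψ p f m)‖ₑ
      ≤ C' ^ d * (∏ i, ENNReal.ofReal (decay s (j i) (m i))) * ‖blockLp hψ p f m‖ₑ)
    (f : TorusD d → ℂ) (j m : Fin d → ℕ) : weight r j * ‖E j (blockLp hψ p f m)‖ₑ
      ≤ C' ^ d * expKernel (min r (s - r)) j m * (weight r m * ‖blockLp hψ p f m‖ₑ) := by
  calc weight r j * ‖E j (blockLp hψ p f m)‖ₑ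
      ≤ weight r j * (C' ^ d * (∏ i, ENNReal.ofReal (decay s (j i) (m i)))
        * ‖blockLp hψ p f m‖ₑ) := by gcongr; exact hu f j m
    _ = C' ^ d * (weight r j * ∏ i, ENNReal.ofReal (decay s (j i) (m i)))
        * ‖blockLp hψ p f m‖ₑ := by ring
    _ ≤ C' ^ d * (expKernel (min r (s - r)) j m * weight r m) * ‖blockLp hψ p f m‖ₑ := by
        gcongr C' ^ d * ?_ * _
        exact weight_mul_prod_decay_le j m
    _ = _ := by ring

/-- The double family `Δ_j(δ_m f)` is absolutely summable, because `‖Δ_j(δ_m f)‖_p` is bounded by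
`2^{-r|j|_1}` times a kernel whose row sums are bounded. -/
theorem tsum_tsum_enorm_lt_top (hψ : IsSmoothResolution ψ) (hθ : 1 ≤ θ) (hr : 0 < r) (hrs : r < s)
    {C' : ℝ≥0} (hu : ∀ f j m, ‖E j (blockLp hψ p f m)‖ₑ
      ≤ C' ^ d * (∏ i, ENNReal.ofReal (decay s (j i) (m i))) * ‖blockLp hψ p f m‖ₑ)
    {f : TorusD d → ℂ} (hf : besovNorm ψ p θ r f < ∞) :
    ∑' j, ∑' m, ‖E j (blockLp hψ p f m)‖ₑ < ∞ := by
  obtain ⟨A, hA⟩ := exists_tsum_expKernel_le d hr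
  obtain ⟨A', hA'⟩ := exists_tsum_expKernel_le d (lt_min hr (sub_pos.2 hrs))
  have hb : ∀ j m, ‖E j (blockLp hψ p f m)‖ₑ ≤ expKernel r 0 j *
      (C' ^ d * besovNorm ψ p θ r f * expKernel (min r (s - r)) j m) := fun j m => by
    have h1 : weight r m * ‖blockLp hψ p f m‖ₑ ≤ besovNorm ψ p θ r f := by
      rw [besovNorm_eq hψ]
      exact le_ellNorm hθ (fun m => weight r m * ‖blockLp hψ p f m‖ₑ) m
    rw [← inv_weight]
    calc ‖E j (blockLp hψ p f m)‖ₑ = (weight r j)⁻¹ * (weight r j * ‖E j (blockLp hψ p f m)‖ₑ) := by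
          rw [← mul_assoc, ENNReal.inv_mul_cancel (weight_ne_zero r j) (weight_ne_top r j), one_mul]
      _ ≤ (weight r j)⁻¹ * (C' ^ d * expKernel (min r (s - r)) j m *
          (weight r m * ‖blockLp hψ p f m‖ₑ)) := by
          gcongr _ * ?_
          exact weight_mul_enorm_le hψ hu f j m
      _ ≤ (weight r j)⁻¹ * (C' ^ d * expKernel (min r (s - r)) j m * besovNorm ψ p θ r f) := by
          gcongr
      _ = _ := by ring
  calc ∑' j, ∑' m, ‖E j (blockLp hψ p f m)‖ₑ
      ≤ ∑' j, expKernel r 0 j * (C' ^ d * besovNorm ψ p θ r f * A') := by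
        refine ENNReal.tsum_le_tsum fun j => (ENNReal.tsum_le_tsum (hb j)).trans ?_
        rw [ENNReal.tsum_mul_left, ENNReal.tsum_mul_left]
        gcongr
        exact hA' j
    _ = (∑' j, expKernel r 0 j) * (C' ^ d * besovNorm ψ p θ r f * A') := ENNReal.tsum_mul_right
    _ < ∞ := by
        refine ENNReal.mul_lt_top ((hA 0).trans_lt ENNReal.coe_lt_top) ?_
        refine ENNReal.mul_lt_top (ENNReal.mul_lt_top ?_ hf) ENNReal.coe_lt_top
        exact ENNReal.pow_lt_top ENNReal.coe_lt_top

/-- The representation `f = ∑_j Δ_j(f)` in `L_p`. -/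
theorem hasSum_mixedDiff (hψ : IsSmoothResolution ψ) (hθ : 1 ≤ θ) (hr : 0 < r) (hrs : r < s)
    {C C' : ℝ≥0} (hU : ∀ j, BoundedUnivariate p C (quasiInterpDiff φ φt j))
    (hlim : ∀ k : ℤ, ∃ lam : ℕ → ℂ, Filter.Tendsto lam Filter.atTop (nhds 1) ∧ ∃ j₀, ∀ j, j₀ ≤ j →
      quasiInterp φ φt j (fun x => fourier k x) = fun x => lam j * fourier k x)
    (hE : ∀ j x, E j x =ᵐ[volume] mixedDiff φ φt j x)
    (hu : ∀ f j m, ‖E j (blockLp hψ p f m)‖ₑ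
      ≤ C' ^ d * (∏ i, ENNReal.ofReal (decay s (j i) (m i))) * ‖blockLp hψ p f m‖ₑ)
    {f : TorusD d → ℂ} (hf : besovNorm ψ p θ r f < ∞)
    {x : Lp ℂ p (volume : Measure (TorusD d))} (hx : HasSum (blockLp hψ p f) x) :
    HasSum (fun j => E j x) x := by
  have hdouble := tsum_tsum_enorm_lt_top hψ hθ hr hrs hu hf
  refine hasSum_of_hasSum_double hx (fun m => ?_) hdouble
  have hcol : ∑' j, ‖E j (blockLp hψ p f m)‖ₑ < ∞ :=
    (ENNReal.tsum_le_tsum fun j =>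
      ENNReal.le_tsum (f := fun m => ‖E j (blockLp hψ p f m)‖ₑ) m).trans_lt hdouble
  have h1 := (summable_of_tsum_enorm_lt_top hcol).hasSum
  have h2 := tendsto_sum_mixedDiff_trigLp hU hlim hE
    ⟨_, dyadicBlock_mem hψ m f, coeFn_blockLp (p := p) hψ f m⟩
  rwa [tendsto_nhds_unique (Filter.Tendsto.comp h1 tendsto_box_atTop) h2] at h1

/-- The upper bound, by Schur's test applied to `Δ_j(f) = ∑_m Δ_j(δ_m f)`. -/
theorem ellNorm_mixedDiff_le (d : ℕ) (p : ℝ≥0∞) [Fact (1 ≤ p)] (hψ : IsSmoothResolution ψ)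
    (hθ : 1 ≤ θ) (hr : 0 < r) (hrs : r < s) (C' : ℝ≥0) : ∃ K : ℝ≥0,
    ∀ E : (Fin d → ℕ) → Lp ℂ p (volume : Measure (TorusD d)) →L[ℂ]
        Lp ℂ p (volume : Measure (TorusD d)),
      (∀ f j m, ‖E j (blockLp hψ p f m)‖ₑ
        ≤ C' ^ d * (∏ i, ENNReal.ofReal (decay s (j i) (m i))) * ‖blockLp hψ p f m‖ₑ) →
      ∀ (f : TorusD d → ℂ) (x : Lp ℂ p (volume : Measure (TorusD d))),
        HasSum (blockLp hψ p f) x →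
        ellNorm θ (fun j => weight r j * ‖E j x‖ₑ) ≤ K * besovNorm ψ p θ r f := by
  obtain ⟨A, hA⟩ := ellNorm_le_of_le_expKernel d hθ (lt_min hr (sub_pos.2 hrs))
  refine ⟨C' ^ d * A, fun E hu f x hx => ?_⟩
  rw [besovNorm_eq hψ, ENNReal.coe_mul, ENNReal.coe_pow]
  refine hA _ _ _ fun j => ?_
  have h1 : ‖E j x‖ₑ ≤ ∑' m, ‖E j (blockLp hψ p f m)‖ₑ := by
    rw [← (hx.mapL (E j)).tsum_eq]
    exact enorm_tsum_le_tsum_enorm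
  calc weight r j * ‖E j x‖ₑ ≤ ∑' m, weight r j * ‖E j (blockLp hψ p f m)‖ₑ := by
        rw [ENNReal.tsum_mul_left]
        gcongr
    _ ≤ _ := ENNReal.tsum_le_tsum fun m => weight_mul_enorm_le hψ hu f j m

/-- The lower bound: `δ_j(f) = ∑_m δ_j(Δ_m(f))`, where only the terms with `j_i ≤ m_i + 1` for all
`i` survive, since the spectrum of `Δ_m(f)` lies in the box `∏_i [-2^{m_i}, 2^{m_i})`. -/
theorem besovNorm_le (d : ℕ) (p : ℝ≥0∞) [Fact (1 ≤ p)] (hψ : IsSmoothResolution ψ)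
    (hθ : 1 ≤ θ) (hr : 0 < r) : ∃ K : ℝ≥0, ∀ (f : TorusD d → ℂ)
      (x : Lp ℂ p (volume : Measure (TorusD d)))
      (w : (Fin d → ℕ) → Lp ℂ p (volume : Measure (TorusD d))), x =ᵐ[volume] f → HasSum w x →
      (∀ m, w m ∈ (trigLp p fun i => Set.Ico (-(2 : ℤ) ^ m i) (2 ^ m i)).topologicalClosure) →
      besovNorm ψ p θ r f ≤ K * ellNorm θ (fun m => weight r m * ‖w m‖ₑ) := by
  obtain ⟨M, hM⟩ := resolution_multBound hψ p
  obtain ⟨A, hA⟩ := ellNorm_le_of_le_expKernel d hθ hr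
  obtain ⟨G, hG⟩ : ∃ G : ℝ≥0, (G : ℝ≥0∞) = ENNReal.ofReal ((2 : ℝ) ^ (2 * r)) := ⟨_, rfl⟩
  refine ⟨M ^ d * G ^ d * A, fun f x w hxf hw hspec => ?_⟩
  rw [besovNorm_eq hψ, ENNReal.coe_mul]
  refine hA _ _ _ fun j => ?_
  obtain ⟨D, hD⟩ := exists_dyadicBlock_clm hψ p j
  have hDx : D x = blockLp hψ p f j := by
    refine Lp.ext ((hD x).trans ?_)
    rw [dyadicBlock_congr_ae hψ j hxf]
    exact (coeFn_blockLp hψ f j).symm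
  have h1 : ‖blockLp hψ p f j‖ₑ ≤ ∑' m, ‖D (w m)‖ₑ := by
    rw [← hDx, ← (hw.mapL D).tsum_eq]
    exact enorm_tsum_le_tsum_enorm
  calc weight r j * ‖blockLp hψ p f j‖ₑ ≤ ∑' m, weight r j * ‖D (w m)‖ₑ := by
        rw [ENNReal.tsum_mul_left]
        gcongr
    _ ≤ _ := ENNReal.tsum_le_tsum fun m => ?_
  by_cases h : ∀ i, j i ≤ m i + 1
  · calc weight r j * ‖D (w m)‖ₑ
        ≤ (G ^ d * expKernel r j m * weight r m) * ((M ^ d : ℝ≥0) * ‖w m‖ₑ) := by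
          refine mul_le_mul' ?_ (enorm_blockClm_le hψ hM hD (hspec m))
          rw [hG]
          exact weight_le_expKernel hr.le h
      _ = _ := by
          push_cast
          ring
  · push Not at h
    obtain ⟨i, hi⟩ := h
    have hdisj : Disjoint (Set.Ico (-(2 : ℤ) ^ m i) (2 ^ m i)) (dyadicSet (j i)) := by
      refine Set.disjoint_left.2 fun k hk hk' => ?_
      have h2 := hk'.2 (by omega)
      have h3 : (2 : ℝ) ^ (m i + 2) ≤ 2 ^ j i := pow_le_pow_right₀ one_le_two (by omega)
      have h4 : |k| ≤ 2 ^ m i := abs_le.2 ⟨hk.1, hk.2.le⟩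
      have h5 : |(k : ℝ)| ≤ 2 ^ m i := by exact_mod_cast h4
      have h6 : (0 : ℝ) < 2 ^ m i := by positivity
      rw [pow_add] at h3
      linarith
    rw [blockClm_eq_zero hψ hD hdisj (hspec m)]
    simp

end

theorem theorem4p1 (d : ℕ) (p θ : ℝ≥0∞) [Fact (1 ≤ p)] (hθ : 1 ≤ θ)
    (r s : ℝ) (hr : 0 < r) (hrs : r < s)
    (ψ : ℕ → ℝ → ℂ) (hψ : IsSmoothResolution ψ)
    (κ : ℂ) (hκ : ‖κ‖ = 1)
    (φ φt : ℕ → Torus → ℂ)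
    (hφ : ∀ j, φ j ∈ trigPoly j)
    (hband : ∃ ε : ℝ, 0 < ε ∧ ∀ (j : ℕ) (k : ℤ),
      (1 - ε) * 2 ^ j < |(k : ℝ)| → fourierCoeff (φ j) k = 0)
    (hφM : UniformlyBoundedMultipliers p fun j k => fourierCoeff (φ j) k)
    (hφt : ∀ j, MemLp (φt j) p.conjExponent volume)
    (hφtL : ⨆ j, specialNorm p.conjExponent j (φt j) < ∞)
    (hwc : Compatibility ψ φ φt p κ s) :
    (∀ f : TorusD d → ℂ, MemBesov ψ p θ r f →
      ∃ (hf : MemLp f p volume) (hΔ : ∀ j : Fin d → ℕ, MemLp (mixedDiff φ φt j f) p volume),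
        HasSum (fun j : Fin d → ℕ => (hΔ j).toLp (mixedDiff φ φt j f)) (hf.toLp f)) ∧
    ∃ c C : ℝ, 0 < c ∧ 0 < C ∧ ∀ f : TorusD d → ℂ, MemBesov ψ p θ r f →
      ENNReal.ofReal c * besovNorm ψ p θ r f
          ≤ ellLpNorm θ p (weighted r fun j => mixedDiff φ φt j f) ∧
        ellLpNorm θ p (weighted r fun j => mixedDiff φ φt j f)
          ≤ ENNReal.ofReal C * besovNorm ψ p θ r f := by


  have hq : ENNReal.HolderConjugate p p.conjExponent := inferInstance
  have hp : 1 ≤ p := Fact.out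
  have hφc : ∀ j, Continuous (φ j) := fun j => continuous_of_mem_trigPoly (hφ j)
  have hφi : ∀ j, Integrable (φt j) volume := fun j =>
    (hφt j).integrable (ENNReal.HolderConjugate.one_le p.conjExponent p)
  obtain ⟨M, hM⟩ := hφM.exists_multBound hp
  set S : ℝ≥0 := (⨆ j, specialNorm p.conjExponent j (φt j)).toNNReal with hSdef
  have hS : ∀ j, specialNorm p.conjExponent j (φt j) ≤ S := fun j => by
    rw [hSdef, ENNReal.coe_toNNReal hφtL.ne]
    exact le_iSup (fun j => specialNorm p.conjExponent j (φt j)) j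
  have hQ : ∀ j h, MemLp h p volume →
      eLpNorm (quasiInterp φ φt j h) p volume ≤ (M * 3 * S * 7 : ℝ≥0) * eLpNorm h p volume :=
    fun j h hh => eLpNorm_quasiInterp_le (hφ j) (hM j) (hφt j) (hS j) hh
  obtain ⟨C₂, hA⟩ := exists_approximation_bound (hr.trans hrs) hψ hκ hφ hband hφi hwc hQ
  obtain ⟨C', hΔ⟩ := exists_quasiInterpDiff_bound hφc hQ hA
  have hlim := tendsto_quasiInterp_symbol (hr.trans hrs) hφ hband hφi hA
  have hU := boundedUnivariate_quasiInterpDiff hφc hφt hQ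
  choose E hE using fun j : Fin d → ℕ => exists_composeVars_clm (p := p)
    (U := fun i => quasiInterpDiff φ φt (j i)) (fun i => hU (j i)) (List.finRange d)
  have hcong : ∀ (j : Fin d → ℕ) {f g : TorusD d → ℂ}, f =ᵐ[volume] g →
      mixedDiff φ φt j f =ᵐ[volume] mixedDiff φ φt j g := fun j f g h =>
    composeVars_congr (U := fun i => quasiInterpDiff φ φt (j i)) (fun i => hU (j i)) _ h
  have hspan := fun (f : TorusD d → ℂ) j m =>
    mixedDiff_mTrigSpan hp hφ hU hΔ j m (dyadicBlock_mem hψ m f)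
  have hEv : ∀ f j m, E j (blockLp hψ p f m) =ᵐ[volume] mixedDiff φ φt j (dyadicBlock ψ m f) :=
    fun f j m => (hE j _).trans (hcong j (coeFn_blockLp hψ f m))
  have hu : ∀ f j m, ‖E j (blockLp hψ p f m)‖ₑ
      ≤ C' ^ d * (∏ i, ENNReal.ofReal (decay s (j i) (m i))) * ‖blockLp hψ p f m‖ₑ :=
    fun f j m => by
      rw [Lp.enorm_def, eLpNorm_congr_ae (hEv f j m), enorm_blockLp]
      exact (hspan f j m).2
  have hrep : ∀ f : TorusD d → ℂ, MemBesov ψ p θ r f →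
      ∃ hf : MemLp f p volume, HasSum (blockLp hψ p f) (hf.toLp f) := fun f hf =>
    hasSum_blockLp hψ hf.1 (tsum_enorm_blockLp_lt_top hψ hθ hr hf.2)
  have hmem : ∀ f : TorusD d → ℂ, MemLp f p volume → ∀ j, MemLp (mixedDiff φ φt j f) p volume :=
    fun f hf j => (memLp_composeVars (U := fun i => quasiInterpDiff φ φt (j i))
      (fun i => hU (j i)) hp _ hf).1
  have hEf : ∀ (f : TorusD d → ℂ) (hf : MemLp f p volume) j,
      E j (hf.toLp f) = (hmem f hf j).toLp _ := fun f hf j =>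
    Lp.ext (((hE j _).trans (hcong j hf.coeFn_toLp)).trans (MemLp.coeFn_toLp _).symm)
  have hsum : ∀ (f : TorusD d → ℂ) (hB : MemBesov ψ p θ r f) (hf : MemLp f p volume),
      HasSum (blockLp hψ p f) (hf.toLp f) → HasSum (fun j => E j (hf.toLp f)) (hf.toLp f) :=
    fun f hB hf hv => hasSum_mixedDiff hψ hθ hr hrs hU hlim hE hu hB.2 hv
  refine ⟨fun f hB => ?_, ?_⟩
  · obtain ⟨hf, hv⟩ := hrep f hB
    refine ⟨hf, hmem f hf, ?_⟩
    simpa only [hEf] using hsum f hB hf hv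
  -- The constants are enlarged by `1` to make them positive.
  obtain ⟨K₁, hK₁⟩ := ellNorm_mixedDiff_le d p hψ hθ hr hrs C'
  obtain ⟨K₂, hK₂⟩ := besovNorm_le (θ := θ) d p hψ hθ hr
  refine ⟨((K₂ + 1 : ℝ≥0) : ℝ)⁻¹, (K₁ + 1 : ℝ≥0), by positivity, by positivity, fun f hB => ?_⟩
  obtain ⟨hf, hv⟩ := hrep f hB
  have hnorm : ellLpNorm θ p (weighted r fun j => mixedDiff φ φt j f)
      = ellNorm θ fun j => weight r j * ‖E j (hf.toLp f)‖ₑ := by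
    simp only [ellLpNorm_weighted, hEf, Lp.enorm_toLp]
  rw [hnorm]
  constructor
  · have h1 := hK₂ f (hf.toLp f) (fun j => E j (hf.toLp f)) hf.coeFn_toLp (hsum f hB hf hv)
      fun j => mem_closure_of_tendsto (hv.mapL (E j)) (Filter.Eventually.of_forall fun G =>
        AddSubgroup.sum_mem _ fun m _ => ⟨_, (hspan f j m).1, hEv f j m⟩)
    have h2 : ((K₂ + 1 : ℝ≥0) : ℝ≥0∞) ≠ 0 := by
      rw [ENNReal.coe_ne_zero]
      positivity
    rw [ENNReal.ofReal_inv_of_pos (by positivity), ENNReal.ofReal_coe_nnreal,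
      ENNReal.inv_mul_le_iff h2 ENNReal.coe_ne_top]
    refine h1.trans ?_
    gcongr
    exact le_self_add
  · rw [ENNReal.ofReal_coe_nnreal]
    refine (hK₁ E hu f (hf.toLp f) hv).trans ?_
    gcongr
    exact le_self_add

end
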